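/- Let $d\ge 1$ and let $\|\cdot\|$ be the Euclidean norm on $\mathbb{R}^d$. Let $S\subset\mathbb{R}^d$ be a nonempty compact convex set of diameter at most a known $R>0$, and let $f$ be differentiable on $S$ with gradient $\nabla f$ and $x^*\in\arg\min_S f$. For $x\in S$ and a coordinate $j$ let $x_j^*=x+\alpha e_j$, where $\alpha$ minimizes $f(x+\alpha e_j)$ over $\{\alpha: x+\alpha e_j\in S\}$. * $f$ is $k$-uniformly convex ($k\ge2$) with constant $\lambda>0$ if $f(y)\ge f(x)+\nabla f(x)^\top(y-x)+\frac{\lambda}{2}\|x-y\|^k$ for all $x,y\in S$. * $f$ is locally $k$-strongly smooth (LkSS) with constant $\Lambda>\lambda/2$ if $|[\nabla f(x)]_j|\le\Lambda\|x-x_j^*\|^{k-1}$ for all $x\in S$ and all $j$. * A stochastic sign oracle for $f$ with constants $0<a\le b$ and $\tau>0$ answers a query $(x,j)$, $x\in S$, by $+$ with probability $\eta_j(x)$ and by $-$ otherwise, each answer being independent of the past given the query, where $\eta_j$ is measurable, $\eta_j(x)>\frac12$ if $[\nabla f(x)]_j>0$, $\eta_j(x)<\frac12$ if $[\nabla f(x)]_j<0$,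 and $a\,|[\nabla f(x)]_j|\le|\eta_j(x)-\frac12|\le b\,|[\nabla f(x)]_j|$ whenever $|[\nabla f(x)]_j|\le\tau$. *Adaptive line search* $LS(x,j,n)$, with a tuning constant $c$, $c^2>2$. Put $E'=\lceil\log_2\sqrt{2n/(c^2\log n)}\,\rceil$ ($0$ if this is negative or $n\le1$) and $N=\lfloor n/E'\rfloor$. Start at position $\alpha_0=0$ on the line $\alpha\mapsto x+\alpha e_j$. For $i=1,\dots,E'$, query the oracle in coordinate $j$ at $N$ independent uniform points of the part of the line that lies in $S$ and at positions within $2^{-(i-1)}R$ of $\alpha_{i-1}$; let $\alpha_i$ be a position in that interval (the left end of the interval or a sampled one) whose threshold classifier "$+$ to the right of $\alpha_i$, $-$ elsewhere" misclassifies the fewest answers. Return $x+\alpha_{E'}e_j$. *Randomized Stochastic-Sign Coordinate Descent* (RSSCD). With query budget $T\ge2$, start at any $x_0\in S$, put $E=\lceil d(\log T)^2\rceil$, and for $e=1,\dots,E$ choose a coordinate $j_e$ uniformly at random and set $x_e=LS(x_{e-1},j_e,\lfloor T/E\rfloor)$. Output $\hat x_T=x_E$. The algorithm makes at most $T$ queries,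 all at points of $S$, and uses none of $k,\lambda,\Lambda,a,b,\tau$. **Theorem.** 1. (Rate, adaptively.) For all $d,R,c,k,\lambda,\Lambda,a,b,\tau$ as above there are $C$ and $p\in\mathbb{N}$, depending only on these, such that for every $S$, every $x_0\in S$, every $T\ge2$, every $f$ on $S$ that is $k$-uniformly convex with constant $\lambda$ and LkSS with constant $\Lambda$, and every stochastic sign oracle for $f$ with constants $a,b,\tau$, RSSCD satisfies $$\mathbb{E}[f(\hat x_T)]-f(x^*)\le C(\log T)^p\,T^{-\frac{k}{2k-2}}.$$ 2. (The rate is minimax.) For all $d\ge1$, $s>0$, $k\ge2$, $\lambda>0$, $\tau>0$ there are $\Lambda>\lambda/2$, $0<a\le b$ and $c_0>0$ such that for every $T\ge1$ and every randomized algorithm that adaptively makes at most $T$ queries to a sign oracle at points of the cube $S=[0,s]^d$ and outputs a point $\hat x_T\in S$, there are a function $f$ on $S$, $k$-uniformly convex with constant $\lambda$ and LkSS with constant $\Lambda$, and a stochastic sign oracle for $f$ with constants $a,b,\tau$, for which $$\mathbb{E}[f(\hat x_T)]-f(x^*)\ge c_0\,T^{-\frac{k}{2k-2}}.$$ 3.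 (Strongly convex, strongly smooth functions.) For all $d,R,c,a,b,\tau$ as above and all $H>\lambda>0$ there are $C$ and $p\in\mathbb{N}$, depending only on these, such that for every $S$, every $x_0\in S$, every $T\ge2$, every $f$ that is $2$-uniformly convex with constant $\lambda$, satisfies $\|\nabla f(x)-\nabla f(y)\|\le H\|x-y\|$ on $S$ and satisfies $[\nabla f(x_j^*)]_j=0$ for all $x\in S$ and all $j$, and every stochastic sign oracle for $f$ with constants $a,b,\tau$, RSSCD satisfies $$\mathbb{E}[f(\hat x_T)]-f(x^*)\le C(\log T)^p\,T^{-1}.$$ -/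

import Mathlib

open MeasureTheory

/-! ### Function classes -/

/-- `ℝ^d` with the Euclidean norm. -/
abbrev Point (d : ℕ) : Type := EuclideanSpace ℝ (Fin d)

/-- The point `x + α e_j`. -/
noncomputable def along {d : ℕ} (x : Point d) (j : Fin d) (α : ℝ) : Point d :=
  x + α • EuclideanSpace.single j (1 : ℝ)

/-- `g` is a gradient field of `f` on `S`. -/
def IsGradientOn {d : ℕ} (S : Set (Point d)) (f : Point d → ℝ) (g : Point d → Point d) : Prop :=
  ∀ x ∈ S, HasGradientWithinAt f (g x) S x

/-- `k`-uniform convexity on `S` with constant `lam`. -/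
def IsUC {d : ℕ} (S : Set (Point d)) (f : Point d → ℝ) (g : Point d → Point d)
    (k lam : ℝ) : Prop :=
  ∀ x ∈ S, ∀ y ∈ S, f x + inner ℝ (g x) (y - x) + lam / 2 * ‖x - y‖ ^ k ≤ f y

/-- `α` minimizes `β ↦ f (x + β e_j)` over `{β | x + β e_j ∈ S}`; then `along x j α` is the
directional minimum `x_j^*`. -/
def IsDirMin {d : ℕ} (S : Set (Point d)) (f : Point d → ℝ) (x : Point d) (j : Fin d)
    (α : ℝ) : Prop :=
  along x j α ∈ S ∧ ∀ β, along x j β ∈ S → f (along x j α) ≤ f (along x j β)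

/-- Local `k`-strong smoothness on `S` with constant `Lam`. -/
def IsLkSS {d : ℕ} (S : Set (Point d)) (f : Point d → ℝ) (g : Point d → Point d)
    (k Lam : ℝ) : Prop :=
  ∀ x ∈ S, ∀ j α, IsDirMin S f x j α → |g x j| ≤ Lam * ‖x - along x j α‖ ^ (k - 1)

/-- `H`-strong smoothness: the gradient is `H`-Lipschitz on `S`. -/
def IsStronglySmooth {d : ℕ} (S : Set (Point d)) (g : Point d → Point d) (H : ℝ) : Prop :=
  ∀ x ∈ S, ∀ y ∈ S, ‖g x - g y‖ ≤ H * ‖x - y‖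

/-- The partial derivative in direction `j` vanishes at every directional minimum. -/
def DirMinStationary {d : ℕ} (S : Set (Point d)) (f : Point d → ℝ) (g : Point d → Point d) :
    Prop :=
  ∀ x ∈ S, ∀ j α, IsDirMin S f x j α → g (along x j α) j = 0

/-! ### Sign oracles -/

/-- `η x j` is the probability that the oracle answers `+` when it is asked for the sign of the
`j`-th partial derivative at `x`. The more likely answer is the correct sign, and
`|η - 1/2|` is of the order of `|g_j|` (with constants `a`, `b`) wherever `|g_j| ≤ τ`. -/
structure IsSignOracle {d : ℕ} (S : Set (Point d)) (g : Point d → Point d)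
    (η : Point d → Fin d → unitInterval) (a b τ : ℝ) : Prop where
  measurable : ∀ j, Measurable fun x => η x j
  pos : ∀ x ∈ S, ∀ j, 0 < g x j → 1 / 2 < (η x j : ℝ)
  neg : ∀ x ∈ S, ∀ j, g x j < 0 → (η x j : ℝ) < 1 / 2
  order : ∀ x ∈ S, ∀ j, |g x j| ≤ τ →
    a * |g x j| ≤ |(η x j : ℝ) - 1 / 2| ∧ |(η x j : ℝ) - 1 / 2| ≤ b * |g x j|

/-! ### Algorithms that query a sign oracle -/

/-- A randomized algorithm with seed `ω : Ω`. Given the seed and the list of the answers received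
so far (oldest first, `true` for `+`), `query` is the next query; `output` is the final
estimate. -/
structure SignAlgorithm (d : ℕ) (Ω : Type*) where
  numQueries : ℕ
  query : Ω → List Bool → Point d × Fin d
  output : Ω → List Bool → Point d

namespace SignAlgorithm

variable {d : ℕ} {Ω : Type*}

/-- At most `T` queries, all queries and the output in `S`, everything measurable in the seed. -/
structure IsAdmissible [MeasurableSpace Ω] (A : SignAlgorithm d Ω) (S : Set (Point d)) (T : ℕ) :
    Prop where
  budget : A.numQueries ≤ T
  query_mem : ∀ ω h, h.length < A.numQueries → (A.query ω h).1 ∈ S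
  output_mem : ∀ ω h, h.length = A.numQueries → A.output ω h ∈ S
  query_measurable : ∀ h, h.length < A.numQueries → Measurable fun ω => A.query ω h
  output_measurable : ∀ h, h.length = A.numQueries → Measurable fun ω => A.output ω h

/-- Conditional expectation of `cost` at the output, given the seed `ω` and the answers `h`
received so far, with `n` queries still to be made: each answer is `+` with probability `η` at the
query, independently of the past given the query. -/
noncomputable def expectedFrom (A : SignAlgorithm d Ω) (η : Point d → Fin d → unitInterval)
    (cost : Point d → ENNReal) (ω : Ω) : ℕ → List Bool → ENNReal
  | 0, h => cost (A.output ω h)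
  | n + 1, h =>
    ENNReal.ofReal (η (A.query ω h).1 (A.query ω h).2) *
        A.expectedFrom η cost ω n (h ++ [true]) +
      ENNReal.ofReal (1 - (η (A.query ω h).1 (A.query ω h).2 : ℝ)) *
        A.expectedFrom η cost ω n (h ++ [false])

/-- Expected function error `E [f x̂ - f x^*]` over the seed (with law `μ`) and the answers. -/
noncomputable def expectedError [MeasurableSpace Ω] (A : SignAlgorithm d Ω) (μ : Measure Ω)
    (η : Point d → Fin d → unitInterval) (f : Point d → ℝ) (xstar : Point d) : ENNReal :=
  ∫⁻ ω, A.expectedFrom η (fun x => ENNReal.ofReal (f x - f xstar)) ω A.numQueries [] ∂μ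

end SignAlgorithm

/-! ### The adaptive one-dimensional active learner

Points on the line through `x` in direction `e_j` are described by `α ↦ along x j α`. -/

/-- Left end of the part of the line that lies in `S` and within distance `r` of position `α`. -/
noncomputable def searchLo {d : ℕ} (S : Set (Point d)) (x : Point d) (j : Fin d) (r α : ℝ) : ℝ :=
  max (sInf {β | along x j β ∈ S}) (α - r)

/-- Right end of the part of the line that lies in `S` and within distance `r` of position `α`. -/
noncomputable def searchHi {d : ℕ} (S : Set (Point d)) (x : Point d) (j : Fin d) (r α : ℝ) : ℝ :=
  min (sSup {β | along x j β ∈ S}) (α + r)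

/-- The position in the search interval that corresponds to `u ∈ [0, 1]`. -/
noncomputable def samplePos {d : ℕ} (S : Set (Point d)) (x : Point d) (j : Fin d) (r α : ℝ)
    (u : unitInterval) : ℝ :=
  searchLo S x j r α + u * (searchHi S x j r α - searchLo S x j r α)

open Classical in
/-- Number of labelled points misclassified by the rule `+` to the right of `t`, `-` elsewhere. -/
noncomputable def empError (data : List (ℝ × Bool)) (t : ℝ) : ℕ :=
  data.countP fun p => p.2 != decide (t < p.1)

/-- Empirical risk minimization over thresholds: the first minimizer of the empirical error among
the left end `lo` and the sample points (these realize every labelling by a threshold). -/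
noncomputable def ermThreshold (lo : ℝ) (data : List (ℝ × Bool)) : ℝ :=
  ((lo :: data.map Prod.fst).argmin (empError data)).getD lo

/-- Adaptive threshold learner: position after `i` epochs, started at `0`. Epoch `i` (counted from
`0`) runs empirical risk minimization on `N` uniform points of the search interval of radius
`R / 2 ^ i` around the current position. `u` are the uniform seeds, `y` the answers. -/
noncomputable def learnerPos {d : ℕ} (S : Set (Point d)) (R : ℝ) (N : ℕ) (x : Point d) (j : Fin d)
    (u : ℕ → unitInterval) (y : ℕ → Bool) : ℕ → ℝ
  | 0 => 0
  | i + 1 =>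
    let α := learnerPos S R N x j u y i
    ermThreshold (searchLo S x j (R / 2 ^ i) α)
      ((List.range N).map fun s =>
        (samplePos S x j (R / 2 ^ i) α (u (i * N + s)), y (i * N + s)))

/-- Number of epochs of the learner with budget `n`: `log₂ √(2n / (c² log n))`, rounded up. -/
noncomputable def learnerEpochs (c : ℝ) (n : ℕ) : ℕ :=
  ⌈Real.logb 2 (Real.sqrt (2 * n / (c ^ 2 * Real.log n)))⌉₊

/-! ### Randomized stochastic-sign coordinate descent -/

/-- Number of epochs of coordinate descent: `d (log T)²`, rounded up. -/
noncomputable def cdEpochs (d T : ℕ) : ℕ := ⌈(d : ℝ) * Real.log T ^ 2⌉₊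

/-- Number of learner epochs per line search, whose budget is `T / E` queries. -/
noncomputable def lsEpochs (c : ℝ) (d T : ℕ) : ℕ := learnerEpochs c (T / cdEpochs d T)

/-- Number of queries per learner epoch. -/
noncomputable def lsSamples (c : ℝ) (d T : ℕ) : ℕ := T / cdEpochs d T / lsEpochs c d T

/-- Seeds of coordinate descent: the coordinates of its epochs, and one number in `[0, 1]` for each
query. -/
abbrev CDSeed (d : ℕ) : Type := (ℕ → Fin d) × (ℕ → unitInterval)

/-- All seeds are independent and uniform. -/
noncomputable def cdSeedLaw (d : ℕ) : Measure (CDSeed d) :=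
  (Measure.infinitePi fun _ : ℕ => ProbabilityTheory.uniformOn (Set.univ : Set (Fin d))).prod
    (Measure.infinitePi fun _ : ℕ => (volume : Measure unitInterval))

/-- Position on the line of epoch `e`, started from `x`, after `i` epochs of its line search. The
line search of epoch `e` consumes the answers and seeds number `e M, e M + 1, …`, where `M` is the
number of queries per line search. -/
noncomputable def cdLinePos {d : ℕ} (S : Set (Point d)) (R c : ℝ) (T : ℕ) (ω : CDSeed d)
    (y : ℕ → Bool) (e : ℕ) (x : Point d) (i : ℕ) : ℝ :=
  let M := lsEpochs c d T * lsSamples c d T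
  learnerPos S R (lsSamples c d T) x (ω.1 e) (fun m => ω.2 (e * M + m)) (fun m => y (e * M + m)) i

/-- The iterate `x_e` of coordinate descent. -/
noncomputable def cdPoint {d : ℕ} (S : Set (Point d)) (R c : ℝ) (x₀ : Point d) (T : ℕ)
    (ω : CDSeed d) (y : ℕ → Bool) : ℕ → Point d
  | 0 => x₀
  | e + 1 =>
    let x := cdPoint S R c x₀ T ω y e
    along x (ω.1 e) (cdLinePos S R c T ω y e x (lsEpochs c d T))

/-- Randomized stochastic-sign coordinate descent on `S` (of diameter at most `R`) with query budget
`T`, started at `x₀`, with the adaptive threshold learner as its line search. Query number `m` is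
the one of epoch `e = m / M`, learner epoch `i = (m % M) / N`. -/
noncomputable def rsscd {d : ℕ} (S : Set (Point d)) (R c : ℝ) (x₀ : Point d) (T : ℕ) :
    SignAlgorithm d (CDSeed d) where
  numQueries := cdEpochs d T * (lsEpochs c d T * lsSamples c d T)
  query ω h :=
    let y : ℕ → Bool := fun m => h.getD m false
    let m := h.length
    let N := lsSamples c d T
    let M := lsEpochs c d T * N
    let e := m / M
    let i := m % M / N
    let x := cdPoint S R c x₀ T ω y e
    (along x (ω.1 e) (samplePos S x (ω.1 e) (R / 2 ^ i) (cdLinePos S R c T ω y e x i) (ω.2 m)),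
      ω.1 e)
  output ω h := cdPoint S R c x₀ T ω (fun m => h.getD m false) (cdEpochs d T)

/-- The cube `[0, s]^d`. -/
def cube (d : ℕ) (s : ℝ) : Set (Point d) := {x | ∀ i, x i ∈ Set.Icc 0 s}

/-! Along a coordinate line with directional minimum `αs`, uniform convexity and local strong
smoothness pin the size of the partial derivative at `β` between multiples of `|β - αs| ^ (k - 1)`
(`IsUC.lower_le_abs`, `IsLkSS.abs_le`). Through the oracle, a line search is thus the learning of a
threshold from labels whose bias near the threshold is of order distance to the power `k - 1`, a
Tsybakov noise condition.

Line search. In an epoch of radius `r`, a threshold farther than `r / 2` from `αs` is separated from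
it by positions of constant probability and bias of order `r ^ (k - 1)`, so its mean excess loss has
this order too. A Chernoff bound (`measure_ermThreshold_far_le`) rules out all such thresholds as
long as `N * r ^ (2 * k - 2)` exceeds a multiple of `log T`. Hence the distance bound halves in each
epoch until `r` is of order `(log T / N) ^ (1 / (2 * k - 2))` (`exists_stopping_epoch`). Below this
scale the epochs may fail, but their radii form a geometric series, so they move the position by at
most `2 * r` (`abs_noisyPos_sub_le`). This makes the learner adaptive: without knowing `k` it ends
within `3 * r` of `αs`, with function error at most `Lam * (3 * r) ^ k`, which has the claimed rate
up to logarithms.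

Descent. The error at `x` is at most a constant times the sum of the gains of exact line searches in
all coordinates (`error_le_sum_gain`). A random coordinate therefore contracts the expected error by
a fixed factor `1 - γ`, up to the inaccuracy of the line search (`lintegral_noisyPoint_le`). The
inaccuracies add up to a geometric series, and the squared logarithm in the number of epochs makes
the initial error negligible (`contraction_pow_le`).

Probability. Each answer is realized as the comparison of an independent uniform variable with `η`;
the recursive expectation becomes an integral over one sequence of independent pairs of a position
seed and an answer seed (`expectedFrom_eq_lintegral_simulate`, `expectedError_rsscd`). Conditioning
on the past is then a splitting of that sequence (`lintegral_concatSeq`).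

Lower bound. This is a two-point argument with separable powers whose minima are `δ` apart in one
coordinate. Their oracles differ only at distance of order `δ`, where both biases are of order `δ ^
(k - 1)`, so a query lowers the Hellinger affinity by a factor `1 - χ` at worst, with `χ` of order
`δ ^ (2 * k - 2)`. For `χ = 1 / (4 * T)` the two cases cannot be told apart, and one of them costs
order `δ ^ k` (`expectedFrom_two_point`, `sq_signBias_sub_le`).

The last statement is the case `k = 2` of the first (`IsStronglySmooth.isLkSS`). -/

/-! ### Independent sequences -/

section Sequences

/-- The law of an independent sequence of variables with law `μ`. -/
noncomputable abbrev seqLaw {X : Type*} [MeasurableSpace X] (μ : Measure X) : Measure (ℕ → X) := Measure.infinitePi fun _ : ℕ => μ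

/-- The sequence that starts with the first `n` entries of `a` and goes on with `b`. -/
def concatSeq {X : Type*} (n : ℕ) (a b : ℕ → X) : ℕ → X := fun i => if i < n then a i else b (i - n)

theorem concatSeq_of_lt {X : Type*} {n i : ℕ} (a b : ℕ → X) (h : i < n) : concatSeq n a b i = a i := if_pos h

theorem concatSeq_add {X : Type*} (n i : ℕ) (a b : ℕ → X) : concatSeq n a b (n + i) = b i := by
  simp [concatSeq]

variable {X Y : Type*} [MeasurableSpace X] [MeasurableSpace Y]

theorem measurable_concatSeq (n : ℕ) :
    Measurable fun p : (ℕ → X) × (ℕ → X) => concatSeq n p.1 p.2 := by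
  refine measurable_pi_lambda _ fun i => ?_
  unfold concatSeq
  split_ifs <;> fun_prop

theorem measurable_update_seq (r : ℕ) :
    Measurable fun p : (ℕ → X) × X => Function.update p.1 r p.2 := by
  refine measurable_pi_lambda _ fun i => ?_
  by_cases h : i = r
  · subst h; simpa using measurable_snd
  · simp only [Function.update_of_ne h]; fun_prop

/-- On a cylinder the factor of index `r` splits off the product of measures. Resampling one entry
is how a single sample is integrated separately from the others. -/
theorem measurePreserving_update (μ : Measure X) [IsProbabilityMeasure μ] (r : ℕ) :
    MeasurePreserving (fun p : (ℕ → X) × X => Function.update p.1 r p.2)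
      ((seqLaw μ).prod μ) (seqLaw μ) := by
  refine ⟨measurable_update_seq r, Measure.eq_infinitePi _ fun s t ht => ?_⟩
  rw [Measure.map_apply (measurable_update_seq r) (.pi s.countable_toSet fun i _ => ht i)]
  have : (fun p : (ℕ → X) × X => Function.update p.1 r p.2) ⁻¹' (Set.pi s t) =
      (Set.pi (s.erase r : Finset ℕ) t) ×ˢ (if r ∈ s then t r else Set.univ) := by
    ext ⟨a, b⟩
    simp only [Set.mem_preimage, Set.mem_pi, Set.mem_prod, Finset.mem_coe, Finset.mem_erase]
    constructor
    · refine fun h => ⟨fun i hi => ?_, ?_⟩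
      · simpa [Function.update_of_ne hi.1] using h i hi.2
      · split_ifs with hr
        · simpa using h r hr
        · trivial
    · rintro ⟨h1, h2⟩ i hi
      by_cases hir : i = r
      · subst hir; simpa [hi] using h2
      · simpa [Function.update_of_ne hir] using h1 i ⟨hir, hi⟩
  rw [this, Measure.prod_prod, Measure.infinitePi_pi _ fun i _ => ht i]
  split_ifs with hr
  · rw [mul_comm, Finset.mul_prod_erase s (fun i => μ (t i)) hr]
  · rw [measure_univ, mul_one, Finset.erase_eq_of_notMem hr]

/-- A cylinder splits into its indices below `n` and the shifted rest. This is the tool for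
conditioning: fix the first `n` entries and integrate over a fresh continuation. -/
theorem measurePreserving_concatSeq (μ : Measure X) [IsProbabilityMeasure μ] (n : ℕ) :
    MeasurePreserving (fun p : (ℕ → X) × (ℕ → X) => concatSeq n p.1 p.2)
      ((seqLaw μ).prod (seqLaw μ)) (seqLaw μ) := by
  refine ⟨measurable_concatSeq n, Measure.eq_infinitePi _ fun s t ht => ?_⟩
  rw [Measure.map_apply (measurable_concatSeq n) (.pi s.countable_toSet fun i _ => ht i)]
  have hinj : Set.InjOn (fun i => n + i) ((fun i => n + i) ⁻¹' (s : Set ℕ)) :=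
    fun i _ j _ h => by simpa using h
  have : (fun p : (ℕ → X) × (ℕ → X) => concatSeq n p.1 p.2) ⁻¹' (Set.pi s t) =
      (Set.pi (s.filter (· < n) : Finset ℕ) t) ×ˢ
        (Set.pi (s.preimage (fun i => n + i) hinj : Finset ℕ) fun i => t (n + i)) := by
    ext ⟨a, b⟩
    simp only [Set.mem_preimage, Set.mem_pi, Set.mem_prod, Finset.mem_coe, Finset.mem_filter,
      Finset.mem_preimage]
    constructor
    · refine fun h => ⟨fun i hi => ?_, fun i hi => ?_⟩
      · simpa [concatSeq_of_lt a b hi.2] using h i hi.1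
      · simpa [concatSeq_add] using h _ hi
    · rintro ⟨h1, h2⟩ i hi
      by_cases hin : i < n
      · rw [concatSeq_of_lt a b hin]; exact h1 i ⟨hi, hin⟩
      · obtain ⟨m, rfl⟩ := Nat.exists_eq_add_of_le (not_lt.mp hin)
        rw [concatSeq_add]; exact h2 m hi
  rw [this, Measure.prod_prod, Measure.infinitePi_pi _ fun i _ => ht i,
    Measure.infinitePi_pi _ fun i _ => ht (n + i),
    ← Finset.prod_filter_mul_prod_filter_not s (· < n) fun i => μ (t i)]
  congr 1
  refine Finset.prod_nbij (fun i => n + i) ?_ ?_ ?_ ?_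
  · intro i hi; simpa using hi
  · intro i _ j _ h; simpa using h
  · intro i hi
    simp only [Finset.coe_filter, Set.mem_ofPred_eq, not_lt] at hi
    exact ⟨i - n, by simp [Nat.add_sub_cancel' hi.2, hi.1], by simp [Nat.add_sub_cancel' hi.2]⟩
  · simp

theorem lintegral_update (μ : Measure X) [IsProbabilityMeasure μ] (r : ℕ)
    {F : (ℕ → X) → ENNReal} (hF : Measurable F) :
    ∫⁻ z, F z ∂seqLaw μ = ∫⁻ z, ∫⁻ w, F (Function.update z r w) ∂μ ∂seqLaw μ := by
  rw [← (measurePreserving_update μ r).lintegral_comp hF,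
    lintegral_prod]
  exact (hF.comp (measurable_update_seq r)).aemeasurable

theorem lintegral_concatSeq (μ : Measure X) [IsProbabilityMeasure μ] (n : ℕ)
    {F : (ℕ → X) → ENNReal} (hF : Measurable F) :
    ∫⁻ z, F z ∂seqLaw μ = ∫⁻ z, ∫⁻ w, F (concatSeq n z w) ∂seqLaw μ ∂seqLaw μ := by
  rw [← (measurePreserving_concatSeq μ n).lintegral_comp hF,
    lintegral_prod]
  exact (hF.comp (measurable_concatSeq n)).aemeasurable

theorem lintegral_seq_eval (μ : Measure X) [IsProbabilityMeasure μ] (r : ℕ)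
    {φ : X → ENNReal} (hφ : Measurable φ) :
    ∫⁻ z, φ (z r) ∂seqLaw μ = ∫⁻ x, φ x ∂μ :=
  (measurePreserving_eval_infinitePi (fun _ : ℕ => μ) r).lintegral_comp hφ

theorem lintegral_seq_prod (μ : Measure X) [IsProbabilityMeasure μ] (s : Finset ℕ)
    {φ : ℕ → X → ENNReal} (hφ : ∀ i, Measurable (φ i)) :
    ∫⁻ z, ∏ i ∈ s, φ i (z i) ∂seqLaw μ = ∏ i ∈ s, ∫⁻ x, φ i x ∂μ := by
  classical
  induction s using Finset.induction_on with
  | empty => simp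
  | insert r s hr ih =>
    have hm : ∀ s : Finset ℕ, Measurable fun z : ℕ → X => ∏ i ∈ s, φ i (z i) := fun s =>
      Finset.measurable_prod _ fun i _ => (hφ i).comp (measurable_pi_apply i)
    rw [lintegral_update μ r (hm _)]
    have : ∀ z : ℕ → X, ∫⁻ w, ∏ i ∈ insert r s, φ i (Function.update z r w i) ∂μ =
        (∫⁻ x, φ r x ∂μ) * ∏ i ∈ s, φ i (z i) := by
      intro z
      rw [← lintegral_mul_const _ (hφ r)]
      refine lintegral_congr fun w => ?_
      rw [Finset.prod_insert hr, Function.update_self]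
      congr 1
      refine Finset.prod_congr rfl fun i hi => ?_
      rw [Function.update_of_ne (by rintro rfl; exact hr hi)]
    simp_rw [this]
    rw [lintegral_const_mul _ (hm s), ih, Finset.prod_insert hr]

/-- Pairing two independent sequences. -/
theorem measurePreserving_pairSeq (μ : Measure X) (ν : Measure Y) [IsProbabilityMeasure μ]
    [IsProbabilityMeasure ν] :
    MeasurePreserving (fun (p : (ℕ → X) × (ℕ → Y)) i => (p.1 i, p.2 i))
      ((seqLaw μ).prod (seqLaw ν)) (seqLaw (μ.prod ν)) := by
  have hmeas : Measurable fun (p : (ℕ → X) × (ℕ → Y)) i => (p.1 i, p.2 i) := by fun_prop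
  refine ⟨hmeas, Measure.eq_infinitePi _ fun s t ht => ?_⟩
  rw [Measure.map_apply hmeas (.pi s.countable_toSet fun i _ => ht i)]
  have hm := hmeas (.pi s.countable_toSet fun i _ => ht i)
  rw [Measure.prod_apply hm]
  have : ∀ u : ℕ → X, (seqLaw ν) (Prod.mk u ⁻¹' ((fun (p : (ℕ → X) × (ℕ → Y)) i =>
      (p.1 i, p.2 i)) ⁻¹' Set.pi s t)) = ∏ i ∈ s, ν (Prod.mk (u i) ⁻¹' t i) := by
    intro u
    rw [← Measure.infinitePi_pi (fun _ : ℕ => ν) fun i _ => measurable_prodMk_left (ht i)]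
    rfl
  simp_rw [this]
  rw [lintegral_seq_prod μ s (φ := fun i x => ν (Prod.mk x ⁻¹' t i)) fun i =>
    measurable_measure_prodMk_left (ht i)]
  exact Finset.prod_congr rfl fun i _ => (Measure.prod_apply (ht i)).symm

end Sequences

/-! ### Lines through a compact convex set -/

section Line

variable {d : ℕ}

theorem along_zero (x : Point d) (j : Fin d) : along x j 0 = x := by simp [along]

theorem along_along (x : Point d) (j : Fin d) (α β : ℝ) :
    along (along x j α) j β = along x j (α + β) := by
  simp [along, add_smul, add_assoc]

theorem along_sub_along (x : Point d) (j : Fin d) (α β : ℝ) :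
    along x j α - along x j β = (α - β) • EuclideanSpace.single j (1 : ℝ) := by
  simp [along, sub_smul]

theorem norm_along_sub_along (x : Point d) (j : Fin d) (α β : ℝ) :
    ‖along x j α - along x j β‖ = |α - β| := by
  rw [along_sub_along, norm_smul]
  simp

theorem continuous_along (j : Fin d) : Continuous fun p : Point d × ℝ => along p.1 j p.2 := by
  unfold along
  fun_prop

/-- The parameters of the points of a line that lie in `S`. -/
def lineSlice (S : Set (Point d)) (x : Point d) (j : Fin d) : Set ℝ := {β | along x j β ∈ S}

variable {S : Set (Point d)} {x : Point d} {j : Fin d}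

theorem abs_sub_le_of_mem_lineSlice {R : ℝ} (hS : IsCompact S) (hR : Metric.diam S ≤ R)
    {α β : ℝ} (hα : α ∈ lineSlice S x j) (hβ : β ∈ lineSlice S x j) : |α - β| ≤ R := by
  rw [← norm_along_sub_along x j, ← dist_eq_norm]
  exact (Metric.dist_le_diam_of_mem hS.isBounded hα hβ).trans hR

theorem isCompact_lineSlice (hS : IsCompact S) : IsCompact (lineSlice S x j) := by
  refine Metric.isCompact_of_isClosed_isBounded
    (hS.isClosed.preimage (((continuous_along j).comp (Continuous.prodMk_right x)))) ?_
  exact Metric.isBounded_iff.2 ⟨Metric.diam S, fun α hα β hβ => by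
    rw [Real.dist_eq]; exact abs_sub_le_of_mem_lineSlice hS le_rfl hα hβ⟩

theorem convex_lineSlice (hS : Convex ℝ S) : Convex ℝ (lineSlice S x j) := by
  intro α hα β hβ s t hs ht hst
  have := hS hα hβ hs ht hst
  have h : s • along x j α + t • along x j β = along x j (s • α + t • β) := by
    simp only [along, smul_add, smul_smul, smul_eq_mul, add_smul]
    have : x = s • x + t • x := by rw [← add_smul, hst, one_smul]
    nth_rewrite 3 [this]
    abel
  rwa [h] at this

theorem zero_mem_lineSlice (hx : x ∈ S) : (0 : ℝ) ∈ lineSlice S x j := by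
  simpa [lineSlice, along_zero] using hx

theorem mem_lineSlice_of_searchLo_le (hS : IsCompact S) (hc : Convex ℝ S) (hx : x ∈ S)
    {r α β : ℝ} (h1 : searchLo S x j r α ≤ β) (h2 : β ≤ searchHi S x j r α) :
    β ∈ lineSlice S x j := by
  have hne : (lineSlice S x j).Nonempty := ⟨0, zero_mem_lineSlice hx⟩
  have hcp := isCompact_lineSlice (x := x) (j := j) hS
  exact (convex_lineSlice hc).ordConnected.out (hcp.sInf_mem hne) (hcp.sSup_mem hne)
    ⟨(le_max_left _ _).trans h1, h2.trans (min_le_left _ _)⟩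

theorem searchLo_le_of_mem (hS : IsCompact S) {r α β : ℝ} (hβ : β ∈ lineSlice S x j)
    (h : |β - α| ≤ r) : searchLo S x j r α ≤ β :=
  max_le (csInf_le (isCompact_lineSlice hS).bddBelow hβ) (by linarith [(abs_le.1 h).1])

theorem le_searchHi_of_mem (hS : IsCompact S) {r α β : ℝ} (hβ : β ∈ lineSlice S x j)
    (h : |β - α| ≤ r) : β ≤ searchHi S x j r α :=
  le_min (le_csSup (isCompact_lineSlice hS).bddAbove hβ) (by linarith [(abs_le.1 h).2])

theorem searchLo_le_searchHi (hS : IsCompact S) {r α : ℝ} (hr : 0 ≤ r)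
    (hα : α ∈ lineSlice S x j) : searchLo S x j r α ≤ searchHi S x j r α :=
  (searchLo_le_of_mem hS hα (by simpa using hr)).trans (le_searchHi_of_mem hS hα (by simpa using hr))

theorem abs_sub_le_of_mem_search {r α β : ℝ} (h1 : searchLo S x j r α ≤ β)
    (h2 : β ≤ searchHi S x j r α) : |β - α| ≤ r := by
  have h3 := (le_max_right _ _).trans h1
  have h4 := h2.trans (min_le_right _ _)
  rw [abs_le]
  constructor <;> linarith

theorem searchLo_le_samplePos {r α : ℝ} (h : searchLo S x j r α ≤ searchHi S x j r α)
    (u : unitInterval) : searchLo S x j r α ≤ samplePos S x j r α u := by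
  unfold samplePos
  nlinarith [u.2.1]

theorem samplePos_le_searchHi {r α : ℝ} (h : searchLo S x j r α ≤ searchHi S x j r α)
    (u : unitInterval) : samplePos S x j r α u ≤ searchHi S x j r α := by
  unfold samplePos
  nlinarith [u.2.2]

end Line

/-! ### Empirical risk minimization over thresholds -/

section ERM

theorem ermThreshold_isLeast (lo : ℝ) (data : List (ℝ × Bool)) :
    ermThreshold lo data ∈ lo :: data.map Prod.fst ∧
      ∀ t ∈ lo :: data.map Prod.fst,
        empError data (ermThreshold lo data) ≤ empError data t := by
  have hne : (lo :: data.map Prod.fst).argmin (empError data) ≠ none := by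
    rw [Ne, List.argmin_eq_none]; simp
  obtain ⟨m, hm⟩ := Option.ne_none_iff_exists'.1 hne
  have h : ermThreshold lo data = m := by rw [ermThreshold, hm]; rfl
  rw [h]
  exact ⟨List.argmin_mem hm, fun t ht => List.le_of_mem_argmin ht hm⟩

theorem ermThreshold_eq_or (lo : ℝ) (data : List (ℝ × Bool)) :
    ermThreshold lo data = lo ∨ ∃ p ∈ data, ermThreshold lo data = p.1 := by
  have h := (ermThreshold_isLeast lo data).1
  rw [List.mem_cons, List.mem_map] at h
  exact h.imp id fun ⟨p, hp, h⟩ => ⟨p, hp, h.symm⟩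

theorem ermThreshold_mem_Icc {lo hi : ℝ} {data : List (ℝ × Bool)} (h : lo ≤ hi)
    (hd : ∀ p ∈ data, p.1 ∈ Set.Icc lo hi) : ermThreshold lo data ∈ Set.Icc lo hi := by
  rcases ermThreshold_eq_or lo data with h' | ⟨p, hp, h'⟩
  · rw [h']; exact ⟨le_rfl, h⟩
  · rw [h']; exact hd p hp

theorem empError_congr {data : List (ℝ × Bool)} {s t : ℝ}
    (h : ∀ p ∈ data, s < p.1 ↔ t < p.1) : empError data s = empError data t := by
  classical
  unfold empError
  refine List.countP_congr fun p hp => ?_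
  rw [decide_eq_decide.2 (h p hp)]

/-- The candidates realize the labellings by all thresholds that are at least `lo`. -/
theorem exists_candidate_empError_eq (lo : ℝ) (data : List (ℝ × Bool)) {t : ℝ} (ht : lo ≤ t) :
    ∃ s ∈ lo :: data.map Prod.fst, empError data s = empError data t := by
  classical
  -- The largest candidate not exceeding `t` has the same samples to its right as `t`.
  let A : Finset ℝ := ((lo :: data.map Prod.fst).toFinset).filter (· ≤ t)
  have hA : A.Nonempty := ⟨lo, by simp [A, ht]⟩
  have hm := A.max'_mem hA
  have hm' := Finset.mem_filter.1 hm
  refine ⟨A.max' hA, List.mem_toFinset.1 hm'.1, empError_congr fun p hp => ⟨fun h => ?_, fun h => ?_⟩⟩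
  · by_contra hlt
    have : p.1 ∈ A := Finset.mem_filter.2 ⟨List.mem_toFinset.2
      (List.mem_cons_of_mem _ (List.mem_map_of_mem hp)), not_lt.1 hlt⟩
    exact absurd (A.le_max' _ this) (not_le.2 h)
  · exact hm'.2.trans_lt h

/-- Allows the comparison with the directional minimum, which need not be a candidate. -/
theorem empError_ermThreshold_le (lo : ℝ) (data : List (ℝ × Bool)) {t : ℝ} (ht : lo ≤ t) :
    empError data (ermThreshold lo data) ≤ empError data t := by
  obtain ⟨s, hs, h⟩ := exists_candidate_empError_eq lo data ht
  rw [← h]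
  exact (ermThreshold_isLeast lo data).2 s hs

open Classical in
theorem empError_map_range (N : ℕ) (p : ℕ → ℝ) (y : ℕ → Bool) (t : ℝ) :
    empError ((List.range N).map fun s => (p s, y s)) t =
      ∑ s ∈ Finset.range N, if y s = decide (t < p s) then 0 else 1 := by
  unfold empError
  rw [List.countP_map]
  induction N with
  | zero => simp
  | succ N ih =>
    rw [List.range_succ, List.countP_append, ih, Finset.sum_range_succ]
    congr 1
    by_cases h : y N = decide (t < p N) <;> simp [h]

theorem argmin_map {ι α β : Type*} [Preorder β] [DecidableLT β] (p : ι → α) (f : α → β)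
    (l : List ι) : (l.map p).argmin f = (l.argmin (f ∘ p)).map p := by
  induction l using List.reverseRecOn with
  | nil => simp
  | append_singleton l a ih =>
    rw [List.map_append, List.map_singleton, List.argmin_concat, List.argmin_concat, ih]
    cases l.argmin (f ∘ p) with
    | none => simp
    | some c => by_cases h : f (p a) < f (p c) <;> simp [h]

variable {Ω : Type*} [MeasurableSpace Ω]

theorem measurable_decide_lt {α : Type*} [TopologicalSpace α] [MeasurableSpace α]
    [OpensMeasurableSpace α] [LinearOrder α] [OrderClosedTopology α] [SecondCountableTopology α]
    {p q : Ω → α} (hp : Measurable p) (hq : Measurable q) [∀ ω, Decidable (p ω < q ω)] :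
    Measurable fun ω => decide (p ω < q ω) := by
  refine measurable_to_bool ?_
  have : (fun ω => decide (p ω < q ω)) ⁻¹' {true} = {ω | p ω < q ω} := by ext; simp
  rw [this]
  exact measurableSet_lt hp hq

/-- The index of the minimizer depends on the data only through the vector of the `N + 1` empirical
errors, which lives in a countable space, where every function is measurable. Index `0` stands for
`lo`. -/
theorem measurable_ermThreshold (N : ℕ) {lo : Ω → ℝ} {p : ℕ → Ω → ℝ} {y : ℕ → Ω → Bool}
    (hlo : Measurable lo) (hp : ∀ s < N, Measurable (p s)) (hy : ∀ s < N, Measurable (y s)) :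
    Measurable fun ω => ermThreshold (lo ω) ((List.range N).map fun s => (p s ω, y s ω)) := by
  classical
  let q : Fin (N + 1) → Ω → ℝ := fun i ω => Fin.cases (lo ω) (fun s => p s ω) i
  have hq : ∀ i, Measurable (q i) := by
    intro i
    induction i using Fin.cases with
    | zero => exact hlo
    | succ s => exact hp s s.2
  let D : Ω → List (ℝ × Bool) := fun ω => (List.range N).map fun s => (p s ω, y s ω)
  let err : Ω → Fin (N + 1) → ℕ := fun ω i => empError (D ω) (q i ω)
  have herr : Measurable err := by
    refine measurable_pi_lambda _ fun i => ?_
    change Measurable fun ω => empError ((List.range N).map fun s => (p s ω, y s ω)) (q i ω)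
    simp_rw [empError_map_range]
    refine Finset.measurable_sum _ fun s hs => ?_
    have hs' := Finset.mem_range.1 hs
    refine Measurable.ite ?_ measurable_const measurable_const
    exact measurableSet_eq_fun (hy s hs') (measurable_decide_lt (hq i) (hp s hs'))
  let idx : (Fin (N + 1) → ℕ) → Fin (N + 1) := fun e => ((List.finRange (N + 1)).argmin e).getD 0
  have hkey : (fun ω => ermThreshold (lo ω) (D ω)) = fun ω => q (idx (err ω)) ω := by
    funext ω
    have hl : lo ω :: (D ω).map Prod.fst = (List.finRange (N + 1)).map fun i => q i ω := by
      rw [List.finRange_succ, List.map_cons, List.map_map]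
      simp only [List.map_map]
      congr 1
      rw [← List.map_coe_finRange_eq_range, List.map_map]
      rfl
    rw [ermThreshold, hl, argmin_map]
    have : (empError (D ω) ∘ fun i => q i ω) = err ω := rfl
    rw [this]
    change _ = q (((List.finRange (N + 1)).argmin (err ω)).getD 0) ω
    cases (List.finRange (N + 1)).argmin (err ω) <;> rfl
  change Measurable fun ω => ermThreshold (lo ω) (D ω)
  rw [hkey]
  have h1 : Measurable fun p : Fin (N + 1) × Ω => q p.1 p.2 :=
    measurable_from_prod_countable_right hq
  exact h1.comp (((measurable_of_countable idx).comp herr).prodMk measurable_id)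

end ERM

/-! ### Measurability of the search interval -/

section SearchMeasurable

variable {d : ℕ} {S : Set (Point d)} {j : Fin d}

theorem measurable_along (j : Fin d) : Measurable fun p : Point d × ℝ => along p.1 j p.2 :=
  (continuous_along j).measurable

/-- The points in question are those of `S` translated by `-β` along the axis; with `β` restricted
to bounded balls they form a countable union of continuous images of compact sets. -/
theorem measurableSet_exists_mem_lineSlice (hS : IsCompact S) (j : Fin d) {C : Set ℝ}
    (hC : IsClosed C) : MeasurableSet {x | ∃ β ∈ C, β ∈ lineSlice S x j} := by
  have : {x | ∃ β ∈ C, β ∈ lineSlice S x j} =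
      ⋃ n : ℕ, (fun p : Point d × ℝ => along p.1 j (-p.2)) ''
        (S ×ˢ (C ∩ Metric.closedBall 0 n)) := by
    ext x
    simp only [Set.mem_ofPred_eq, Set.mem_iUnion, Set.mem_image, Set.mem_prod, Set.mem_inter_iff,
      Prod.exists, Metric.mem_closedBall, dist_zero_right]
    constructor
    · rintro ⟨β, hβ, h⟩
      obtain ⟨n, hn⟩ := exists_nat_ge ‖β‖
      exact ⟨n, along x j β, β, ⟨h, hβ, hn⟩, by rw [along_along]; simp [along_zero]⟩
    · rintro ⟨n, y, β, ⟨hy, hβ, -⟩, rfl⟩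
      refine ⟨β, hβ, ?_⟩
      simpa [lineSlice, along_along, along_zero] using hy
  rw [this]
  refine MeasurableSet.iUnion fun n => IsCompact.measurableSet (IsCompact.image ?_ ?_)
  · exact hS.prod ((isCompact_closedBall _ _).inter_left hC)
  · exact (continuous_along j).comp (continuous_fst.prodMk continuous_snd.neg)

theorem measurable_sInf_lineSlice (hS : IsCompact S) (j : Fin d) :
    Measurable fun x => sInf (lineSlice S x j) := by
  refine measurable_of_Iic fun t => ?_
  -- A line that misses `S` has `sInf ∅ = 0`, so it belongs to the preimage exactly when `0 ≤ t`.
  have : (fun x => sInf (lineSlice S x j)) ⁻¹' Set.Iic t =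
      {x | ∃ β ∈ Set.Iic t, β ∈ lineSlice S x j} ∪
        ({x | ∃ β ∈ Set.univ, β ∈ lineSlice S x j}ᶜ ∩ {_x | 0 ≤ t}) := by
    ext x
    simp only [Set.mem_preimage, Set.mem_Iic, Set.mem_union, Set.mem_ofPred_eq, Set.mem_inter_iff,
      Set.mem_compl_iff, Set.mem_univ, true_and]
    rcases (lineSlice S x j).eq_empty_or_nonempty with h | h
    · simp [h]
    · have hm := (isCompact_lineSlice (x := x) (j := j) hS).sInf_mem h
      constructor
      · exact fun ht => Or.inl ⟨_, ht, hm⟩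
      · rintro (⟨β, hβ, h'⟩ | ⟨h', -⟩)
        · exact (csInf_le (isCompact_lineSlice hS).bddBelow h').trans hβ
        · exact absurd h h'
  rw [this]
  exact (measurableSet_exists_mem_lineSlice hS j isClosed_Iic).union
    ((measurableSet_exists_mem_lineSlice hS j isClosed_univ).compl.inter (.const _))

theorem measurable_sSup_lineSlice (hS : IsCompact S) (j : Fin d) :
    Measurable fun x => sSup (lineSlice S x j) := by
  refine measurable_of_Ici fun t => ?_
  have : (fun x => sSup (lineSlice S x j)) ⁻¹' Set.Ici t =
      {x | ∃ β ∈ Set.Ici t, β ∈ lineSlice S x j} ∪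
        ({x | ∃ β ∈ Set.univ, β ∈ lineSlice S x j}ᶜ ∩ {_x | t ≤ 0}) := by
    ext x
    simp only [Set.mem_preimage, Set.mem_Ici, Set.mem_union, Set.mem_ofPred_eq, Set.mem_inter_iff,
      Set.mem_compl_iff, Set.mem_univ, true_and]
    rcases (lineSlice S x j).eq_empty_or_nonempty with h | h
    · simp [h]
    · have hm := (isCompact_lineSlice (x := x) (j := j) hS).sSup_mem h
      constructor
      · exact fun ht => Or.inl ⟨_, ht, hm⟩
      · rintro (⟨β, hβ, h'⟩ | ⟨h', -⟩)
        · exact hβ.trans (le_csSup (isCompact_lineSlice hS).bddAbove h')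
        · exact absurd h h'
  rw [this]
  exact (measurableSet_exists_mem_lineSlice hS j isClosed_Ici).union
    ((measurableSet_exists_mem_lineSlice hS j isClosed_univ).compl.inter (.const _))

variable {Ω : Type*} [MeasurableSpace Ω] {X : Ω → Point d} {A : Ω → ℝ}

theorem Measurable.along {α : Ω → ℝ} (hX : Measurable X) (hα : Measurable α) :
    Measurable fun ω => along (X ω) j (α ω) :=
  (measurable_along j).comp (hX.prodMk hα)

theorem Measurable.searchLo (hS : IsCompact S) (j : Fin d) (r : ℝ) (hX : Measurable X)
    (hA : Measurable A) : Measurable fun ω => searchLo S (X ω) j r (A ω) :=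
  ((measurable_sInf_lineSlice hS j).comp hX).max (hA.sub_const r)

theorem Measurable.searchHi (hS : IsCompact S) (j : Fin d) (r : ℝ) (hX : Measurable X)
    (hA : Measurable A) : Measurable fun ω => searchHi S (X ω) j r (A ω) :=
  ((measurable_sSup_lineSlice hS j).comp hX).min (hA.add_const r)

theorem Measurable.samplePos (hS : IsCompact S) (j : Fin d) (r : ℝ) (hX : Measurable X)
    (hA : Measurable A) {u : Ω → unitInterval} (hu : Measurable u) :
    Measurable fun ω => samplePos S (X ω) j r (A ω) (u ω) :=
  (hX.searchLo hS j r hA).add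
    (hu.subtype_val.mul ((hX.searchHi hS j r hA).sub (hX.searchLo hS j r hA)))

/-- A function of a point and a coordinate is measurable if it is so for each coordinate. -/
theorem measurable_of_coordinate {γ : Type*} [MeasurableSpace γ] {J : Ω → Fin d}
    (hJ : Measurable J) {F : Fin d → Ω → γ} (hF : ∀ j, Measurable (F j)) :
    Measurable fun ω => F (J ω) ω := by
  have h1 : Measurable fun p : Fin d × Ω => F p.1 p.2 := measurable_from_prod_countable_right hF
  exact h1.comp (hJ.prodMk measurable_id)

theorem measurable_learnerPos (hS : IsCompact S) (R : ℝ) (N : ℕ) (j : Fin d)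
    (hX : Measurable X) {u : Ω → ℕ → unitInterval} (hu : Measurable u) (y : ℕ → Bool) (i : ℕ) :
    Measurable fun ω => learnerPos S R N (X ω) j (u ω) y i := by
  induction i with
  | zero => exact measurable_const
  | succ i ih =>
    simp only [learnerPos]
    refine measurable_ermThreshold N (hX.searchLo hS j _ ih) (p := fun s ω => samplePos S (X ω) j
      (R / 2 ^ i) (learnerPos S R N (X ω) j (u ω) y i) (u ω (i * N + s)))
      (y := fun s _ => y (i * N + s)) (fun s _ => ?_) fun s _ => measurable_const
    exact hX.samplePos hS j _ ih ((measurable_pi_apply _).comp hu)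

theorem measurable_cdLinePos (hS : IsCompact S) (R c : ℝ) (T : ℕ) (y : ℕ → Bool) (e i : ℕ)
    {X : CDSeed d → Point d} (hX : Measurable X) :
    Measurable fun ω => cdLinePos S R c T ω y e (X ω) i := by
  unfold cdLinePos
  refine measurable_of_coordinate (J := fun ω : CDSeed d => ω.1 e) (by fun_prop)
    (F := fun j ω => learnerPos S R (lsSamples c d T) (X ω) j
      (fun m => ω.2 (e * (lsEpochs c d T * lsSamples c d T) + m))
      (fun m => y (e * (lsEpochs c d T * lsSamples c d T) + m)) i) fun j => ?_
  exact measurable_learnerPos hS R _ j hX (by fun_prop) _ i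

theorem measurable_cdPoint (hS : IsCompact S) (R c : ℝ) (x₀ : Point d) (T : ℕ) (y : ℕ → Bool)
    (e : ℕ) : Measurable fun ω => cdPoint S R c x₀ T ω y e := by
  induction e with
  | zero => exact measurable_const
  | succ e ih =>
    simp only [cdPoint]
    refine measurable_of_coordinate (J := fun ω : CDSeed d => ω.1 e) (by fun_prop)
      (F := fun j ω => along (cdPoint S R c x₀ T ω y e) j
        (cdLinePos S R c T ω y e (cdPoint S R c x₀ T ω y e) (lsEpochs c d T))) fun j => ?_
    exact ih.along (measurable_cdLinePos hS R c T y e _ ih)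

end SearchMeasurable

/-! ### Admissibility of coordinate descent -/

section Admissible

variable {d : ℕ} {S : Set (Point d)} {R : ℝ}

theorem learnerPos_mem (hS : IsCompact S) (hc : Convex ℝ S) (hR : 0 ≤ R) (N : ℕ) {x : Point d}
    (hx : x ∈ S) (j : Fin d) (u : ℕ → unitInterval) (y : ℕ → Bool) (i : ℕ) :
    learnerPos S R N x j u y i ∈ lineSlice S x j := by
  induction i with
  | zero => exact zero_mem_lineSlice hx
  | succ i ih =>
    have hle := searchLo_le_searchHi hS (r := R / 2 ^ i) (by positivity) ih
    have h := ermThreshold_mem_Icc hle (data := (List.range N).map fun s =>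
        (samplePos S x j (R / 2 ^ i) (learnerPos S R N x j u y i) (u (i * N + s)),
          y (i * N + s))) (by
      intro p hp
      obtain ⟨s, -, rfl⟩ := List.mem_map.1 hp
      exact ⟨searchLo_le_samplePos hle _, samplePos_le_searchHi hle _⟩)
    exact mem_lineSlice_of_searchLo_le hS hc hx h.1 h.2

theorem cdPoint_mem (hS : IsCompact S) (hc : Convex ℝ S) (hR : 0 ≤ R) (c : ℝ) {x₀ : Point d}
    (hx₀ : x₀ ∈ S) (T : ℕ) (ω : CDSeed d) (y : ℕ → Bool) (e : ℕ) :
    cdPoint S R c x₀ T ω y e ∈ S := by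
  induction e with
  | zero => exact hx₀
  | succ e ih => exact learnerPos_mem hS hc hR _ ih _ _ _ _

theorem isAdmissible_rsscd (hS : IsCompact S) (hc : Convex ℝ S) (hR : 0 ≤ R) (c : ℝ)
    {x₀ : Point d} (hx₀ : x₀ ∈ S) (T : ℕ) : (rsscd S R c x₀ T).IsAdmissible S T where
  budget := by
    change cdEpochs d T * (lsEpochs c d T * (T / cdEpochs d T / lsEpochs c d T)) ≤ T
    -- Both quotients are rounded down; a vanishing divisor gives quotient `0` and needs no separate
    -- case.
    exact (Nat.mul_le_mul_left _ (Nat.mul_div_le _ _)).trans (Nat.mul_div_le _ _)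
  query_mem ω h _ := by
    simp only [rsscd]
    set y : ℕ → Bool := fun m => h.getD m false
    have hx := cdPoint_mem hS hc hR c hx₀ T ω y
      (h.length / (lsEpochs c d T * lsSamples c d T))
    have hle := searchLo_le_searchHi hS (r := R / 2 ^ (h.length %
      (lsEpochs c d T * lsSamples c d T) / lsSamples c d T)) (by positivity)
      (learnerPos_mem hS hc hR (lsSamples c d T) hx
        (ω.1 (h.length / (lsEpochs c d T * lsSamples c d T)))
        (fun m => ω.2 (h.length / (lsEpochs c d T * lsSamples c d T) *
          (lsEpochs c d T * lsSamples c d T) + m))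
        (fun m => y (h.length / (lsEpochs c d T * lsSamples c d T) *
          (lsEpochs c d T * lsSamples c d T) + m))
        (h.length % (lsEpochs c d T * lsSamples c d T) / lsSamples c d T))
    exact mem_lineSlice_of_searchLo_le hS hc hx (searchLo_le_samplePos hle _)
      (samplePos_le_searchHi hle _)
  output_mem ω h _ := cdPoint_mem hS hc hR c hx₀ T ω _ _
  query_measurable h _ := by
    simp only [rsscd]
    set e := h.length / (lsEpochs c d T * lsSamples c d T)
    set i := h.length % (lsEpochs c d T * lsSamples c d T) / lsSamples c d T
    have hx := measurable_cdPoint hS R c x₀ T (fun m => h.getD m false) e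
    refine Measurable.prodMk ?_ (by fun_prop)
    refine measurable_of_coordinate (J := fun ω : CDSeed d => ω.1 e) (by fun_prop)
      (F := fun j ω => along (cdPoint S R c x₀ T ω (fun m => h.getD m false) e) j
        (samplePos S (cdPoint S R c x₀ T ω (fun m => h.getD m false) e) j (R / 2 ^ i)
          (cdLinePos S R c T ω (fun m => h.getD m false) e
            (cdPoint S R c x₀ T ω (fun m => h.getD m false) e) i) (ω.2 h.length))) fun j => ?_
    exact hx.along (hx.samplePos hS j _ (measurable_cdLinePos hS R c T _ _ _ hx) (by fun_prop))
  output_measurable h _ := measurable_cdPoint hS R c x₀ T _ _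

end Admissible

/-! ### Simulating the oracle by uniform variables -/

section Simulation

open Classical in
/-- Continue the history `h` by `n` further queries, where the answer to query number `m` is `+` if
`v m` is below the probability of `+`. -/
noncomputable def simulate {d : ℕ} {Ω : Type*} (A : SignAlgorithm d Ω)
    (η : Point d → Fin d → unitInterval) (ω : Ω) (v : ℕ → unitInterval) :
    ℕ → List Bool → List Bool
  | 0, h => h
  | n + 1, h =>
    simulate A η ω v n (h ++ [decide (v h.length < η (A.query ω h).1 (A.query ω h).2)])

variable {d : ℕ} {Ω : Type*} (A : SignAlgorithm d Ω) (η : Point d → Fin d → unitInterval) (ω : Ω)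

theorem measurable_comp_simulate (F : List Bool → ENNReal) (n : ℕ) (h : List Bool) :
    Measurable fun v => F (simulate A η ω v n h) := by
  classical
  induction n generalizing h with
  | zero => simpa only [simulate] using measurable_const
  | succ n ih =>
    have : (fun v => F (simulate A η ω v (n + 1) h)) = fun v : ℕ → unitInterval =>
        if v h.length < η (A.query ω h).1 (A.query ω h).2 then F (simulate A η ω v n (h ++ [true]))
        else F (simulate A η ω v n (h ++ [false])) := by
      funext v
      simp only [simulate]
      split_ifs with hv <;> simp [hv]
    rw [this]
    exact Measurable.ite (measurableSet_lt (measurable_pi_apply _) measurable_const) (ih _) (ih _)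

theorem simulate_congr {v v' : ℕ → unitInterval} (n : ℕ) (h : List Bool)
    (hv : ∀ m, h.length ≤ m → v m = v' m) : simulate A η ω v n h = simulate A η ω v' n h := by
  induction n generalizing h with
  | zero => rfl
  | succ n ih =>
    simp only [simulate, hv _ le_rfl]
    exact ih _ fun m hm => hv m (by simp at hm; omega)

theorem volume_setOf_lt_unitInterval (p : unitInterval) :
    (volume : Measure unitInterval) {t | t < p} = ENNReal.ofReal p := by
  have : {t | t < p} = Set.Iio p := rfl
  rw [this, unitInterval.volume_Iio]

/-- A comparison with a uniform variable has the right probability of `+`, and each query uses a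
fresh variable, so the randomness of all answers can be drawn in advance. -/
theorem expectedFrom_eq_lintegral_simulate (cost : Point d → ENNReal) (n : ℕ) (h : List Bool) :
    A.expectedFrom η cost ω n h =
      ∫⁻ v, cost (A.output ω (simulate A η ω v n h)) ∂seqLaw (volume : Measure unitInterval) := by
  classical
  induction n generalizing h with
  | zero => simp [SignAlgorithm.expectedFrom, simulate]
  | succ n ih =>
    let F : List Bool → ENNReal := fun l => cost (A.output ω l)
    have hF := measurable_comp_simulate A η ω F
    set p := η (A.query ω h).1 (A.query ω h).2 with hp
    change _ = ∫⁻ v, F (simulate A η ω v (n + 1) h) ∂seqLaw (volume : Measure unitInterval)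
    -- The seed of index `h.length` decides only the next answer, since all later queries read later
    -- seeds. Integrating it first produces the weights `p` and `1 - p`.
    rw [lintegral_update _ h.length (hF (n + 1) h)]
    have key : ∀ v : ℕ → unitInterval,
        ∫⁻ t : unitInterval, F (simulate A η ω (Function.update v h.length t) (n + 1) h) =
          ENNReal.ofReal p * F (simulate A η ω v n (h ++ [true])) +
            ENNReal.ofReal (1 - (p : ℝ)) * F (simulate A η ω v n (h ++ [false])) := by
      intro v
      have h1 : ∀ t : unitInterval,
          F (simulate A η ω (Function.update v h.length t) (n + 1) h) =
            {t | t < p}.indicator (fun _ => F (simulate A η ω v n (h ++ [true]))) t +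
              {t | t < p}ᶜ.indicator (fun _ => F (simulate A η ω v n (h ++ [false]))) t := by
        intro t
        simp only [simulate, Function.update_self]
        rw [simulate_congr A η ω (v' := v) n _ fun m hm => Function.update_of_ne
          (by simp at hm; omega) _ _]
        by_cases ht : t < p
        · simp [ht, ← hp]
        · simp [ht, ← hp]
      have hms : MeasurableSet {t : unitInterval | t < p} := measurableSet_Iio
      simp_rw [h1]
      rw [lintegral_add_left (measurable_const.indicator hms), lintegral_indicator hms,
        lintegral_indicator hms.compl, setLIntegral_const, setLIntegral_const,
        prob_compl_eq_one_sub hms, volume_setOf_lt_unitInterval, mul_comm (ENNReal.ofReal _),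
        mul_comm (ENNReal.ofReal _), ENNReal.ofReal_sub _ p.2.1, ENNReal.ofReal_one]
    simp_rw [key]
    rw [lintegral_add_left ((hF n _).const_mul _), lintegral_const_mul _ (hF n _),
      lintegral_const_mul _ (hF n _), SignAlgorithm.expectedFrom, ih, ih]

theorem length_simulate (v : ℕ → unitInterval) (n : ℕ) (h : List Bool) :
    (simulate A η ω v n h).length = h.length + n := by
  induction n generalizing h with
  | zero => rfl
  | succ n ih => rw [simulate, ih]; simp; omega

theorem prefix_simulate (v : ℕ → unitInterval) (n : ℕ) (h : List Bool) :
    h <+: simulate A η ω v n h := by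
  induction n generalizing h with
  | zero => exact List.prefix_rfl
  | succ n ih => exact (List.prefix_append h _).trans (ih _)

open Classical in
-- Later queries only extend the history, so answer number `m` is the one given to the query asked
-- after the first `m` answers.
theorem getD_simulate (v : ℕ → unitInterval) (n : ℕ) (h : List Bool) {m : ℕ} (hm : h.length ≤ m)
    (hmn : m < h.length + n) :
    (simulate A η ω v n h).getD m false =
      decide (v m < η (A.query ω ((simulate A η ω v n h).take m)).1
        (A.query ω ((simulate A η ω v n h).take m)).2) := by
  induction n generalizing h with
  | zero => omega
  | succ n ih =>
    rw [simulate]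
    set b := decide (v h.length < η (A.query ω h).1 (A.query ω h).2) with hb
    rcases hm.eq_or_lt with rfl | hlt
    · obtain ⟨t, ht⟩ := prefix_simulate A η ω v n (h ++ [b])
      rw [← ht]
      simp [hb]
    · exact ih (h ++ [b]) (by simp; omega) (by simp; omega)

end Simulation

/-! ### Coordinate descent driven by independent uniform variables -/

section NoisyDescent

variable {d : ℕ}

open Classical in
/-- The adaptive threshold learner with simulated answers: `(z m).1` selects the position of sample
`m`, and `(z m).2` its answer. -/
noncomputable def noisyPos (S : Set (Point d)) (R : ℝ) (N : ℕ)
    (η : Point d → Fin d → unitInterval) (x : Point d) (j : Fin d)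
    (z : ℕ → unitInterval × unitInterval) : ℕ → ℝ
  | 0 => 0
  | i + 1 =>
    let α := noisyPos S R N η x j z i
    ermThreshold (searchLo S x j (R / 2 ^ i) α)
      ((List.range N).map fun s =>
        (samplePos S x j (R / 2 ^ i) α (z (i * N + s)).1,
          decide ((z (i * N + s)).2 <
            η (along x j (samplePos S x j (R / 2 ^ i) α (z (i * N + s)).1)) j)))

/-- Coordinate descent with simulated answers: `K` learner epochs of `N` samples in each line
search. -/
noncomputable def noisyPoint (S : Set (Point d)) (R : ℝ) (K N : ℕ)
    (η : Point d → Fin d → unitInterval) (x₀ : Point d) (J : ℕ → Fin d)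
    (z : ℕ → unitInterval × unitInterval) : ℕ → Point d
  | 0 => x₀
  | e + 1 =>
    let x := noisyPoint S R K N η x₀ J z e
    along x (J e) (noisyPos S R N η x (J e) (fun m => z (e * (K * N) + m)) K)

theorem learnerPos_congr (S : Set (Point d)) (R : ℝ) (N : ℕ) (x : Point d) (j : Fin d)
    (u : ℕ → unitInterval) {y y' : ℕ → Bool} {i : ℕ} (h : ∀ m < i * N, y m = y' m) :
    learnerPos S R N x j u y i = learnerPos S R N x j u y' i := by
  induction i with
  | zero => rfl
  | succ i ih =>
    simp only [learnerPos]
    rw [ih fun m hm => h m (hm.trans_le (Nat.mul_le_mul_right _ i.le_succ))]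
    congr 1
    refine List.map_congr_left fun s hs => ?_
    rw [h (i * N + s) (by rw [Nat.succ_mul]; simpa using hs)]

theorem cdPoint_congr (S : Set (Point d)) (R c : ℝ) (x₀ : Point d) (T : ℕ) (ω : CDSeed d)
    {y y' : ℕ → Bool} {e : ℕ} (h : ∀ m < e * (lsEpochs c d T * lsSamples c d T), y m = y' m) :
    cdPoint S R c x₀ T ω y e = cdPoint S R c x₀ T ω y' e := by
  induction e with
  | zero => rfl
  | succ e ih =>
    simp only [cdPoint]
    rw [ih fun m hm => h m (hm.trans_le (Nat.mul_le_mul_right _ e.le_succ))]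
    congr 1
    exact learnerPos_congr _ _ _ _ _ _ fun m hm => h _ (by rw [Nat.succ_mul]; omega)

theorem noisyPos_congr (S : Set (Point d)) (R : ℝ) (N : ℕ) (η : Point d → Fin d → unitInterval)
    (x : Point d) (j : Fin d) {z z' : ℕ → unitInterval × unitInterval} {i : ℕ}
    (h : ∀ m < i * N, z m = z' m) : noisyPos S R N η x j z i = noisyPos S R N η x j z' i := by
  induction i with
  | zero => rfl
  | succ i ih =>
    simp only [noisyPos]
    rw [ih fun m hm => h m (hm.trans_le (Nat.mul_le_mul_right _ i.le_succ))]
    congr 1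
    refine List.map_congr_left fun s hs => ?_
    rw [h (i * N + s) (by rw [Nat.succ_mul]; simpa using hs)]

theorem noisyPoint_congr (S : Set (Point d)) (R : ℝ) (K N : ℕ)
    (η : Point d → Fin d → unitInterval) (x₀ : Point d) {J J' : ℕ → Fin d}
    {z z' : ℕ → unitInterval × unitInterval} {e : ℕ} (hJ : ∀ i < e, J i = J' i)
    (h : ∀ m < e * (K * N), z m = z' m) :
    noisyPoint S R K N η x₀ J z e = noisyPoint S R K N η x₀ J' z' e := by
  induction e with
  | zero => rfl
  | succ e ih =>
    simp only [noisyPoint]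
    rw [ih (fun i hi => hJ i (by omega))
      fun m hm => h m (hm.trans_le (Nat.mul_le_mul_right _ e.le_succ)), hJ e e.lt_succ_self]
    congr 1
    exact noisyPos_congr _ _ _ _ _ _ fun m hm => h _ (by rw [Nat.succ_mul]; omega)

/-- Against simulated answers, coordinate descent follows `noisyPoint`. -/
theorem cdPoint_simulate (S : Set (Point d)) (R c : ℝ) (x₀ : Point d) (T : ℕ)
    (η : Point d → Fin d → unitInterval) (ω : CDSeed d) (v : ℕ → unitInterval) {e : ℕ}
    (he : e ≤ cdEpochs d T) :
    cdPoint S R c x₀ T ω (fun m => (simulate (rsscd S R c x₀ T) η ω v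
        (rsscd S R c x₀ T).numQueries []).getD m false) e =
      noisyPoint S R (lsEpochs c d T) (lsSamples c d T) η x₀ ω.1 (fun m => (ω.2 m, v m)) e := by
  classical
  set L := simulate (rsscd S R c x₀ T) η ω v (rsscd S R c x₀ T).numQueries [] with hL
  set K := lsEpochs c d T with hK
  set N := lsSamples c d T with hN
  -- Query number `m` sees the first `m` answers, padded by `false`. The iterate and the position it
  -- is computed from read no answer of index `m` or more, so the padding is harmless.
  have htake : ∀ m i, i < m → (L.take m).getD i false = L.getD i false := by
    intro m i hi
    simp [List.getD_eq_getElem?_getD, hi]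
  have hlen : L.length = cdEpochs d T * (K * N) := by
    rw [hL, length_simulate]; simp [rsscd, hK, hN]
  have hget : ∀ e < cdEpochs d T, ∀ i < K, ∀ s < N,
      L.getD (e * (K * N) + (i * N + s)) false =
        decide (v (e * (K * N) + (i * N + s)) < η (along (cdPoint S R c x₀ T ω
          (fun m => L.getD m false) e) (ω.1 e) (samplePos S (cdPoint S R c x₀ T ω
          (fun m => L.getD m false) e) (ω.1 e) (R / 2 ^ i) (learnerPos S R N
            (cdPoint S R c x₀ T ω (fun m => L.getD m false) e) (ω.1 e)
            (fun m => ω.2 (e * (K * N) + m)) (fun m => L.getD (e * (K * N) + m) false) i)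
            (ω.2 (e * (K * N) + (i * N + s))))) (ω.1 e)) := by
    intro e he i hi s hs
    have hlt : i * N + s < K * N := by nlinarith
    set m := e * (K * N) + (i * N + s) with hm
    have hmn : m < cdEpochs d T * (K * N) := by nlinarith
    have h1 := getD_simulate (rsscd S R c x₀ T) η ω v (rsscd S R c x₀ T).numQueries []
      (m := m) (Nat.zero_le _) (by simpa [rsscd, ← hK, ← hN] using hmn)
    rw [← hL] at h1
    rw [h1]
    have hlm : (L.take m).length = m := by simp [hlen, hmn.le]
    -- The query number decodes by division into the line search `e`, the learner epoch `i` and the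
    -- sample `s`.
    have hdiv : m / (K * N) = e := by
      rw [hm, Nat.mul_comm, Nat.mul_add_div (by omega), Nat.div_eq_of_lt hlt, add_zero]
    have hmod : m % (K * N) / N = i := by
      rw [hm, Nat.mul_comm, Nat.mul_add_mod, Nat.mod_eq_of_lt hlt, Nat.mul_comm,
        Nat.mul_add_div (by omega), Nat.div_eq_of_lt hs, add_zero]
    simp only [rsscd, hlm, ← hK, ← hN, hdiv, hmod, cdLinePos]
    have h2 : cdPoint S R c x₀ T ω (fun i => (L.take m).getD i false) e =
        cdPoint S R c x₀ T ω (fun i => L.getD i false) e :=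
      cdPoint_congr S R c x₀ T ω fun i hi => htake m i (by rw [← hK, ← hN] at hi; omega)
    rw [h2]
    have h3 : ∀ x, learnerPos S R N x (ω.1 e) (fun m => ω.2 (e * (K * N) + m))
        (fun i => (L.take m).getD (e * (K * N) + i) false) i =
          learnerPos S R N x (ω.1 e) (fun m => ω.2 (e * (K * N) + m))
            (fun i => L.getD (e * (K * N) + i) false) i := fun x =>
      learnerPos_congr S R N x _ _ fun i hi => htake m _ (by omega)
    rw [h3]
  clear_value L
  induction e with
  | zero => rfl
  | succ e ih =>
    have ih := ih (by omega)
    simp only [cdPoint, noisyPoint, cdLinePos, ← hK, ← hN]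
    rw [← ih]
    congr 1
    have : ∀ i ≤ K, learnerPos S R N (cdPoint S R c x₀ T ω (fun m => L.getD m false) e) (ω.1 e)
        (fun m => ω.2 (e * (K * N) + m)) (fun m => L.getD (e * (K * N) + m) false) i =
        noisyPos S R N η (cdPoint S R c x₀ T ω (fun m => L.getD m false) e) (ω.1 e)
          (fun m => (ω.2 (e * (K * N) + m), v (e * (K * N) + m))) i := by
      intro i hi
      induction i with
      | zero => rfl
      | succ i ihi =>
        have ihi := ihi (by omega)
        simp only [learnerPos, noisyPos]
        rw [← ihi]
        congr 1
        refine List.map_congr_left fun s hs => ?_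
        rw [hget e (by omega) i (by omega) s (by simpa using hs)]
    exact this K le_rfl

variable {S : Set (Point d)} {R : ℝ} {η : Point d → Fin d → unitInterval}

theorem noisyPos_succ_mem_search (hS : IsCompact S) (hR : 0 ≤ R) (N : ℕ)
    {x : Point d} (j : Fin d) (z : ℕ → unitInterval × unitInterval) {i : ℕ}
    (hi : noisyPos S R N η x j z i ∈ lineSlice S x j) :
    noisyPos S R N η x j z (i + 1) ∈
      Set.Icc (searchLo S x j (R / 2 ^ i) (noisyPos S R N η x j z i))
        (searchHi S x j (R / 2 ^ i) (noisyPos S R N η x j z i)) := by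
  have hle := searchLo_le_searchHi hS (r := R / 2 ^ i) (by positivity) hi
  refine ermThreshold_mem_Icc hle fun p hp => ?_
  obtain ⟨s, -, rfl⟩ := List.mem_map.1 hp
  exact ⟨searchLo_le_samplePos hle _, samplePos_le_searchHi hle _⟩

theorem noisyPos_mem (hS : IsCompact S) (hc : Convex ℝ S) (hR : 0 ≤ R) (N : ℕ)
    {x : Point d} (hx : x ∈ S) (j : Fin d) (z : ℕ → unitInterval × unitInterval) (i : ℕ) :
    noisyPos S R N η x j z i ∈ lineSlice S x j := by
  induction i with
  | zero => exact zero_mem_lineSlice hx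
  | succ i ih =>
    have h := noisyPos_succ_mem_search (η := η) hS hR N j z ih
    exact mem_lineSlice_of_searchLo_le hS hc hx h.1 h.2

theorem noisyPoint_mem (hS : IsCompact S) (hc : Convex ℝ S) (hR : 0 ≤ R) (K N : ℕ)
    {x₀ : Point d} (hx₀ : x₀ ∈ S) (J : ℕ → Fin d) (z : ℕ → unitInterval × unitInterval) (e : ℕ) :
    noisyPoint S R K N η x₀ J z e ∈ S := by
  induction e with
  | zero => exact hx₀
  | succ e ih => exact noisyPos_mem hS hc hR N ih _ _ _

theorem measurable_noisyPos {Ω : Type*} [MeasurableSpace Ω] (hS : IsCompact S)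
    (hη : ∀ j, Measurable fun x => η x j) (N : ℕ) (j : Fin d) {X : Ω → Point d}
    (hX : Measurable X) {z : Ω → ℕ → unitInterval × unitInterval} (hz : Measurable z) (i : ℕ) :
    Measurable fun ω => noisyPos S R N η (X ω) j (z ω) i := by
  classical
  induction i with
  | zero => exact measurable_const
  | succ i ih =>
    simp only [noisyPos]
    have hz1 : ∀ m, Measurable fun ω => (z ω m).1 := fun m =>
      measurable_fst.comp ((measurable_pi_apply m).comp hz)
    have hz2 : ∀ m, Measurable fun ω => (z ω m).2 := fun m =>
      measurable_snd.comp ((measurable_pi_apply m).comp hz)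
    have hp : ∀ s, Measurable fun ω => samplePos S (X ω) j (R / 2 ^ i)
        (noisyPos S R N η (X ω) j (z ω) i) (z ω (i * N + s)).1 := fun s =>
      hX.samplePos hS j _ ih (hz1 _)
    exact measurable_ermThreshold N (hX.searchLo hS j _ ih) (fun s _ => hp s) fun s _ =>
      measurable_decide_lt (hz2 _) ((hη j).comp (hX.along (hp s)))

theorem measurable_noisyPoint {Ω : Type*} [MeasurableSpace Ω] (hS : IsCompact S)
    (hη : ∀ j, Measurable fun x => η x j) (K N : ℕ) (x₀ : Point d) {J : Ω → ℕ → Fin d}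
    (hJ : Measurable J) {z : Ω → ℕ → unitInterval × unitInterval} (hz : Measurable z) (e : ℕ) :
    Measurable fun ω => noisyPoint S R K N η x₀ (J ω) (z ω) e := by
  induction e with
  | zero => exact measurable_const
  | succ e ih =>
    simp only [noisyPoint]
    refine measurable_of_coordinate (J := fun ω => J ω e) ((measurable_pi_apply e).comp hJ)
      (F := fun j ω => along (noisyPoint S R K N η x₀ (J ω) (z ω) e) j
        (noisyPos S R N η (noisyPoint S R K N η x₀ (J ω) (z ω) e) j
          (fun m => z ω (e * (K * N) + m)) K)) fun j => ?_
    refine ih.along (measurable_noisyPos hS hη N j ih ?_ K)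
    exact measurable_pi_lambda _ fun m => (measurable_pi_apply _).comp hz

/-- The uniform distribution on the coordinates. -/
noncomputable abbrev coordLaw (d : ℕ) : Measure (Fin d) :=
  ProbabilityTheory.uniformOn (Set.univ : Set (Fin d))

/-- The uniform distribution on the unit square. -/
noncomputable abbrev squareLaw : Measure (unitInterval × unitInterval) :=
  (volume : Measure unitInterval).prod volume

theorem isProbabilityMeasure_coordLaw (hd : 1 ≤ d) : IsProbabilityMeasure (coordLaw d) := by
  have : Nonempty (Fin d) := ⟨⟨0, hd⟩⟩
  exact ProbabilityTheory.isProbabilityMeasure_uniformOn Set.finite_univ Set.univ_nonempty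

/-- Nothing is known about `f` off `S`, not even measurability; as all iterates stay in `S`, a
measurable `cost` that agrees with the error there may replace it. Answer seeds and position seeds
are then paired into one independent sequence. -/
theorem expectedError_rsscd (hd : 1 ≤ d) (hS : IsCompact S) (hc : Convex ℝ S) (hR : 0 ≤ R) (c : ℝ)
    {x₀ : Point d} (hx₀ : x₀ ∈ S) (T : ℕ) (hη : ∀ j, Measurable fun x => η x j)
    {f : Point d → ℝ} (xstar : Point d) {cost : Point d → ENNReal} (hcost : Measurable cost)
    (hfc : ∀ x ∈ S, ENNReal.ofReal (f x - f xstar) = cost x) :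
    (rsscd S R c x₀ T).expectedError (cdSeedLaw d) η f xstar =
      ∫⁻ J, ∫⁻ z, cost (noisyPoint S R (lsEpochs c d T) (lsSamples c d T) η x₀ J z
        (cdEpochs d T)) ∂seqLaw squareLaw ∂seqLaw (coordLaw d) := by
  have := isProbabilityMeasure_coordLaw hd
  have h1 : ∀ ω : CDSeed d, (rsscd S R c x₀ T).expectedFrom η
      (fun x => ENNReal.ofReal (f x - f xstar)) ω (rsscd S R c x₀ T).numQueries [] =
      ∫⁻ v, cost (noisyPoint S R (lsEpochs c d T) (lsSamples c d T) η x₀ ω.1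
        (fun m => (ω.2 m, v m)) (cdEpochs d T)) ∂seqLaw (volume : Measure unitInterval) := by
    intro ω
    rw [expectedFrom_eq_lintegral_simulate]
    refine lintegral_congr fun v => ?_
    change ENNReal.ofReal (f (cdPoint S R c x₀ T ω (fun m => (simulate (rsscd S R c x₀ T) η ω v
        (rsscd S R c x₀ T).numQueries []).getD m false) (cdEpochs d T)) - f xstar) = _
    rw [cdPoint_simulate S R c x₀ T η ω v le_rfl]
    exact hfc _ (noisyPoint_mem hS hc hR _ _ hx₀ _ _ _)
  unfold SignAlgorithm.expectedError
  simp_rw [h1]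
  have hm : ∀ {Ω : Type} [MeasurableSpace Ω] {J : Ω → ℕ → Fin d} (_ : Measurable J)
      {z : Ω → ℕ → unitInterval × unitInterval} (_ : Measurable z),
      Measurable fun ω => cost (noisyPoint S R (lsEpochs c d T) (lsSamples c d T) η x₀ (J ω) (z ω)
        (cdEpochs d T)) := by
    intro Ω _ J hJ z hz
    exact hcost.comp (measurable_noisyPoint hS hη _ _ x₀ hJ hz _)
  unfold cdSeedLaw
  rw [lintegral_prod]
  · refine lintegral_congr fun J => ?_
    have h2 := hm (J := fun _ : ℕ → unitInterval × unitInterval => J) measurable_const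
      (z := fun z => z) measurable_id
    rw [← (measurePreserving_pairSeq (volume : Measure unitInterval)
      (volume : Measure unitInterval)).lintegral_comp h2, lintegral_prod]
    exact (hm measurable_const (by fun_prop)).aemeasurable
  · refine Measurable.aemeasurable (Measurable.lintegral_prod_right' (f := fun p :
      CDSeed d × (ℕ → unitInterval) => cost (noisyPoint S R (lsEpochs c d T) (lsSamples c d T) η x₀
        p.1.1 (fun m => (p.1.2 m, p.2 m)) (cdEpochs d T))) ?_)
    exact hm (by fun_prop) (by fun_prop)

end NoisyDescent

/-! ### Concentration of empirical risk minimization -/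

section Concentration

open Classical in
/-- Excess loss of the threshold `t` over the threshold `s` at a sample. -/
noncomputable def excessLoss (pos : unitInterval → ℝ) (p : ℝ → unitInterval) (s t : ℝ)
    (z : unitInterval × unitInterval) : ℝ :=
  (if decide (z.2 < p (pos z.1)) = decide (t < pos z.1) then 0 else 1) -
    (if decide (z.2 < p (pos z.1)) = decide (s < pos z.1) then 0 else 1)

variable {pos : unitInterval → ℝ} {p : ℝ → unitInterval} {s : ℝ}

theorem neg_one_le_excessLoss (t : ℝ) (z : unitInterval × unitInterval) :
    -1 ≤ excessLoss pos p s t z := by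
  unfold excessLoss
  split_ifs <;> norm_num

theorem measurable_excessLoss {Ω : Type*} [MeasurableSpace Ω] (hpos : Measurable pos)
    (hp : Measurable p) {t : Ω → ℝ} {z : Ω → unitInterval × unitInterval} (ht : Measurable t)
    (hz : Measurable z) : Measurable fun ω => excessLoss pos p s (t ω) (z ω) := by
  classical
  have h1 : Measurable fun ω => pos (z ω).1 := hpos.comp (measurable_fst.comp hz)
  have h2 : Measurable fun ω => decide ((z ω).2 < p (pos (z ω).1)) :=
    measurable_decide_lt (measurable_snd.comp hz) (hp.comp h1)
  unfold excessLoss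
  refine Measurable.sub ?_ ?_
  · exact Measurable.ite (measurableSet_eq_fun h2 (measurable_decide_lt ht h1)) measurable_const
      measurable_const
  · exact Measurable.ite (measurableSet_eq_fun h2 (measurable_decide_lt measurable_const h1))
      measurable_const measurable_const

theorem exp_neg_le_quadratic {θ : ℝ} (h0 : 0 ≤ θ) (h1 : θ ≤ 1) : Real.exp (-θ) ≤ 1 - θ + θ ^ 2 := by
  have := Real.abs_exp_sub_one_sub_id_le (x := -θ) (by rw [abs_neg, abs_of_nonneg h0]; exact h1)
  have := (abs_le.1 this).2
  linarith [neg_sq θ]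

theorem exp_le_quadratic {θ : ℝ} (h0 : 0 ≤ θ) (h1 : θ ≤ 1) : Real.exp θ ≤ 1 + θ + θ ^ 2 := by
  have := (abs_le.1 (Real.abs_exp_sub_one_sub_id_le (x := θ) (by rwa [abs_of_nonneg h0]))).2
  linarith

/-- Exponential moment of the excess loss at a fixed position. -/
theorem lintegral_exp_excessLoss_snd {θ q : ℝ} (h0 : 0 ≤ θ) (h1 : θ ≤ 1) (u : unitInterval) (t : ℝ)
    (hright : s < pos u → 1 / 2 ≤ (p (pos u) : ℝ)) (hleft : pos u ≤ s → (p (pos u) : ℝ) ≤ 1 / 2)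
    (hq : q ≤ 0 ∨ (q ≤ |2 * (p (pos u) : ℝ) - 1| ∧ ((s < pos u ∧ pos u ≤ t) ∨
      (t < pos u ∧ pos u ≤ s)))) :
    ∫⁻ v : unitInterval, ENNReal.ofReal (Real.exp (-θ * excessLoss pos p s t (u, v))) ≤
      ENNReal.ofReal (1 + θ ^ 2 - θ * q) := by
  classical
  set P : ℝ := (p (pos u) : ℝ) with hP
  have hP0 : 0 ≤ P := (p (pos u)).2.1
  have hP1 : P ≤ 1 := (p (pos u)).2.2
  have hms : MeasurableSet {v : unitInterval | v < p (pos u)} := measurableSet_Iio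
  -- At a fixed position the excess loss depends only on the answer, which has the weights `P` and
  -- `1 - P`.
  have hconst : ∀ A B : ℝ, 0 ≤ A → 0 ≤ B →
      (∀ v : unitInterval, v < p (pos u) → Real.exp (-θ * excessLoss pos p s t (u, v)) ≤ A) →
      (∀ v : unitInterval, ¬ v < p (pos u) → Real.exp (-θ * excessLoss pos p s t (u, v)) ≤ B) →
      ∫⁻ v : unitInterval, ENNReal.ofReal (Real.exp (-θ * excessLoss pos p s t (u, v))) ≤
        ENNReal.ofReal (P * A + (1 - P) * B) := by
    intro A B hA hB h1 h2
    calc _ ≤ ∫⁻ v : unitInterval, ({v | v < p (pos u)}.indicator (fun _ => ENNReal.ofReal A) v +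
          {v | v < p (pos u)}ᶜ.indicator (fun _ => ENNReal.ofReal B) v) := by
          refine lintegral_mono fun v => ?_
          by_cases hv : v < p (pos u)
          · simpa [hv] using ENNReal.ofReal_le_ofReal (h1 v hv)
          · simpa [hv] using ENNReal.ofReal_le_ofReal (h2 v hv)
      _ = ENNReal.ofReal A * ENNReal.ofReal P + ENNReal.ofReal B * ENNReal.ofReal (1 - P) := by
          rw [lintegral_add_left (measurable_const.indicator hms), lintegral_indicator hms,
            lintegral_indicator hms.compl, setLIntegral_const, setLIntegral_const,
            prob_compl_eq_one_sub hms, volume_setOf_lt_unitInterval, ENNReal.ofReal_sub _ hP0,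
            ENNReal.ofReal_one]
      _ = _ := by
          rw [← ENNReal.ofReal_mul hA, ← ENNReal.ofReal_mul hB, ← ENNReal.ofReal_add
            (mul_nonneg hA hP0) (mul_nonneg hB (by linarith))]
          congr 1; ring
  have e1 := exp_neg_le_quadratic h0 h1
  have e2 := exp_le_quadratic h0 h1
  have n1 : 0 ≤ 1 - θ + θ ^ 2 := (Real.exp_pos _).le.trans e1
  have n2 : 0 ≤ 1 + θ + θ ^ 2 := (Real.exp_pos _).le.trans e2
  by_cases hs : s < pos u
  · have hP2 := hright hs
    -- If `t` also predicts `+` here, the excess loss vanishes. Otherwise it is `1` for the answer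
    -- `+` and `-1` for the answer `-`, with mean `2 * P - 1`.
    by_cases ht : t < pos u
    · have hq0 : q ≤ 0 := by
        rcases hq with h | ⟨-, h | h⟩
        · exact h
        · exact absurd ht (not_lt.2 h.2)
        · exact absurd hs (not_lt.2 h.2)
      refine (hconst 1 1 zero_le_one zero_le_one ?_ ?_).trans (ENNReal.ofReal_le_ofReal ?_)
      · intro v hv; simp [excessLoss, hv, hs, ht]
      · intro v hv; simp [excessLoss, hv, hs, ht]
      · nlinarith [sq_nonneg θ, mul_nonneg h0 (neg_nonneg.2 hq0)]
    · refine (hconst (1 - θ + θ ^ 2) (1 + θ + θ ^ 2) n1 n2 ?_ ?_).trans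
        (ENNReal.ofReal_le_ofReal ?_)
      · intro v hv; simpa [excessLoss, hv, hs, ht] using e1
      · intro v hv; simpa [excessLoss, hv, hs, ht] using e2
      · have hq' : q ≤ 2 * P - 1 := by
          rcases hq with h | ⟨h, -⟩
          · linarith
          · rwa [abs_of_nonneg (by linarith)] at h
        nlinarith [mul_le_mul_of_nonneg_left hq' h0]
  · have hP2 := hleft (not_lt.1 hs)
    by_cases ht : t < pos u
    · refine (hconst (1 + θ + θ ^ 2) (1 - θ + θ ^ 2) n2 n1 ?_ ?_).trans
        (ENNReal.ofReal_le_ofReal ?_)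
      · intro v hv; simpa [excessLoss, hv, hs, ht] using e2
      · intro v hv; simpa [excessLoss, hv, hs, ht] using e1
      · have hq' : q ≤ 1 - 2 * P := by
          rcases hq with h | ⟨h, -⟩
          · linarith
          · rw [abs_of_nonpos (by linarith)] at h
            linarith
        nlinarith [mul_le_mul_of_nonneg_left hq' h0]
    · have hq0 : q ≤ 0 := by
        rcases hq with h | ⟨-, h | h⟩
        · exact h
        · exact absurd h.1 hs
        · exact absurd h.1 ht
      refine (hconst 1 1 zero_le_one zero_le_one ?_ ?_).trans (ENNReal.ofReal_le_ofReal ?_)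
      · intro v hv; simp [excessLoss, hv, hs, ht]
      · intro v hv; simp [excessLoss, hv, hs, ht]
      · nlinarith [sq_nonneg θ, mul_nonneg h0 (neg_nonneg.2 hq0)]

/-- Exponential moment of the excess loss of a threshold that is separated from `s` by a set `U` of
positions whose labels are biased by at least `q`. -/
theorem lintegral_exp_excessLoss (hpos : Measurable pos) (hp : Measurable p)
    (hright : ∀ u, s < pos u → 1 / 2 ≤ (p (pos u) : ℝ))
    (hleft : ∀ u, pos u ≤ s → (p (pos u) : ℝ) ≤ 1 / 2) {m₀ q t : ℝ} (hm₀ : 0 ≤ m₀) (hm₁ : m₀ ≤ 1)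
    {U : Set unitInterval} (hU : MeasurableSet U) (hUm : m₀ ≤ q * volume.real U)
    (hUq : ∀ u ∈ U, q ≤ |2 * (p (pos u) : ℝ) - 1| ∧ ((s < pos u ∧ pos u ≤ t) ∨
      (t < pos u ∧ pos u ≤ s))) :
    ∫⁻ z, ENNReal.ofReal (Real.exp (-(m₀ / 2) * excessLoss pos p s t z)) ∂squareLaw ≤
      ENNReal.ofReal (Real.exp (-(m₀ ^ 2 / 4))) := by
  set θ := m₀ / 2 with hθ
  have h0 : 0 ≤ θ := by positivity
  have h1 : θ ≤ 1 := by linarith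
  have hmeas : Measurable fun z => ENNReal.ofReal (Real.exp (-θ * excessLoss pos p s t z)) :=
    (Real.measurable_exp.comp ((measurable_excessLoss hpos hp measurable_const
      measurable_id).const_mul _)).ennreal_ofReal
  rw [lintegral_prod _ hmeas.aemeasurable]
  have hin : ∀ u : unitInterval,
      ∫⁻ v : unitInterval, ENNReal.ofReal (Real.exp (-θ * excessLoss pos p s t (u, v))) ≤
        U.indicator (fun _ => ENNReal.ofReal (1 + θ ^ 2 - θ * q)) u +
          Uᶜ.indicator (fun _ => ENNReal.ofReal (1 + θ ^ 2)) u := by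
    intro u
    by_cases hu : u ∈ U
    · simpa [hu] using lintegral_exp_excessLoss_snd h0 h1 u t (hright u) (hleft u)
        (Or.inr (hUq u hu))
    · simpa [hu] using lintegral_exp_excessLoss_snd (q := 0) h0 h1 u t (hright u) (hleft u)
        (Or.inl le_rfl)
  refine (lintegral_mono hin).trans ?_
  rw [lintegral_add_left (measurable_const.indicator hU), lintegral_indicator hU,
    lintegral_indicator hU.compl, setLIntegral_const, setLIntegral_const]
  have hw0 : 0 ≤ volume.real U := measureReal_nonneg
  have hw1 : volume.real U ≤ 1 := measureReal_le_one
  have hwc : volume Uᶜ = ENNReal.ofReal (1 - volume.real U) := by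
    rw [prob_compl_eq_one_sub hU, ENNReal.ofReal_sub _ hw0, ENNReal.ofReal_one, ofReal_measureReal]
  rw [hwc, ← ofReal_measureReal (μ := volume) (s := U)]
  -- The bound `q ≤ 1` needs a point of `U`; for empty `U` the margin `m₀` is zero and the claim is
  -- trivial.
  rcases U.eq_empty_or_nonempty with hUe | ⟨u, hu⟩
  · have hm : m₀ = 0 := le_antisymm (by simpa [hUe] using hUm) hm₀
    simp [hUe, hθ, hm]
  have hq1 : q ≤ 1 := (hUq u hu).1.trans (abs_le.2 ⟨by linarith [(p (pos u)).2.1],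
    by linarith [(p (pos u)).2.2]⟩)
  have hn : 0 ≤ 1 + θ ^ 2 - θ * q := by nlinarith [sq_nonneg θ, mul_le_mul_of_nonneg_left hq1 h0]
  rw [← ENNReal.ofReal_mul hn, ← ENNReal.ofReal_mul (by positivity), ← ENNReal.ofReal_add
    (by positivity) (mul_nonneg (by positivity) (by linarith))]
  refine ENNReal.ofReal_le_ofReal ?_
  calc _ = 1 + θ ^ 2 - θ * (q * volume.real U) := by ring
    _ ≤ 1 + θ ^ 2 - θ * m₀ := by linarith [mul_le_mul_of_nonneg_left hUm h0]
    -- The choice `θ = m₀ / 2` minimizes `θ ^ 2 - θ * m₀`.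
    _ = -(m₀ ^ 2 / 4) + 1 := by rw [hθ]; ring
    _ ≤ _ := Real.add_one_le_exp _

open Classical in
-- The minimizer is `lo` or a sample point, so a union bound over `N + 1` candidates suffices and no
-- uniform deviation bound is needed. A candidate at sample `r` is independent of the other `N - 1`
-- samples, and leaving sample `r` out changes the total excess loss by at most `1`; hence the
-- factor `2` and the exponent `N - 1`.
theorem measure_ermThreshold_far_le (N : ℕ) (hpos : Measurable pos) (hp : Measurable p)
    {lo hi δ m₀ : ℝ} (hmem : ∀ u, pos u ∈ Set.Icc lo hi) (hs : s ∈ Set.Icc lo hi)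
    (hright : ∀ u, s < pos u → 1 / 2 ≤ (p (pos u) : ℝ))
    (hleft : ∀ u, pos u ≤ s → (p (pos u) : ℝ) ≤ 1 / 2) (hm₀ : 0 ≤ m₀) (hm₁ : m₀ ≤ 1)
    (hgap : ∀ t ∈ Set.Icc lo hi, δ < |t - s| → ∃ (q : ℝ) (U : Set unitInterval), MeasurableSet U ∧
      m₀ ≤ q * volume.real U ∧ ∀ u ∈ U, q ≤ |2 * (p (pos u) : ℝ) - 1| ∧
        ((s < pos u ∧ pos u ≤ t) ∨ (t < pos u ∧ pos u ≤ s))) :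
    seqLaw squareLaw {z | δ < |ermThreshold lo ((List.range N).map fun i =>
      (pos (z i).1, decide ((z i).2 < p (pos (z i).1)))) - s|} ≤
      ENNReal.ofReal ((N + 1) * (2 * Real.exp (-(m₀ ^ 2 / 4)) ^ (N - 1))) := by
  set θ := m₀ / 2 with hθ
  have h0 : 0 ≤ θ := by positivity
  set ρ := Real.exp (-(m₀ ^ 2 / 4)) with hρ
  have hρ0 : 0 < ρ := Real.exp_pos _
  have hρ1 : ρ ≤ 1 := Real.exp_le_one_iff.2 (by nlinarith [sq_nonneg m₀])
  let φ : ℝ → unitInterval × unitInterval → ENNReal := fun t z =>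
    ENNReal.ofReal (Real.exp (-θ * excessLoss pos p s t z))
  have hφ : ∀ {Ω : Type} [MeasurableSpace Ω] {t : Ω → ℝ} {z : Ω → unitInterval × unitInterval}
      (_ : Measurable t) (_ : Measurable z), Measurable fun ω => φ (t ω) (z ω) := by
    intro Ω _ t z ht hz
    exact (Real.measurable_exp.comp ((measurable_excessLoss hpos hp ht hz).const_mul
      _)).ennreal_ofReal
  have hφle : ∀ t ∈ Set.Icc lo hi, δ < |t - s| → ∫⁻ z, φ t z ∂squareLaw ≤ ENNReal.ofReal ρ := by
    intro t ht hd
    obtain ⟨q, U, hU, hUm, hUq⟩ := hgap t ht hd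
    exact lintegral_exp_excessLoss hpos hp hright hleft hm₀ hm₁ hU hUm hUq
  let D : (ℕ → unitInterval × unitInterval) → List (ℝ × Bool) := fun z =>
    (List.range N).map fun i => (pos (z i).1, decide ((z i).2 < p (pos (z i).1)))
  let bad : ℝ → Set (ℕ → unitInterval × unitInterval) := fun t =>
    {z | δ < |t - s| ∧ ∑ i ∈ Finset.range N, excessLoss pos p s t (z i) ≤ 0}
  have hdiff : ∀ z t, (empError (D z) t : ℝ) - empError (D z) s =
      ∑ i ∈ Finset.range N, excessLoss pos p s t (z i) := by
    intro z t
    simp only [D]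
    rw [empError_map_range, empError_map_range]
    push_cast
    rw [← Finset.sum_sub_distrib]
    exact Finset.sum_congr rfl fun i _ => by simp only [excessLoss]
  have hsub : {z | δ < |ermThreshold lo (D z) - s|} ⊆
      bad lo ∪ ⋃ r ∈ Finset.range N, {z | z ∈ bad (pos (z r).1)} := by
    intro z hz
    -- The threshold `s` competes with the minimizer although it need not be a candidate.
    have hle : ∑ i ∈ Finset.range N, excessLoss pos p s (ermThreshold lo (D z)) (z i) ≤ 0 := by
      rw [← hdiff, sub_nonpos]
      exact_mod_cast empError_ermThreshold_le lo (D z) hs.1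
    rcases ermThreshold_eq_or lo (D z) with h | ⟨a, ha, h⟩
    · left
      rw [h] at hle
      exact ⟨by rw [← h]; exact hz, hle⟩
    · right
      obtain ⟨r, hr, rfl⟩ := List.mem_map.1 ha
      have hz' : δ < |ermThreshold lo (D z) - s| := hz
      rw [h] at hle hz'
      exact Set.mem_biUnion (Finset.mem_coe.2 (Finset.mem_range.2 (List.mem_range.1 hr)))
        ⟨hz', hle⟩
  have hprod : ∀ t (z : ℕ → unitInterval × unitInterval) (A : Finset ℕ), ∏ i ∈ A, φ t (z i) =
      ENNReal.ofReal (Real.exp (-θ * ∑ i ∈ A, excessLoss pos p s t (z i))) := by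
    intro t z A
    rw [← ENNReal.ofReal_prod_of_nonneg fun i _ => (Real.exp_pos _).le, ← Real.exp_sum,
      Finset.mul_sum]
  have hpow : ∀ t ∈ Set.Icc lo hi, δ < |t - s| → ∀ A : Finset ℕ,
      ∫⁻ z, ∏ i ∈ A, φ t (z i) ∂seqLaw squareLaw ≤ ENNReal.ofReal (ρ ^ A.card) := by
    intro t ht hd A
    rw [lintegral_seq_prod squareLaw A (φ := fun _ => φ t) fun _ =>
      hφ measurable_const measurable_id, Finset.prod_const, ENNReal.ofReal_pow hρ0.le]
    gcongr
    exact hφle t ht hd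
  have hlo : seqLaw squareLaw (bad lo) ≤ ENNReal.ofReal (2 * ρ ^ (N - 1)) := by
    by_cases hd : δ < |lo - s|
    · calc seqLaw squareLaw (bad lo) ≤
          ∫⁻ z, ∏ i ∈ Finset.range N, φ lo (z i) ∂seqLaw squareLaw := by
            refine (measure_mono ?_).trans (meas_ge_le_lintegral_div (f := fun z =>
              ∏ i ∈ Finset.range N, φ lo (z i)) ?_ one_ne_zero ENNReal.one_ne_top |>.trans
              (by rw [div_one]))
            · intro z hz
              simp only [Set.mem_ofPred_eq]
              rw [hprod, ENNReal.one_le_ofReal, Real.one_le_exp_iff]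
              nlinarith [hz.2]
            · exact (Finset.measurable_prod _ fun i _ => hφ measurable_const
                (measurable_pi_apply i)).aemeasurable
        _ ≤ ENNReal.ofReal (ρ ^ N) := by
            simpa using hpow lo ⟨le_rfl, hs.1.trans hs.2⟩ hd (Finset.range N)
        _ ≤ _ := by
            refine ENNReal.ofReal_le_ofReal ?_
            have := pow_le_pow_of_le_one hρ0.le hρ1 (Nat.sub_le N 1)
            linarith [pow_pos hρ0 (N - 1)]
    · have : bad lo = ∅ := by ext z; simp [bad, hd]
      simp [this]
  have hr : ∀ r ∈ Finset.range N, seqLaw squareLaw {z | z ∈ bad (pos (z r).1)} ≤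
      ENNReal.ofReal (2 * ρ ^ (N - 1)) := by
    intro r hr
    let A := (Finset.range N).erase r
    have hA : A.card = N - 1 := by simp [A, Finset.card_erase_of_mem hr]
    let B : Set (unitInterval × unitInterval) := {w | δ < |pos w.1 - s|}
    have hB : MeasurableSet B := measurableSet_lt measurable_const
      ((hpos.comp measurable_fst).sub_const s).abs
    -- Markov's inequality is applied to `F`, which is at least `1` on the bad event; the factor
    -- `exp θ` pays for the omitted sample `r`.
    let F : (ℕ → unitInterval × unitInterval) → ENNReal := fun z =>
      B.indicator (fun _ => 1) (z r) * (ENNReal.ofReal (Real.exp θ) *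
        ∏ i ∈ A, φ (pos (z r).1) (z i))
    have hF : Measurable F := by
      refine ((measurable_const.indicator hB).comp (measurable_pi_apply r)).mul
        (Measurable.const_mul (Finset.measurable_prod _ fun i _ => ?_) _)
      exact hφ (hpos.comp (measurable_fst.comp (measurable_pi_apply r))) (measurable_pi_apply i)
    have h1 : seqLaw squareLaw {z | z ∈ bad (pos (z r).1)} ≤ ∫⁻ z, F z ∂seqLaw squareLaw := by
      refine (measure_mono ?_).trans (meas_ge_le_lintegral_div (f := F) hF.aemeasurable
        one_ne_zero ENNReal.one_ne_top |>.trans (by rw [div_one]))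
      intro z hz
      have hzB : z r ∈ B := hz.1
      simp only [Set.mem_ofPred_eq, F, Set.indicator_of_mem hzB, one_mul]
      rw [hprod, ← ENNReal.ofReal_mul (Real.exp_pos _).le, ← Real.exp_add, ENNReal.one_le_ofReal,
        Real.one_le_exp_iff]
      have hz2 := hz.2
      rw [← Finset.add_sum_erase _ _ hr] at hz2
      have := neg_one_le_excessLoss (pos := pos) (p := p) (s := s) (pos (z r).1) (z r)
      have h3 : ∑ i ∈ A, excessLoss pos p s (pos (z r).1) (z i) ≤ 1 := by
        simp only [A]; linarith
      nlinarith [mul_le_mul_of_nonneg_left h3 h0]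
    have h2 : ∫⁻ z, F z ∂seqLaw squareLaw = ∫⁻ w, ∫⁻ z, B.indicator (fun _ => 1) w *
        (ENNReal.ofReal (Real.exp θ) * ∏ i ∈ A, φ (pos w.1) (z i)) ∂seqLaw squareLaw
          ∂squareLaw := by
      -- With sample `r` fixed as `w`, the candidate `pos w.1` is a constant for the integral over
      -- the other samples.
      rw [lintegral_update squareLaw r hF, lintegral_lintegral_swap (f := fun z w =>
        F (Function.update z r w)) (hF.comp (measurable_update_seq r)).aemeasurable]
      refine lintegral_congr fun w => lintegral_congr fun z => ?_
      simp only [F, Function.update_self]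
      congr 2
      refine Finset.prod_congr rfl fun i hi => ?_
      rw [Function.update_of_ne (Finset.ne_of_mem_erase hi)]
    have h4 : ∀ w, ∫⁻ z, B.indicator (fun _ => 1) w * (ENNReal.ofReal (Real.exp θ) *
        ∏ i ∈ A, φ (pos w.1) (z i)) ∂seqLaw squareLaw ≤ ENNReal.ofReal (2 * ρ ^ (N - 1)) := by
      intro w
      by_cases hw : w ∈ B
      · simp only [Set.indicator_of_mem hw, one_mul]
        rw [lintegral_const_mul _ (Finset.measurable_prod _ fun i _ => hφ measurable_const
          (measurable_pi_apply i)), ENNReal.ofReal_mul zero_le_two]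
        gcongr
        · refine (exp_le_quadratic h0 (by linarith)).trans ?_
          nlinarith
        · rw [← hA]
          exact hpow _ (hmem _) hw A
      · simp [Set.indicator_of_notMem hw]
    calc _ ≤ _ := h1
      _ = _ := h2
      _ ≤ ∫⁻ _, ENNReal.ofReal (2 * ρ ^ (N - 1)) ∂squareLaw := lintegral_mono h4
      _ = _ := by simp
  calc _ ≤ seqLaw squareLaw (bad lo ∪ ⋃ r ∈ Finset.range N, {z | z ∈ bad (pos (z r).1)}) :=
        measure_mono hsub
    _ ≤ seqLaw squareLaw (bad lo) +
        ∑ r ∈ Finset.range N, seqLaw squareLaw {z | z ∈ bad (pos (z r).1)} :=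
        (measure_union_le _ _).trans (by gcongr; exact measure_biUnion_finset_le _ _)
    _ ≤ ENNReal.ofReal (2 * ρ ^ (N - 1)) +
        ∑ r ∈ Finset.range N, ENNReal.ofReal (2 * ρ ^ (N - 1)) := by
        gcongr with r hr'
        exact hr r hr'
    _ = _ := by
        rw [Finset.sum_const, Finset.card_range, nsmul_eq_mul,
          ENNReal.ofReal_mul (p := (N : ℝ) + 1) (by positivity),
          ENNReal.ofReal_add (by positivity) zero_le_one, ENNReal.ofReal_natCast,
          ENNReal.ofReal_one]
        ring

end Concentration

/-! ### Uniformly convex, locally strongly smooth functions -/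

section FunctionClass

variable {d : ℕ} {S : Set (Point d)} {f : Point d → ℝ} {g : Point d → Point d} {k lam Lam : ℝ}
  {x : Point d} {j : Fin d} {α : ℝ}

theorem IsGradientOn.continuousOn (hg : IsGradientOn S f g) : ContinuousOn f S :=
  fun x hx => (hg x hx).continuousWithinAt

theorem inner_along_sub_along (v x : Point d) (j : Fin d) (α β : ℝ) :
    inner ℝ v (along x j α - along x j β) = (α - β) * v j := by
  rw [along_sub_along, inner_smul_right, EuclideanSpace.inner_single_right]
  simp

theorem exists_isDirMin (hS : IsCompact S) (hf : ContinuousOn f S) (hx : x ∈ S) (j : Fin d) :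
    ∃ α, IsDirMin S f x j α := by
  have hcont : ContinuousOn (fun β => f (along x j β)) (lineSlice S x j) :=
    hf.comp ((continuous_along j).comp (Continuous.prodMk_right x)).continuousOn fun β hβ => hβ
  obtain ⟨α, hα, h⟩ := (isCompact_lineSlice (x := x) (j := j) hS).exists_isMinOn
    ⟨0, zero_mem_lineSlice hx⟩ hcont
  exact ⟨α, hα, fun β hβ => h hβ⟩

theorem IsDirMin.shift (h : IsDirMin S f x j α) (β : ℝ) :
    IsDirMin S f (along x j β) j (α - β) := by
  refine ⟨by rw [along_along]; simpa using h.1, fun γ hγ => ?_⟩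
  rw [along_along] at hγ ⊢
  rw [along_along]
  simpa using h.2 _ hγ

/-- All points of a line in direction `j` share the directional minimum, so smoothness may be
applied at each of them. -/
theorem IsLkSS.abs_le (hss : IsLkSS S f g k Lam) (h : IsDirMin S f x j α) {β : ℝ}
    (hβ : β ∈ lineSlice S x j) : |g (along x j β) j| ≤ Lam * |β - α| ^ (k - 1) := by
  have := hss _ hβ j _ (h.shift β)
  rwa [along_along, norm_along_sub_along, show β - (β + (α - β)) = β - α by ring] at this

theorem IsUC.le_mul (huc : IsUC S f g k lam) (h : IsDirMin S f x j α) {β : ℝ}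
    (hβ : β ∈ lineSlice S x j) :
    f (along x j β) - f (along x j α) + lam / 2 * |β - α| ^ k ≤ g (along x j β) j * (β - α) := by
  have := huc _ hβ _ h.1
  rw [inner_along_sub_along, norm_along_sub_along] at this
  linarith

theorem IsUC.lower_le_mul (huc : IsUC S f g k lam) (h : IsDirMin S f x j α) {β : ℝ}
    (hβ : β ∈ lineSlice S x j) : lam / 2 * |β - α| ^ k ≤ g (along x j β) j * (β - α) := by
  have := huc.le_mul h hβ
  linarith [h.2 β hβ]

theorem abs_rpow_sub_one_mul {t k : ℝ} (hk : 1 < k) : |t| ^ (k - 1) * |t| = |t| ^ k := by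
  rcases eq_or_ne t 0 with rfl | ht
  · simp [Real.zero_rpow (by linarith : k ≠ 0)]
  · rw [← Real.rpow_add_one (abs_ne_zero.2 ht)]; simp

theorem IsUC.lower_le_abs (hk : 1 < k) (huc : IsUC S f g k lam) (h : IsDirMin S f x j α) {β : ℝ}
    (hβ : β ∈ lineSlice S x j) (hne : β ≠ α) :
    lam / 2 * |β - α| ^ (k - 1) ≤ |g (along x j β) j| := by
  have h1 := (huc.lower_le_mul h hβ).trans (le_abs_self _)
  rw [abs_mul, ← abs_rpow_sub_one_mul hk, ← mul_assoc] at h1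
  exact le_of_mul_le_mul_right h1 (abs_pos.2 (sub_ne_zero.2 hne))

/-- By convexity the excess value is at most the derivative at `β` times the distance, and
smoothness bounds that derivative. -/
theorem lineSearch_error_le (hk : 1 < k) (hlam : 0 ≤ lam) (huc : IsUC S f g k lam)
    (hss : IsLkSS S f g k Lam) (h : IsDirMin S f x j α) {β : ℝ} (hβ : β ∈ lineSlice S x j) :
    f (along x j β) - f (along x j α) ≤ Lam * |β - α| ^ k := by
  have h1 := huc.le_mul h hβ
  have h2 : 0 ≤ lam / 2 * |β - α| ^ k := by positivity
  have h3 := (le_abs_self (g (along x j β) j * (β - α)))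
  rw [abs_mul] at h3
  have h4 := mul_le_mul_of_nonneg_right (hss.abs_le h hβ) (abs_nonneg (β - α))
  rw [mul_assoc, abs_rpow_sub_one_mul hk] at h4
  linarith

/-- A minimum at an end of the slice need not be stationary in general; here smoothness applies at
the minimum itself, where the distance is `0`. -/
theorem IsLkSS.eq_zero (hk : 1 < k) (hss : IsLkSS S f g k Lam) (h : IsDirMin S f x j α) :
    g (along x j α) j = 0 := by
  have := hss.abs_le h h.1
  rw [sub_self, abs_zero, Real.zero_rpow (by linarith), mul_zero] at this
  exact abs_eq_zero.1 (le_antisymm this (abs_nonneg _))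

/-- The linear term of uniform convexity at the directional minimum vanishes. -/
theorem lineSearch_gain_ge (hk : 1 < k) (huc : IsUC S f g k lam)
    (hss : IsLkSS S f g k Lam) (h : IsDirMin S f x j α) (hx : x ∈ S) :
    lam / 2 * |α| ^ k ≤ f x - f (along x j α) := by
  have h1 := huc _ h.1 _ (show along x j 0 ∈ S by rwa [along_zero])
  rw [inner_along_sub_along, hss.eq_zero hk h, norm_along_sub_along, along_zero] at h1
  simp only [mul_zero, add_zero, sub_zero] at h1
  linarith

/-- The error is controlled by the gains of the coordinate line searches. -/
theorem error_le_sum_gain (hk : 2 ≤ k) (hlam : 0 < lam) (hLam : lam / 2 < Lam)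
    (huc : IsUC S f g k lam) (hss : IsLkSS S f g k Lam) (hd : 1 ≤ d) (hx : x ∈ S)
    {A : Fin d → ℝ} (hA : ∀ j, IsDirMin S f x j (A j)) {xstar : Point d} (hxs : xstar ∈ S)
    (hmin : IsMinOn f S xstar) :
    f x - f xstar ≤ (2 * d * Lam / lam) ^ 2 * ∑ j, (f x - f (along x j (A j))) := by
  have : Nonempty (Fin d) := ⟨⟨0, hd⟩⟩
  have hd' : (1 : ℝ) ≤ d := by exact_mod_cast hd
  have hLam0 : 0 < Lam := by linarith
  have hk1 : 1 < k := by linarith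
  -- The largest distance `ρ` to a directional minimum bounds all partial derivatives, while the
  -- gain in direction `j₀` alone is at least `lam / 2 * ρ ^ k`.
  obtain ⟨j₀, hj₀⟩ := Finite.exists_max fun j => |A j|
  set ρ := |A j₀| with hρ
  have hρ0 : 0 ≤ ρ := abs_nonneg _
  set D := 2 * d * Lam / lam with hD
  have hD1 : 1 ≤ D := by
    rw [hD, one_le_div hlam]
    nlinarith
  set r := ‖x - xstar‖ with hr
  have hr0 : 0 ≤ r := norm_nonneg _
  have hgj : ∀ j, |g x j| ≤ Lam * ρ ^ (k - 1) := by
    intro j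
    have := hss.abs_le (hA j) (zero_mem_lineSlice hx)
    rw [along_zero, zero_sub, abs_neg] at this
    refine this.trans ?_
    gcongr
    exact hj₀ j
  have hinner : -inner ℝ (g x) (xstar - x) ≤ d * Lam * ρ ^ (k - 1) * r := by
    refine (neg_le_abs _).trans ?_
    rw [PiLp.inner_apply]
    refine (Finset.abs_sum_le_sum_abs _ _).trans ?_
    calc ∑ i, |inner ℝ (g x i) ((xstar - x) i)| ≤ ∑ _i : Fin d, Lam * ρ ^ (k - 1) * r := by
          refine Finset.sum_le_sum fun i _ => ?_
          simp only [RCLike.inner_apply, conj_trivial]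
          rw [abs_mul, mul_comm]
          refine mul_le_mul (hgj i) ?_ (abs_nonneg _) (by positivity)
          rw [hr, norm_sub_rev]
          exact PiLp.norm_apply_le (xstar - x) i
      _ = _ := by simp; ring
  have h1 := huc x hx xstar hxs
  rw [← hr] at h1
  have h2 : f xstar ≤ f x := hmin hx
  have h3 : 0 ≤ lam / 2 * r ^ k := by positivity
  -- Since `f xstar ≤ f x`, the linear term of uniform convexity has to outweigh `lam / 2 * r ^ k`,
  -- which bounds `r`.
  have hrD : r ≤ D * ρ := by
    rcases hr0.eq_or_lt with h0 | h0
    · rw [← h0]; positivity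
    have h4 : lam / 2 * (r ^ (k - 1) * r) ≤ d * Lam * ρ ^ (k - 1) * r := by
      have := abs_rpow_sub_one_mul (t := r) hk1
      rw [abs_of_pos h0] at this
      rw [this]; linarith
    have h5 : lam / 2 * r ^ (k - 1) ≤ d * Lam * ρ ^ (k - 1) :=
      le_of_mul_le_mul_right (by rw [mul_assoc]; exact h4) h0
    have h6 : r ^ (k - 1) ≤ D * ρ ^ (k - 1) := by
      rw [hD, div_mul_eq_mul_div, le_div_iff₀ hlam]
      linarith
    have h7 : r ^ (k - 1) ≤ (D * ρ) ^ (k - 1) := by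
      rw [Real.mul_rpow (by linarith) hρ0]
      refine h6.trans ?_
      gcongr
      -- `D ≤ D ^ (k - 1)`, from `1 ≤ D` and `2 ≤ k`.
      exact Real.self_le_rpow_of_one_le hD1 (by linarith)
    exact (Real.rpow_le_rpow_iff hr0 (by positivity) (by linarith)).1 h7
  have h8 : f x - f xstar ≤ D ^ 2 * (lam / 2 * ρ ^ k) := by
    have h9 : ρ ^ (k - 1) * ρ = ρ ^ k := by
      have := abs_rpow_sub_one_mul (t := ρ) hk1
      rwa [abs_of_nonneg hρ0] at this
    calc f x - f xstar ≤ d * Lam * ρ ^ (k - 1) * r := by linarith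
      _ ≤ d * Lam * ρ ^ (k - 1) * (D * ρ) := by gcongr
      _ = d * Lam * D * ρ ^ k := by rw [← h9]; ring
      _ = D ^ 2 * (lam / 2 * ρ ^ k) := by
          have : d * Lam = D * (lam / 2) := by rw [hD]; field_simp
          rw [this]; ring
  refine h8.trans (mul_le_mul_of_nonneg_left ?_ (by positivity))
  refine (lineSearch_gain_ge hk1 huc hss (hA j₀) hx).trans ?_
  exact Finset.single_le_sum (f := fun j => f x - f (along x j (A j))) (fun j _ => by
    have := (hA j).2 0 (by rwa [along_zero])
    rw [along_zero] at this
    linarith) (Finset.mem_univ j₀)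

/-- A bound for the error that depends only on the constants of the problem. -/
theorem error_le_const {R : ℝ} (hk : 2 ≤ k) (hlam : 0 < lam) (hLam : lam / 2 < Lam)
    (hS : IsCompact S) (hR : Metric.diam S ≤ R) (hg : IsGradientOn S f g) (huc : IsUC S f g k lam)
    (hss : IsLkSS S f g k Lam) (hx : x ∈ S) {xstar : Point d} (hxs : xstar ∈ S) :
    f x - f xstar ≤ d * Lam * R ^ k := by
  have hLam0 : 0 < Lam := by linarith
  have hR0 : 0 ≤ R := Metric.diam_nonneg.trans hR
  have hk1 : 1 < k := by linarith
  have h1 := huc x hx xstar hxs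
  have h3 : 0 ≤ lam / 2 * ‖x - xstar‖ ^ k := by positivity
  have h2 : -inner ℝ (g x) (xstar - x) ≤ d * Lam * R ^ k := by
    refine (neg_le_abs _).trans ?_
    rw [PiLp.inner_apply]
    refine (Finset.abs_sum_le_sum_abs _ _).trans ?_
    calc ∑ i, |inner ℝ (g x i) ((xstar - x) i)| ≤ ∑ _i : Fin d, Lam * R ^ k := by
          refine Finset.sum_le_sum fun i _ => ?_
          obtain ⟨α, hα⟩ := exists_isDirMin hS hg.continuousOn hx i
          have hgi := hss.abs_le hα (zero_mem_lineSlice hx)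
          rw [along_zero] at hgi
          have hαR : |0 - α| ≤ R :=
            abs_sub_le_of_mem_lineSlice hS hR (zero_mem_lineSlice hx) hα.1
          have h4 := abs_rpow_sub_one_mul (t := R) hk1
          rw [abs_of_nonneg hR0] at h4
          simp only [RCLike.inner_apply, conj_trivial]
          rw [abs_mul, mul_comm, ← h4, ← mul_assoc]
          refine mul_le_mul (hgi.trans ?_) ?_ (abs_nonneg _) (by positivity)
          · gcongr
          · refine (PiLp.norm_apply_le (xstar - x) i).trans ?_
            rw [← dist_eq_norm]
            exact (Metric.dist_le_diam_of_mem hS.isBounded hxs hx).trans hR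
      _ = _ := by simp; ring
  linarith

/-- The gradient at `x` is compared with the one at the directional minimum, whose `j`-th entry is
zero. -/
theorem IsStronglySmooth.isLkSS {H : ℝ} (hs : IsStronglySmooth S g H)
    (h0 : DirMinStationary S f g) : IsLkSS S f g 2 H := by
  intro x hx j α hα
  have h1 := hs x hx _ hα.1
  have h2 := PiLp.norm_apply_le (g x - g (along x j α)) j
  rw [PiLp.sub_apply, h0 x hx j α hα, sub_zero, Real.norm_eq_abs] at h2
  norm_num
  exact h2.trans h1

end FunctionClass

/-! ### Accuracy of the line search -/

section LineSearch

variable {d : ℕ} {S : Set (Point d)} {f : Point d → ℝ} {g : Point d → Point d}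
  {η : Point d → Fin d → unitInterval} {k lam Lam a b τ R : ℝ} {x : Point d} {j : Fin d} {αs : ℝ}

theorem IsSignOracle.half_le_of_lt (hlam : 0 < lam) (huc : IsUC S f g k lam)
    (ho : IsSignOracle S g η a b τ) (h : IsDirMin S f x j αs) {β : ℝ}
    (hβ : β ∈ lineSlice S x j) (hlt : αs < β) : 1 / 2 ≤ (η (along x j β) j : ℝ) := by
  refine (ho.pos _ hβ j ?_).le
  have h1 := huc.lower_le_mul h hβ
  have h2 : 0 < lam / 2 * |β - αs| ^ k := by
    have : 0 < |β - αs| := abs_pos.2 (by linarith)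
    positivity
  exact pos_of_mul_pos_left (h2.trans_le h1) (by linarith)

/-- At the minimum itself the derivative is zero, and `order` forces a fair coin. Hence the
threshold classifier at `αs` predicts a most likely label everywhere. -/
theorem IsSignOracle.le_half_of_le (hk : 1 < k) (hlam : 0 < lam) (hτ : 0 < τ)
    (huc : IsUC S f g k lam) (hss : IsLkSS S f g k Lam) (ho : IsSignOracle S g η a b τ)
    (h : IsDirMin S f x j αs) {β : ℝ} (hβ : β ∈ lineSlice S x j) (hle : β ≤ αs) :
    (η (along x j β) j : ℝ) ≤ 1 / 2 := by
  rcases hle.eq_or_lt with rfl | hlt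
  · have h0 := hss.eq_zero hk h
    have := (ho.order _ hβ j (by rw [h0, abs_zero]; exact hτ.le)).2
    rw [h0, abs_zero, mul_zero] at this
    linarith [(abs_le.1 this).2]
  · refine (ho.neg _ hβ j ?_).le
    have h1 := huc.lower_le_mul h hβ
    have h2 : 0 < lam / 2 * |β - αs| ^ k := by
      have : 0 < |β - αs| := abs_pos.2 (by linarith)
      positivity
    by_contra hge
    nlinarith [mul_nonneg (not_lt.1 hge) (sub_nonneg.2 hle)]

/-- The bound `w` on the distance keeps the derivative below `τ`, where the bias is comparable to
it; the bound `w / 2` keeps the derivative large. -/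
theorem IsSignOracle.bias_ge (hk : 1 < k) (ha : 0 < a) (huc : IsUC S f g k lam)
    (hss : IsLkSS S f g k Lam) (ho : IsSignOracle S g η a b τ) (hlam : 0 < lam) (hLam : 0 < Lam)
    (h : IsDirMin S f x j αs) {β w : ℝ} (hβ : β ∈ lineSlice S x j) (hw0 : 0 < w)
    (hw : w / 2 ≤ |β - αs|) (hw' : |β - αs| ≤ w) (hwτ : Lam * w ^ (k - 1) ≤ τ) :
    a * lam * (w / 2) ^ (k - 1) ≤ |2 * (η (along x j β) j : ℝ) - 1| := by
  have h1 : |g (along x j β) j| ≤ τ := by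
    refine (hss.abs_le h hβ).trans (le_trans ?_ hwτ)
    gcongr
  have hne : β ≠ αs := by rintro rfl; simp at hw; linarith
  have h2 := (ho.order _ hβ j h1).1
  have h3 := huc.lower_le_abs hk h hβ hne
  have h4 : lam / 2 * (w / 2) ^ (k - 1) ≤ lam / 2 * |β - αs| ^ (k - 1) := by
    gcongr
  have h5 : |2 * (η (along x j β) j : ℝ) - 1| = 2 * |(η (along x j β) j : ℝ) - 1 / 2| := by
    rw [← abs_of_pos (zero_lt_two' ℝ), ← abs_mul, abs_of_pos (zero_lt_two' ℝ)]
    congr 1; ring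
  rw [h5]
  have h6 := mul_le_mul_of_nonneg_left (h4.trans h3) ha.le
  linarith

theorem volume_real_setOf_affine {lo L A B : ℝ} (hL : 0 < L) (h1 : lo ≤ A) (h2 : A ≤ B)
    (h3 : B ≤ lo + L) :
    volume.real {u : unitInterval | A ≤ lo + u * L ∧ lo + u * L ≤ B} = (B - A) / L := by
  have hA : (A - lo) / L ∈ unitInterval :=
    ⟨div_nonneg (by linarith) hL.le, (div_le_one hL).2 (by linarith)⟩
  have hB : (B - lo) / L ∈ unitInterval :=
    ⟨div_nonneg (by linarith) hL.le, (div_le_one hL).2 (by linarith)⟩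
  have : {u : unitInterval | A ≤ lo + u * L ∧ lo + u * L ≤ B} =
      Set.Icc ⟨(A - lo) / L, hA⟩ ⟨(B - lo) / L, hB⟩ := by
    ext u
    simp only [Set.mem_ofPred_eq, Set.mem_Icc, ← Subtype.coe_le_coe, div_le_iff₀ hL,
      le_div_iff₀ hL]
    constructor <;> rintro ⟨h, h'⟩ <;> constructor <;> linarith
  rw [this, measureReal_def, unitInterval.volume_Icc, ENNReal.toReal_ofReal]
  · simp only; field_simp; ring
  · simp only [sub_nonneg]; gcongr

/-- One epoch of the learner: if the directional minimum is within the radius `r` of the search,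
then the next position is within `r / 2` of it, up to a small probability. -/
theorem measure_epoch_far_le (hS : IsCompact S) (hc : Convex ℝ S) (hx : x ∈ S) (hk : 2 ≤ k)
    (hlam : 0 < lam) (hLam : 0 < Lam) (ha : 0 < a) (hτ : 0 < τ) (huc : IsUC S f g k lam)
    (hss : IsLkSS S f g k Lam) (ho : IsSignOracle S g η a b τ) (h : IsDirMin S f x j αs)
    {r α θ m₀ : ℝ} (hr : 0 < r) (hα : α ∈ lineSlice S x j) (hαs : |αs - α| ≤ r)
    (hθ0 : 0 < θ) (hθ : θ ≤ 1 / 2) (hθτ : Lam * (θ * r) ^ (k - 1) ≤ τ) (hm0 : 0 ≤ m₀) (hm1 : m₀ ≤ 1)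
    (hm : m₀ ≤ a * lam * (θ * r / 2) ^ (k - 1) * (θ / 4)) (N : ℕ)
    [∀ (u v : unitInterval), Decidable (u < v)] :
    seqLaw squareLaw {z | r / 2 < |ermThreshold (searchLo S x j r α) ((List.range N).map fun i =>
      (samplePos S x j r α (z i).1,
        decide ((z i).2 < η (along x j (samplePos S x j r α (z i).1)) j))) - αs|} ≤
      ENNReal.ofReal ((N + 1) * (2 * Real.exp (-(m₀ ^ 2 / 4)) ^ (N - 1))) := by
  have hk1 : 1 < k := by linarith
  set lo := searchLo S x j r α with hlo
  set hi := searchHi S x j r α with hhi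
  have hle : lo ≤ hi := searchLo_le_searchHi hS hr.le hα
  have hpos : Measurable fun u => samplePos S x j r α u :=
    Measurable.samplePos hS j r measurable_const measurable_const measurable_id
  have hmem : ∀ u, samplePos S x j r α u ∈ Set.Icc lo hi := fun u =>
    ⟨searchLo_le_samplePos hle u, samplePos_le_searchHi hle u⟩
  have hsl : ∀ u, samplePos S x j r α u ∈ lineSlice S x j := fun u =>
    mem_lineSlice_of_searchLo_le hS hc hx (hmem u).1 (hmem u).2
  have hp : Measurable fun β => η (along x j β) j :=
    (ho.measurable j).comp (Measurable.along measurable_const measurable_id)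
  have hs : αs ∈ Set.Icc lo hi := ⟨searchLo_le_of_mem hS h.1 hαs, le_searchHi_of_mem hS h.1 hαs⟩
  have hL2 : hi - lo ≤ 2 * r := by
    have h1 : α - r ≤ lo := le_max_right _ _
    have h2 : hi ≤ α + r := min_le_right _ _
    linarith
  set w := θ * r with hw
  have hw0 : 0 < w := by positivity
  -- Hence the band at distances between `w / 2` and `w` on the side of `t` fits between `αs` and
  -- any threshold `t` farther than `r / 2`.
  have hwr : w ≤ r / 2 := by rw [hw]; nlinarith
  convert measure_ermThreshold_far_le (s := αs) N hpos hp hmem hs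
    (fun u hu => ho.half_le_of_lt hlam huc h (hsl u) hu)
    (fun u hu => ho.le_half_of_le hk1 hlam hτ huc hss h (hsl u) hu) hm0 hm1 ?_ using 1
  · congr!
  intro t ht hd
  -- A band of length `w / 2` in an interval of length at most `2 * r` has probability at least `θ /
  -- 4`.
  have hvol : ∀ A B : ℝ, lo ≤ A → A + w / 2 = B → B ≤ hi → 0 < hi - lo →
      m₀ ≤ a * lam * (w / 2) ^ (k - 1) *
        volume.real {u : unitInterval | A ≤ samplePos S x j r α u ∧ samplePos S x j r α u ≤ B} := by
    intro A B hA hAB hB hL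
    have := volume_real_setOf_affine (A := A) (B := B) hL hA (by linarith)
      (by linarith : B ≤ lo + (hi - lo))
    unfold samplePos
    rw [← hlo, ← hhi, this]
    refine hm.trans (mul_le_mul_of_nonneg_left ?_ (by positivity))
    rw [le_div_iff₀ hL]
    calc θ / 4 * (hi - lo) ≤ θ / 4 * (2 * r) := by gcongr
      _ = B - A := by rw [← hAB, hw]; ring
  have hms : ∀ A B : ℝ, MeasurableSet
      {u : unitInterval | A ≤ samplePos S x j r α u ∧ samplePos S x j r α u ≤ B} := fun A B =>
    (measurableSet_le measurable_const hpos).inter (measurableSet_le hpos measurable_const)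
  rcases lt_or_ge αs t with hlt | hge
  · rw [abs_of_pos (by linarith)] at hd
    refine ⟨_, _, hms (αs + w / 2) (αs + w), hvol _ _ (by linarith [hs.1]) (by ring)
      (by linarith [ht.2]) (by linarith [ht.2, hs.1]), fun u hu => ⟨?_, Or.inl ⟨?_, ?_⟩⟩⟩
    · refine ho.bias_ge hk1 ha huc hss hlam hLam h (hsl u) hw0 ?_ ?_ hθτ
      · exact le_trans (by linarith [hu.1]) (le_abs_self _)
      · rw [abs_of_nonneg (by linarith [hu.1])]; linarith [hu.2]
    · linarith [hu.1]
    · linarith [hu.2]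
  · rw [abs_of_nonpos (by linarith)] at hd
    refine ⟨_, _, hms (αs - w) (αs - w / 2), hvol _ _ (by linarith [ht.1]) (by ring)
      (by linarith [hs.2]) (by linarith [ht.1, hs.2]), fun u hu => ⟨?_, Or.inr ⟨?_, ?_⟩⟩⟩
    · refine ho.bias_ge hk1 ha huc hss hlam hLam h (hsl u) hw0 ?_ ?_ hθτ
      · exact le_trans (by linarith [hu.2]) (neg_le_abs _)
      · rw [abs_of_nonpos (by linarith [hu.2])]; linarith [hu.1]
    · linarith [hu.1]
    · linarith [hu.2]

/-- Positions drift by less than twice the radius at which one starts to count. -/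
theorem abs_noisyPos_sub_le (hS : IsCompact S) (hc : Convex ℝ S) (hR : 0 ≤ R) (N : ℕ) (hx : x ∈ S)
    (z : ℕ → unitInterval × unitInterval) {I K : ℕ} (hIK : I ≤ K) :
    |noisyPos S R N η x j z K - noisyPos S R N η x j z I| ≤ 2 * (R / 2 ^ I) - 2 * (R / 2 ^ K) := by
  induction K, hIK using Nat.le_induction with
  | base => simp
  | succ K _ ih =>
    have h := noisyPos_succ_mem_search (η := η) hS hR N j z (noisyPos_mem hS hc hR N hx j z K)
    have h1 := abs_sub_le_of_mem_search h.1 h.2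
    have h2 := abs_sub_le (noisyPos S R N η x j z (K + 1)) (noisyPos S R N η x j z K)
      (noisyPos S R N η x j z I)
    have h3 : R / 2 ^ K = 2 * (R / 2 ^ (K + 1)) := by rw [pow_succ]; field_simp
    linarith

/-- Fubini: a bound valid for every past `z` is valid unconditionally. -/
theorem measure_le_of_concatSeq {X : Type*} [MeasurableSpace X] {μ : Measure X}
    [IsProbabilityMeasure μ] (n : ℕ) {B : Set (ℕ → X)} (hB : MeasurableSet B) {C : ENNReal}
    (h : ∀ z, seqLaw μ {w | concatSeq n z w ∈ B} ≤ C) : seqLaw μ B ≤ C := by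
  rw [← lintegral_indicator_one hB, lintegral_concatSeq μ n (measurable_one.indicator hB)]
  calc _ ≤ ∫⁻ _, C ∂seqLaw μ := lintegral_mono fun z => by
        refine le_trans ?_ (h z)
        exact lintegral_indicator_one_le {w | concatSeq n z w ∈ B}
    _ = C := by simp

open Classical in
theorem noisyPos_concatSeq_succ (N i : ℕ) (z z' : ℕ → unitInterval × unitInterval) :
    noisyPos S R N η x j (concatSeq (i * N) z z') (i + 1) =
      ermThreshold (searchLo S x j (R / 2 ^ i) (noisyPos S R N η x j z i))
        ((List.range N).map fun s =>
          (samplePos S x j (R / 2 ^ i) (noisyPos S R N η x j z i) (z' s).1,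
            decide ((z' s).2 < η (along x j (samplePos S x j (R / 2 ^ i)
              (noisyPos S R N η x j z i) (z' s).1)) j))) := by
  have h : noisyPos S R N η x j (concatSeq (i * N) z z') i = noisyPos S R N η x j z i :=
    noisyPos_congr _ _ _ _ _ _ fun m hm => concatSeq_of_lt _ _ hm
  simp only [noisyPos, h, concatSeq_add]

/-- An epoch fails if it starts within its radius of the minimum and ends farther away than half of
it. If none of the first `I` epochs fails, epoch `I` starts within `R / 2 ^ I`, and the later
epochs, successful or not, add at most twice that distance. -/
theorem measure_lineSearch_far_le (hS : IsCompact S) (hc : Convex ℝ S) (hx : x ∈ S)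
    (hR0 : 0 < R) (hR : Metric.diam S ≤ R) (hk : 2 ≤ k)
    (hlam : 0 < lam) (hLam : 0 < Lam) (ha : 0 < a) (hτ : 0 < τ) (huc : IsUC S f g k lam)
    (hss : IsLkSS S f g k Lam) (ho : IsSignOracle S g η a b τ) (h : IsDirMin S f x j αs)
    {θ κ ε : ℝ} (hθ0 : 0 < θ) (hθ : θ ≤ 1 / 2) (hθτ : Lam * (θ * R) ^ (k - 1) ≤ τ)
    (hκ0 : 0 ≤ κ) (hκ1 : κ * R ^ (k - 1) ≤ 1) (hκ : κ ≤ a * lam * (θ / 2) ^ (k - 1) * (θ / 4))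
    (N : ℕ) {I K : ℕ} (hIK : I ≤ K)
    (hε : ∀ i < I, 2 * Real.exp (-((κ * (R / 2 ^ i) ^ (k - 1)) ^ 2 / 4)) ^ (N - 1) ≤ ε) :
    seqLaw squareLaw {z | 3 * (R / 2 ^ I) < |noisyPos S R N η x j z K - αs|} ≤
      ENNReal.ofReal (I * ((N + 1) * ε)) := by
  classical
  have hposm : ∀ i, Measurable fun z => noisyPos S R N η x j z i := fun i =>
    measurable_noisyPos hS ho.measurable N j measurable_const measurable_id i
  let bad : ℕ → Set (ℕ → unitInterval × unitInterval) := fun i =>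
    {z | |αs - noisyPos S R N η x j z i| ≤ R / 2 ^ i ∧
      R / 2 ^ i / 2 < |noisyPos S R N η x j z (i + 1) - αs|}
  have hbadm : ∀ i, MeasurableSet (bad i) := fun i =>
    (measurableSet_le (measurable_const.sub (hposm i)).abs measurable_const).inter
      (measurableSet_lt measurable_const ((hposm (i + 1)).sub_const αs).abs)
  have hsub : {z | 3 * (R / 2 ^ I) < |noisyPos S R N η x j z K - αs|} ⊆
      ⋃ i ∈ Finset.range I, bad i := by
    intro z hz
    by_contra hnot
    simp only [Set.mem_iUnion, not_exists] at hnot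
    have hgood : ∀ i ≤ I, |αs - noisyPos S R N η x j z i| ≤ R / 2 ^ i := by
      intro i hi
      induction i with
      | zero =>
        -- The first radius `R` bounds the diameter of `S`, so the start is always near.
        simpa [noisyPos] using abs_sub_le_of_mem_lineSlice hS hR h.1 (zero_mem_lineSlice hx)
      | succ i ih =>
        have h1 := hnot i (Finset.mem_range.2 (by omega))
        by_contra h2
        refine h1 ⟨ih (by omega), ?_⟩
        rw [abs_sub_comm, div_div, ← pow_succ]
        exact not_le.1 h2
    have h1 := hgood I le_rfl
    have h2 := abs_noisyPos_sub_le (η := η) (j := j) hS hc hR0.le N hx z hIK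
    have h3 := abs_sub_le (noisyPos S R N η x j z K) (noisyPos S R N η x j z I) αs
    rw [abs_sub_comm αs] at h1
    have h4 : 0 ≤ 2 * (R / 2 ^ K) := by positivity
    have h5 : 3 * (R / 2 ^ I) < |noisyPos S R N η x j z K - αs| := hz
    linarith
  have hbad : ∀ i ∈ Finset.range I, seqLaw squareLaw (bad i) ≤ ENNReal.ofReal ((N + 1) * ε) := by
    intro i hi
    have hi' := Finset.mem_range.1 hi
    have hRi : R / 2 ^ i ≤ R := div_le_self hR0.le (one_le_pow₀ one_le_two)
    have hRi0 : 0 < R / 2 ^ i := by positivity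
    have hk0 : 0 ≤ k - 1 := by linarith
    refine measure_le_of_concatSeq (i * N) (hbadm i) fun z => ?_
    have hpi : ∀ z', noisyPos S R N η x j (concatSeq (i * N) z z') i =
        noisyPos S R N η x j z i := fun z' =>
      noisyPos_congr _ _ _ _ _ _ fun m hm => concatSeq_of_lt _ _ hm
    -- The past fixes the position at the start of epoch `i`; if it is not near, a failure is
    -- impossible by definition.
    by_cases hnear : |αs - noisyPos S R N η x j z i| ≤ R / 2 ^ i
    · have hb := measure_epoch_far_le hS hc hx hk hlam hLam ha hτ huc hss ho h
        (r := R / 2 ^ i) (θ := θ) (m₀ := κ * (R / 2 ^ i) ^ (k - 1)) hRi0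
        (noisyPos_mem hS hc hR0.le N hx j z i) hnear hθ0 hθ
        (le_trans (by gcongr) hθτ) (by positivity) (le_trans (by gcongr) hκ1) (by
          have : (θ * (R / 2 ^ i) / 2) ^ (k - 1) =
              (θ / 2) ^ (k - 1) * (R / 2 ^ i) ^ (k - 1) := by
            rw [← Real.mul_rpow (by positivity) hRi0.le]; congr 1; ring
          rw [this]
          calc _ ≤ a * lam * (θ / 2) ^ (k - 1) * (θ / 4) * (R / 2 ^ i) ^ (k - 1) := by gcongr
            _ = _ := by ring) N
      refine ((measure_mono fun z' hz' => ?_).trans hb).trans (ENNReal.ofReal_le_ofReal ?_)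
      · have h2 := hz'.2
        rw [noisyPos_concatSeq_succ] at h2
        exact h2
      · exact mul_le_mul_of_nonneg_left (hε i hi') (by positivity)
    · have : {z' | concatSeq (i * N) z z' ∈ bad i} = ∅ := by
        ext z'
        simp only [Set.mem_ofPred_eq, Set.mem_empty_iff_false, iff_false]
        exact fun hz' => hnear (by simpa only [hpi] using hz'.1)
      simp [this]
  calc _ ≤ seqLaw squareLaw (⋃ i ∈ Finset.range I, bad i) := measure_mono hsub
    _ ≤ ∑ i ∈ Finset.range I, seqLaw squareLaw (bad i) := measure_biUnion_finset_le _ _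
    _ ≤ ∑ i ∈ Finset.range I, ENNReal.ofReal ((N + 1) * ε) := Finset.sum_le_sum hbad
    _ = _ := by
        rw [Finset.sum_const, Finset.card_range, nsmul_eq_mul,
          ENNReal.ofReal_mul (p := (I : ℝ)) (by positivity), ENNReal.ofReal_natCast]

end LineSearch

/-! ### Contraction of coordinate descent -/

section Contraction

variable {d : ℕ} {S : Set (Point d)} {f : Point d → ℝ} {g : Point d → Point d}
  {η : Point d → Fin d → unitInterval} {k lam Lam a b τ R : ℝ} {xstar : Point d}

theorem lintegral_coordLaw (φ : Fin d → ENNReal) :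
    ∫⁻ j, φ j ∂coordLaw d = (∑ j, φ j) / d := by
  rw [lintegral_fintype, ENNReal.div_eq_inv_mul, Finset.mul_sum]
  refine Finset.sum_congr rfl fun j _ => ?_
  rw [ProbabilityTheory.uniformOn_univ, Measure.count_singleton, mul_comm, Fintype.card_fin,
    one_div]

/-- Expected error after a line search of accuracy `ε`, up to a probability `π`. -/
theorem lintegral_lineSearch_le {B ε π : ℝ} (hS : IsCompact S) (hc : Convex ℝ S) (hR : 0 ≤ R)
    (hk : 1 < k) (hlam : 0 < lam) (hLam : 0 ≤ Lam) (huc : IsUC S f g k lam)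
    (hss : IsLkSS S f g k Lam) (hη : ∀ j, Measurable fun x => η x j)
    (hB : ∀ x ∈ S, f x - f xstar ≤ B) (hmin : IsMinOn f S xstar)
    {cost : Point d → ENNReal} (hfc : ∀ x ∈ S, ENNReal.ofReal (f x - f xstar) = cost x)
    {x : Point d} (hx : x ∈ S) {j : Fin d} {αs : ℝ} (h : IsDirMin S f x j αs) (N K : ℕ)
    (hε : 0 ≤ ε) (hB0 : 0 ≤ B) (hπ0 : 0 ≤ π)
    (hπ : seqLaw squareLaw {z | ε < |noisyPos S R N η x j z K - αs|} ≤ ENNReal.ofReal π) :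
    ∫⁻ z, cost (along x j (noisyPos S R N η x j z K)) ∂seqLaw squareLaw ≤
      ENNReal.ofReal (f (along x j αs) - f xstar + (Lam * ε ^ k + B * π)) := by
  set bad := {z | ε < |noisyPos S R N η x j z K - αs|} with hbad
  have hbadm : MeasurableSet bad := measurableSet_lt measurable_const
    ((measurable_noisyPos hS hη N j measurable_const measurable_id K).sub_const αs).abs
  have h0 : 0 ≤ f (along x j αs) - f xstar := sub_nonneg.2 (hmin h.1)
  calc _ ≤ ∫⁻ z, (ENNReal.ofReal (f (along x j αs) - f xstar + Lam * ε ^ k) +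
        bad.indicator (fun _ => ENNReal.ofReal B) z) ∂seqLaw squareLaw := by
        refine lintegral_mono fun z => ?_
        have hmem := noisyPos_mem (η := η) hS hc hR N hx j z K
        rw [← hfc _ hmem]
        by_cases hz : z ∈ bad
        · rw [Set.indicator_of_mem hz]
          exact (ENNReal.ofReal_le_ofReal (hB _ hmem)).trans le_add_self
        · rw [Set.indicator_of_notMem hz, add_zero]
          refine ENNReal.ofReal_le_ofReal ?_
          have h1 := lineSearch_error_le hk hlam.le huc hss h hmem
          have h2 : |noisyPos S R N η x j z K - αs| ^ k ≤ ε ^ k :=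
            Real.rpow_le_rpow (abs_nonneg _) (not_lt.1 hz) (by linarith)
          have h3 := mul_le_mul_of_nonneg_left h2 hLam
          linarith
    _ = ENNReal.ofReal (f (along x j αs) - f xstar + Lam * ε ^ k) +
        ENNReal.ofReal B * seqLaw squareLaw bad := by
        rw [lintegral_add_left measurable_const, lintegral_indicator hbadm, setLIntegral_const]
        simp
    _ ≤ ENNReal.ofReal (f (along x j αs) - f xstar + Lam * ε ^ k) +
        ENNReal.ofReal B * ENNReal.ofReal π := by gcongr
    _ = _ := by
        rw [← ENNReal.ofReal_mul hB0, ← ENNReal.ofReal_add (by positivity) (by positivity),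
          add_assoc]

/-- The Markov property: the coordinate and the samples of epoch `e` are independent of all that
determines the iterate `x_e`, so they may be redrawn after splitting the sequences at `e` and at `e
* (K * N)`. -/
theorem lintegral_noisyPoint_succ {cost : Point d → ENNReal} (hd : 1 ≤ d) (hS : IsCompact S)
    (hη : ∀ j, Measurable fun x => η x j) (hcost : Measurable cost) (K N : ℕ) (x₀ : Point d)
    (e : ℕ) :
    ∫⁻ J, ∫⁻ z, cost (noisyPoint S R K N η x₀ J z (e + 1)) ∂seqLaw squareLaw
        ∂seqLaw (coordLaw d) =
      ∫⁻ J, ∫⁻ z, (∑ j, ∫⁻ z', cost (along (noisyPoint S R K N η x₀ J z e) j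
        (noisyPos S R N η (noisyPoint S R K N η x₀ J z e) j z' K)) ∂seqLaw squareLaw) / d
          ∂seqLaw squareLaw ∂seqLaw (coordLaw d) := by
  have := isProbabilityMeasure_coordLaw hd
  have hm : ∀ {Ω : Type} [MeasurableSpace Ω] {J : Ω → ℕ → Fin d} (_ : Measurable J)
      {z : Ω → ℕ → unitInterval × unitInterval} (_ : Measurable z),
      Measurable fun ω => cost (noisyPoint S R K N η x₀ (J ω) (z ω) (e + 1)) := by
    intro Ω _ J hJ z hz
    exact hcost.comp (measurable_noisyPoint hS hη _ _ x₀ hJ hz _)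
  rw [lintegral_concatSeq (coordLaw d) e]
  swap
  · exact Measurable.lintegral_prod_right' (f := fun p : (ℕ → Fin d) ×
      (ℕ → unitInterval × unitInterval) => cost (noisyPoint S R K N η x₀ p.1 p.2 (e + 1)))
      (hm measurable_fst measurable_snd)
  refine lintegral_congr fun J => ?_
  have h1 : ∀ J' : ℕ → Fin d, ∫⁻ z, cost (noisyPoint S R K N η x₀ (concatSeq e J J') z (e + 1))
      ∂seqLaw squareLaw = ∫⁻ z, ∫⁻ z', cost (noisyPoint S R K N η x₀ (concatSeq e J J')
        (concatSeq (e * (K * N)) z z') (e + 1)) ∂seqLaw squareLaw ∂seqLaw squareLaw := fun J' =>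
    lintegral_concatSeq squareLaw (e * (K * N)) (F := fun z =>
      cost (noisyPoint S R K N η x₀ (concatSeq e J J') z (e + 1)))
      (hm (J := fun _ => concatSeq e J J') measurable_const measurable_id)
  simp_rw [h1]
  rw [lintegral_lintegral_swap (f := fun (J' : ℕ → Fin d)
    (z : ℕ → unitInterval × unitInterval) => ∫⁻ z', cost (noisyPoint S R K N η x₀
      (concatSeq e J J') (concatSeq (e * (K * N)) z z') (e + 1)) ∂seqLaw squareLaw)]
  swap
  · refine Measurable.aemeasurable (Measurable.lintegral_prod_right' (f := fun p :
      ((ℕ → Fin d) × (ℕ → unitInterval × unitInterval)) × (ℕ → unitInterval × unitInterval) =>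
      cost (noisyPoint S R K N η x₀ (concatSeq e J p.1.1)
        (concatSeq (e * (K * N)) p.1.2 p.2) (e + 1))) ?_)
    refine hm ?_ ?_
    · exact (measurable_concatSeq e).comp (measurable_const.prodMk
        (measurable_fst.comp measurable_fst))
    · exact (measurable_concatSeq _).comp ((measurable_snd.comp measurable_fst).prodMk
        measurable_snd)
  refine lintegral_congr fun z => ?_
  have h2 : ∀ (J' : ℕ → Fin d) (z' : ℕ → unitInterval × unitInterval),
      noisyPoint S R K N η x₀ (concatSeq e J J') (concatSeq (e * (K * N)) z z') (e + 1) =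
        along (noisyPoint S R K N η x₀ J z e) (J' 0)
          (noisyPos S R N η (noisyPoint S R K N η x₀ J z e) (J' 0) z' K) := by
    intro J' z'
    have h3 : noisyPoint S R K N η x₀ (concatSeq e J J') (concatSeq (e * (K * N)) z z') e =
        noisyPoint S R K N η x₀ J z e :=
      noisyPoint_congr _ _ _ _ _ _ (fun i hi => concatSeq_of_lt _ _ hi)
        fun m hm => concatSeq_of_lt _ _ hm
    have h4 : concatSeq e J J' e = J' 0 := concatSeq_add e 0 J J'
    simp only [noisyPoint, h3, h4, concatSeq_add]
  simp_rw [h2]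
  rw [lintegral_seq_eval (coordLaw d) 0 (φ := fun j => ∫⁻ z', cost (along
    (noisyPoint S R K N η x₀ J z e) j (noisyPos S R N η (noisyPoint S R K N η x₀ J z e) j z' K))
    ∂seqLaw squareLaw) (measurable_of_countable _), lintegral_coordLaw]

/-- Expected error of coordinate descent with line searches of accuracy `ε`, up to a
probability `π`. -/
theorem lintegral_noisyPoint_le {ε π γ : ℝ} (hd : 1 ≤ d) (hS : IsCompact S) (hc : Convex ℝ S)
    (hR : Metric.diam S ≤ R) (hk : 2 ≤ k) (hlam : 0 < lam) (hLam : lam / 2 < Lam)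
    (hg : IsGradientOn S f g) (huc : IsUC S f g k lam) (hss : IsLkSS S f g k Lam)
    (hη : ∀ j, Measurable fun x => η x j) (hxs : xstar ∈ S) (hmin : IsMinOn f S xstar)
    {cost : Point d → ENNReal} (hcost : Measurable cost)
    (hfc : ∀ x ∈ S, ENNReal.ofReal (f x - f xstar) = cost x) {x₀ : Point d} (hx₀ : x₀ ∈ S)
    (N K : ℕ) (hε : 0 ≤ ε) (hπ0 : 0 ≤ π) (hγ : γ = 1 / (d * (2 * d * Lam / lam) ^ 2))
    (hπ : ∀ x ∈ S, ∀ j αs, IsDirMin S f x j αs →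
      seqLaw squareLaw {z | ε < |noisyPos S R N η x j z K - αs|} ≤ ENNReal.ofReal π) (e : ℕ) :
    ∫⁻ J, ∫⁻ z, cost (noisyPoint S R K N η x₀ J z e) ∂seqLaw squareLaw ∂seqLaw (coordLaw d) ≤
      ENNReal.ofReal ((1 - γ) ^ e * (d * Lam * R ^ k) +
        (Lam * ε ^ k + d * Lam * R ^ k * π) / γ) := by
  have := isProbabilityMeasure_coordLaw hd
  have hR0 : 0 ≤ R := Metric.diam_nonneg.trans hR
  have hd' : (1 : ℝ) ≤ d := by exact_mod_cast hd
  have hLam0 : 0 < Lam := by linarith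
  have hk1 : 1 < k := by linarith
  set B := d * Lam * R ^ k with hB
  have hB0 : 0 ≤ B := by positivity
  set D := 2 * d * Lam / lam with hD
  have hD1 : 1 ≤ D := by
    rw [hD, one_le_div hlam]
    nlinarith
  have hγ0 : 0 < γ := by rw [hγ]; positivity
  have hγ1 : γ ≤ 1 := by
    rw [hγ, div_le_one (by positivity)]
    nlinarith
  set ν := Lam * ε ^ k + B * π with hν
  have hν0 : 0 ≤ ν := by positivity
  have hBS : ∀ x ∈ S, f x - f xstar ≤ B := fun x hx =>
    error_le_const hk hlam hLam hS hR hg huc hss hx hxs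
  induction e with
  | zero =>
    simp only [noisyPoint, lintegral_const, measure_univ, mul_one, pow_zero, one_mul]
    rw [← hfc _ hx₀]
    refine ENNReal.ofReal_le_ofReal ((hBS _ hx₀).trans ?_)
    have : 0 ≤ ν / γ := by positivity
    linarith
  | succ e ih =>
    rw [lintegral_noisyPoint_succ hd hS hη hcost]
    -- Averaged over `j`, the gains of exact line searches are at least `γ` times the error; `ν` is
    -- the price of the inexact search.
    have hstep : ∀ x ∈ S, (∑ j, ∫⁻ z', cost (along x j (noisyPos S R N η x j z' K))
        ∂seqLaw squareLaw) / d ≤ ENNReal.ofReal (1 - γ) * cost x + ENNReal.ofReal ν := by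
      intro x hx
      choose A hA using fun j => exists_isDirMin hS hg.continuousOn hx j
      have h0 : ∀ j, 0 ≤ f (along x j (A j)) - f xstar := fun j => sub_nonneg.2 (hmin (hA j).1)
      have h1 : ∑ j, ∫⁻ z', cost (along x j (noisyPos S R N η x j z' K)) ∂seqLaw squareLaw ≤
          ENNReal.ofReal (∑ j, (f (along x j (A j)) - f xstar + ν)) := by
        rw [ENNReal.ofReal_sum_of_nonneg fun j _ => add_nonneg (h0 j) hν0]
        exact Finset.sum_le_sum fun j _ => lintegral_lineSearch_le hS hc hR0 hk1 hlam hLam0.le huc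
          hss hη hBS hmin hfc hx (hA j) N K hε hB0 hπ0 (hπ x hx j _ (hA j))
      refine (ENNReal.div_le_div_right h1 _).trans ?_
      rw [← hfc x hx, ← ENNReal.ofReal_mul (by linarith), ← ENNReal.ofReal_add
        (mul_nonneg (by linarith) (sub_nonneg.2 (hmin hx))) hν0, ← ENNReal.ofReal_natCast d,
        ← ENNReal.ofReal_div_of_pos (by linarith)]
      refine ENNReal.ofReal_le_ofReal ?_
      have h2 := error_le_sum_gain hk hlam hLam huc hss hd hx hA hxs hmin
      rw [div_le_iff₀ (by linarith)]
      simp only [Finset.sum_add_distrib, Finset.sum_sub_distrib, Finset.sum_const,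
        Finset.card_univ, Fintype.card_fin, nsmul_eq_mul] at h2 ⊢
      have h3 : γ * d * (f x - f xstar) ≤ d * f x - ∑ j, f (along x j (A j)) := by
        rw [hγ]
        have : 1 / (d * D ^ 2) * d * (f x - f xstar) = (f x - f xstar) / D ^ 2 := by
          field_simp
        rw [this, div_le_iff₀ (by positivity)]
        linarith
      linarith
    have hmc : ∀ J : ℕ → Fin d, Measurable fun z => cost (noisyPoint S R K N η x₀ J z e) :=
      fun J => hcost.comp (measurable_noisyPoint hS hη _ _ x₀ measurable_const measurable_id _)
    have hmJ : Measurable fun J : ℕ → Fin d =>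
        ∫⁻ z, cost (noisyPoint S R K N η x₀ J z e) ∂seqLaw squareLaw :=
      Measurable.lintegral_prod_right' (f := fun p : (ℕ → Fin d) ×
        (ℕ → unitInterval × unitInterval) => cost (noisyPoint S R K N η x₀ p.1 p.2 e))
        (hcost.comp (measurable_noisyPoint hS hη _ _ x₀ measurable_fst measurable_snd _))
    calc _ ≤ ∫⁻ J, ∫⁻ z, (ENNReal.ofReal (1 - γ) * cost (noisyPoint S R K N η x₀ J z e) +
          ENNReal.ofReal ν) ∂seqLaw squareLaw ∂seqLaw (coordLaw d) :=
          lintegral_mono fun J => lintegral_mono fun z =>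
            hstep _ (noisyPoint_mem hS hc hR0 _ _ hx₀ _ _ _)
      _ = ENNReal.ofReal (1 - γ) * ∫⁻ J, ∫⁻ z, cost (noisyPoint S R K N η x₀ J z e)
          ∂seqLaw squareLaw ∂seqLaw (coordLaw d) + ENNReal.ofReal ν := by
          have h5 : ∀ J, ∫⁻ z, (ENNReal.ofReal (1 - γ) * cost (noisyPoint S R K N η x₀ J z e) +
              ENNReal.ofReal ν) ∂seqLaw squareLaw = ENNReal.ofReal (1 - γ) *
                ∫⁻ z, cost (noisyPoint S R K N η x₀ J z e) ∂seqLaw squareLaw +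
                  ENNReal.ofReal ν := by
            intro J
            rw [lintegral_add_right _ measurable_const, lintegral_const_mul _ (hmc J)]
            simp
          simp_rw [h5]
          rw [lintegral_add_right _ measurable_const, lintegral_const_mul _ hmJ]
          simp
      _ ≤ ENNReal.ofReal (1 - γ) * ENNReal.ofReal ((1 - γ) ^ e * B + ν / γ) +
          ENNReal.ofReal ν := by gcongr
      -- `ν / γ` is the fixed point of `t ↦ (1 - γ) * t + ν`.
      _ = _ := by
          have h1γ : 0 ≤ 1 - γ := by linarith
          rw [← ENNReal.ofReal_mul h1γ, ← ENNReal.ofReal_add (by positivity) hν0]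
          congr 1
          field_simp
          ring

end Contraction

/-! ### The parameters of coordinate descent -/

section Parameters

theorem div_sub_one_lt_natDiv (m n : ℕ) : (m : ℝ) / n - 1 < ((m / n : ℕ) : ℝ) := by
  have := Nat.lt_floor_add_one ((m : ℝ) / n)
  rw [Nat.floor_div_eq_div] at this
  linarith

/-- Rounding down loses at most `1`, which is at most half of `m / y` once this is at least `2`. -/
theorem natDiv_ge_half_div {m n : ℕ} {y : ℝ} (hy : 0 < y) (hn : (n : ℝ) ≤ y) (hn0 : 0 < n)
    (hm : 2 * y ≤ m) : (m : ℝ) / (2 * y) ≤ ((m / n : ℕ) : ℝ) := by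
  have h1 := div_sub_one_lt_natDiv m n
  have hn0' : (0 : ℝ) < n := by exact_mod_cast hn0
  have h2 : (m : ℝ) / y ≤ m / n := by gcongr
  have h3 : (1 : ℝ) ≤ m / (2 * y) := (one_le_div (by positivity)).2 hm
  have h4 : (m : ℝ) / y = m / (2 * y) + m / (2 * y) := by field_simp; ring
  linarith

variable {d T : ℕ} {c : ℝ}

theorem lineSearch_budget_ge (hd : 1 ≤ d) (hL : 1 ≤ Real.log T)
    (hT : 4 * d * Real.log T ^ 2 ≤ T) :
    (T : ℝ) / (4 * d * Real.log T ^ 2) ≤ ((T / cdEpochs d T : ℕ) : ℝ) := by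
  set L := Real.log T
  have hd' : (1 : ℝ) ≤ d := by exact_mod_cast hd
  have hdL : 1 ≤ d * L ^ 2 := one_le_mul_of_one_le_of_one_le hd' (one_le_pow₀ hL)
  have hE : (cdEpochs d T : ℝ) ≤ 2 * d * L ^ 2 := by
    have := (Nat.ceil_lt_add_one (by positivity : 0 ≤ (d : ℝ) * L ^ 2)).le
    change ((⌈(d : ℝ) * L ^ 2⌉₊ : ℕ) : ℝ) ≤ _
    linarith
  have hE0 : 0 < cdEpochs d T := Nat.ceil_pos.2 (by linarith)
  have := natDiv_ge_half_div (by linarith) hE hE0 (by linarith : 2 * (2 * d * L ^ 2) ≤ (T : ℝ))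
  calc _ = (T : ℝ) / (2 * (2 * d * L ^ 2)) := by congr 1; ring
    _ ≤ _ := this

/-- The logarithmic bound leaves enough samples for each epoch; the last bound makes the final
relative radius of order `√(L / n)`, the finest resolution needed, namely that for `k = 2`. -/
theorem learnerEpochs_bounds {n : ℕ} {L : ℝ} (hc : 2 < c ^ 2) (hn : 3 ≤ n) (hL : Real.log n ≤ L)
    (hcn : c ^ 2 * L < 2 * n) :
    1 ≤ learnerEpochs c n ∧ (learnerEpochs c n : ℝ) ≤ 2 * L ∧
      ((1 : ℝ) / 2 ^ learnerEpochs c n) ^ 2 ≤ c ^ 2 * L / (2 * n) := by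
  have hn0 : (0 : ℝ) < n := by exact_mod_cast (by omega : 0 < n)
  have hlog1 : 1 ≤ Real.log n := by
    rw [Real.le_log_iff_exp_le hn0]
    have h3 : (3 : ℝ) ≤ n := by exact_mod_cast hn
    linarith [Real.exp_one_lt_d9]
  have hden : 0 < c ^ 2 * Real.log n := by positivity
  set y := 2 * n / (c ^ 2 * Real.log n) with hy
  have hy1 : 1 < y := by
    rw [hy, one_lt_div hden]
    refine lt_of_le_of_lt ?_ hcn
    gcongr
  have hyn : y ≤ n := by
    rw [hy, div_le_iff₀ hden]
    have : 2 ≤ c ^ 2 * Real.log n := by nlinarith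
    nlinarith
  have hs1 : 1 < Real.sqrt y := by rw [Real.lt_sqrt zero_le_one]; simpa using hy1
  have hlogpos : 0 < Real.logb 2 (Real.sqrt y) := Real.logb_pos one_lt_two hs1
  refine ⟨Nat.ceil_pos.2 hlogpos, ?_, ?_⟩
  · have h1 := (Nat.ceil_lt_add_one hlogpos.le).le
    have h2 : Real.logb 2 (Real.sqrt y) ≤ Real.log n := by
      -- The square root halves the logarithm, and `2 * log 2 ≥ 1` absorbs the change of base.
      rw [Real.logb, div_le_iff₀ (Real.log_pos one_lt_two), Real.log_sqrt (by linarith)]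
      have h3 : Real.log y ≤ Real.log n := Real.log_le_log (by linarith) hyn
      have h4 := Real.log_two_gt_d9
      nlinarith
    change ((⌈Real.logb 2 (Real.sqrt y)⌉₊ : ℕ) : ℝ) ≤ _
    linarith
  · have h1 : Real.sqrt y ≤ 2 ^ learnerEpochs c n := by
      have h2 : Real.logb 2 (Real.sqrt y) ≤ learnerEpochs c n := Nat.le_ceil _
      rw [Real.logb_le_iff_le_rpow one_lt_two (by linarith)] at h2
      rwa [Real.rpow_natCast] at h2
    have h3 : y ≤ (2 ^ learnerEpochs c n) ^ 2 := by
      rw [← Real.sq_sqrt (by linarith : 0 ≤ y)]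
      gcongr
    calc ((1 : ℝ) / 2 ^ learnerEpochs c n) ^ 2 = 1 / (2 ^ learnerEpochs c n) ^ 2 := by
          rw [div_pow, one_pow]
      _ ≤ 1 / y := by gcongr
      _ = c ^ 2 * Real.log n / (2 * n) := by rw [hy, one_div_div]
      _ ≤ _ := by gcongr

/-- There are at most `2 * d * L ^ 2` line searches with at most `2 * L` learner epochs each, where
`L = log T`. The lower bound on `T` makes the quotients so large that each rounding costs at most a
factor `2`. -/
theorem descent_parameters (hd : 1 ≤ d) (hc : 2 < c ^ 2) (hL : 1 ≤ Real.log T)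
    (hT : (32 + 4 * c ^ 2) * d * Real.log T ^ 4 ≤ T) :
    (T : ℝ) / (16 * d * Real.log T ^ 3) ≤ lsSamples c d T - 1 ∧ 2 ≤ lsSamples c d T ∧
      lsEpochs c d T * lsSamples c d T ≤ T ∧
      ((1 : ℝ) / 2 ^ lsEpochs c d T) ^ 2 ≤ 2 * c ^ 2 * d * Real.log T ^ 4 / T := by
  set L := Real.log T with hLdef
  have hd' : (1 : ℝ) ≤ d := by exact_mod_cast hd
  have hT0 : (0 : ℝ) < T := lt_of_lt_of_le (by positivity) hT
  set n := T / cdEpochs d T with hn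
  have hL23 : L ^ 2 ≤ L ^ 3 := pow_le_pow_right₀ hL (by norm_num)
  have hL34 : L ^ 3 ≤ L ^ 4 := pow_le_pow_right₀ hL (by norm_num)
  have hdL2 : d * L ^ 2 ≤ d * L ^ 4 := 
    mul_le_mul_of_nonneg_left (hL23.trans hL34) (by positivity)
  have hdL3 : d * L ^ 3 ≤ d * L ^ 4 := by gcongr
  have hcd : 0 ≤ c ^ 2 * (d * L ^ 4) := by positivity
  have hdL4 : 0 < d * L ^ 4 := by positivity
  have hn1 := lineSearch_budget_ge (T := T) hd hL (by nlinarith)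
  rw [← hLdef, ← hn] at hn1
  have hn2 : c ^ 2 * L ≤ n := by
    refine le_trans ?_ hn1
    rw [le_div_iff₀ (by positivity)]
    calc c ^ 2 * L * (4 * d * L ^ 2) = 4 * (c ^ 2 * (d * L ^ 3)) := by ring
      _ ≤ 4 * (c ^ 2 * (d * L ^ 4)) := by gcongr
      _ ≤ T := by nlinarith
  have hn8 : 8 * L ≤ n := by
    refine le_trans ?_ hn1
    rw [le_div_iff₀ (by positivity)]
    calc 8 * L * (4 * d * L ^ 2) = 32 * (d * L ^ 3) := by ring
      _ ≤ 32 * (d * L ^ 4) := by gcongr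
      _ ≤ T := by nlinarith
  have hn3 : 3 ≤ n := by
    have : (3 : ℝ) ≤ n := by linarith
    exact_mod_cast this
  have hn0 : (0 : ℝ) < n := by linarith
  have hnT : n ≤ T := Nat.div_le_self _ _
  have hlog : Real.log n ≤ L := Real.log_le_log hn0 (by exact_mod_cast hnT)
  obtain ⟨hK1, hK2, hK3⟩ := learnerEpochs_bounds (n := n) (L := L) hc hn3 hlog (by linarith)
  have hKdef : lsEpochs c d T = learnerEpochs c n := rfl
  have hNdef : lsSamples c d T = n / learnerEpochs c n := rfl
  rw [hKdef, hNdef]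
  set K := learnerEpochs c n
  have hN := natDiv_ge_half_div (m := n) (by linarith : 0 < 2 * L) hK2 hK1 (by linarith)
  have hN2 : (2 : ℝ) ≤ ((n / K : ℕ) : ℝ) := by
    refine le_trans ?_ hN
    rw [le_div_iff₀ (by positivity)]
    linarith
  refine ⟨?_, by exact_mod_cast hN2, (Nat.mul_div_le _ _).trans hnT, ?_⟩
  · have h1 : (T : ℝ) / (16 * d * L ^ 3) ≤ n / (2 * (2 * L)) := by
      rw [le_div_iff₀ (by positivity)]
      refine le_trans (le_of_eq ?_) hn1
      field_simp
      norm_num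
    have h2 : (n : ℝ) / (2 * (2 * L)) ≤ ((n / K : ℕ) : ℝ) - 1 := by
      have h3 := div_sub_one_lt_natDiv n K
      have hK0 : (0 : ℝ) < K := by exact_mod_cast hK1
      have h4 : (n : ℝ) / (2 * L) ≤ n / K := by gcongr
      have h5 : (n : ℝ) / (2 * L) = n / (2 * (2 * L)) + n / (2 * (2 * L)) := by field_simp; ring
      have h6 : 2 ≤ (n : ℝ) / (2 * (2 * L)) := by
        rw [le_div_iff₀ (by positivity)]; linarith
      linarith
    exact h1.trans h2
  · refine hK3.trans ?_
    rw [div_le_div_iff₀ (by positivity) hT0]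
    rw [div_le_iff₀ (by positivity)] at hn1
    calc c ^ 2 * L * T ≤ c ^ 2 * L * (n * (4 * d * L ^ 2)) := by gcongr
      _ = 4 * c ^ 2 * d * L ^ 3 * n := by ring
      _ ≤ 4 * c ^ 2 * d * L ^ 4 * n := by gcongr
      _ = _ := by ring

/-- The exponent is at least `log T ^ 2`, which beats `log T / γ` eventually for every `γ`, so `γ`
need not be known to the algorithm. Completing the square gives the constant. -/
theorem contraction_pow_le {γ : ℝ} (hγ0 : 0 < γ) (hγ1 : γ ≤ 1) (hd : 1 ≤ d) (hT : 2 ≤ T) :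
    (1 - γ) ^ cdEpochs d T ≤ Real.exp (1 / (4 * γ)) / T := by
  have hT0 : (0 : ℝ) < T := by exact_mod_cast (by omega : 0 < T)
  set L := Real.log T with hL
  have hd' : (1 : ℝ) ≤ d := by exact_mod_cast hd
  have hE : L ^ 2 ≤ cdEpochs d T := by
    refine le_trans ?_ (Nat.le_ceil _)
    nlinarith [sq_nonneg L]
  have h1 : 1 - γ ≤ Real.exp (-γ) := by linarith [Real.add_one_le_exp (-γ)]
  calc (1 - γ) ^ cdEpochs d T ≤ Real.exp (-γ) ^ cdEpochs d T := by
        gcongr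
    _ = Real.exp (-(γ * cdEpochs d T)) := by rw [← Real.exp_nat_mul]; congr 1; ring
    _ ≤ Real.exp (1 / (4 * γ) - L) := by
        refine Real.exp_le_exp.2 ?_
        have h2 : 0 ≤ γ * (L - 1 / (2 * γ)) ^ 2 := by positivity
        have h3 : γ * (L - 1 / (2 * γ)) ^ 2 = γ * L ^ 2 - L + 1 / (4 * γ) := by field_simp; ring
        have h4 := mul_le_mul_of_nonneg_left hE hγ0.le
        linarith
    _ = _ := by rw [Real.exp_sub, hL, Real.exp_log hT0]

theorem exists_log_bounds (A : ℝ) : ∃ T₀ : ℕ, ∀ T : ℕ, T₀ ≤ T →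
    1 ≤ Real.log T ∧ A * Real.log T ^ 4 ≤ T := by
  have h1 : ∀ᶠ T : ℕ in Filter.atTop, 1 ≤ Real.log T :=
    (Real.tendsto_log_atTop.comp tendsto_natCast_atTop_atTop).eventually_ge_atTop 1
  have h2 : ∀ᶠ T : ℕ in Filter.atTop, |A| * Real.log T ^ 4 ≤ T := by
    have h3 := (Real.isLittleO_pow_log_id_atTop (n := 4)).bound
      (show 0 < 1 / (|A| + 1) by positivity)
    filter_upwards [tendsto_natCast_atTop_atTop.eventually h3] with T hT
    have hA : 0 < |A| + 1 := by positivity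
    rw [div_mul_eq_mul_div, one_mul, le_div_iff₀ hA] at hT
    simp only [Real.norm_eq_abs, id, abs_pow, Nat.abs_cast] at hT
    have h4 : |Real.log T| ^ 4 = Real.log T ^ 4 := by
      rw [← abs_pow, abs_of_nonneg (by positivity)]
    rw [h4] at hT
    nlinarith [show 0 ≤ Real.log T ^ 4 by positivity]
  obtain ⟨T₀, h⟩ := Filter.eventually_atTop.1 (h1.and h2)
  refine ⟨T₀, fun T hT => ⟨(h T hT).1, le_trans ?_ (h T hT).2⟩⟩
  gcongr
  exact le_abs_self A

end Parameters

/-! ### The rate of coordinate descent -/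

section Rate

theorem div_rpow_le {A T q : ℝ} (hA : 0 ≤ A) (hT : 0 < T) (hq0 : 0 ≤ q) (hq1 : q ≤ 1) :
    (A / T) ^ q ≤ (1 + A) * T ^ (-q) := by
  rw [Real.div_rpow hA hT.le, div_eq_mul_inv, ← Real.rpow_neg hT.le]
  gcongr
  calc A ^ q ≤ (1 + A) ^ q := by gcongr; linarith
    _ ≤ (1 + A) ^ (1 : ℝ) := Real.rpow_le_rpow_of_exponent_le (by linarith) hq1
    _ = 1 + A := Real.rpow_one _

theorem one_add_mul_log_le {A L : ℝ} (hL : 1 ≤ L) : 1 + A * L ^ 4 ≤ (1 + A) * L ^ 4 := by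
  have := one_le_pow₀ hL (n := 4)
  linarith

theorem sq_rpow {x : ℝ} (hx : 0 ≤ x) (a : ℝ) : (x ^ 2) ^ a = x ^ (2 * a) := by
  rw [← Real.rpow_natCast x 2, ← Real.rpow_mul hx, Nat.cast_ofNat]

theorem rpow_sq {x : ℝ} (hx : 0 ≤ x) (a : ℝ) : (x ^ a) ^ 2 = x ^ (2 * a) := by
  rw [← Real.rpow_mul_natCast hx, Nat.cast_ofNat, mul_comm]

/-- The number of successful learner epochs and the accuracy they achieve. -/
theorem exists_stopping_epoch {d T : ℕ} {R c k κ : ℝ} (hd : 1 ≤ d) (hR : 0 < R) (hc : 2 < c ^ 2)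
    (hk : 2 ≤ k) (hκ : 0 < κ) (hL : 1 ≤ Real.log T)
    (hT : ((32 + 4 * c ^ 2) * d + 2 * c ^ 2 * d) * Real.log T ^ 4 ≤ T) :
    ∃ I ≤ lsEpochs c d T,
      (∀ i < I, 2 * Real.exp (-((κ * (R / 2 ^ i) ^ (k - 1)) ^ 2 / 4)) ^ (lsSamples c d T - 1) ≤
        2 / T ^ 2) ∧
      (R / 2 ^ I) ^ k ≤ ((1 + 128 * d / κ ^ 2) + R ^ k * (1 + 2 * c ^ 2 * d)) *
        (Real.log T ^ 4 * (T : ℝ) ^ (-(k / (2 * k - 2)))) ∧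
      (I : ℝ) * ((lsSamples c d T + 1) * (2 / T ^ 2)) ≤ 4 / T := by
  classical
  set L := Real.log T with hLdef
  have hd' : (1 : ℝ) ≤ d := by exact_mod_cast hd
  have hL4 : 0 < L ^ 4 := by positivity
  have hcd : 0 ≤ c ^ 2 * d * L ^ 4 := by positivity
  have hdL : 0 ≤ d * L ^ 4 := by positivity
  have hT1 : (32 + 4 * c ^ 2) * d * L ^ 4 ≤ T := by nlinarith
  have hT2 : 2 * c ^ 2 * d * L ^ 4 ≤ T := by nlinarith
  have hT0 : (0 : ℝ) < T := lt_of_lt_of_le (by positivity) hT1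
  obtain ⟨hN1, hN2, hKN, hK⟩ := descent_parameters hd hc hL hT1
  rw [← hLdef] at hN1 hK
  set K := lsEpochs c d T
  set N := lsSamples c d T
  set q := k / (2 * k - 2) with hq
  have h2k : 0 < 2 * k - 2 := by linarith
  have hq0 : 0 ≤ q := by positivity
  have hq1 : q ≤ 1 := by rw [hq, div_le_one h2k]; linarith
  have hN0 : (0 : ℝ) < N - 1 := lt_of_lt_of_le (by positivity) hN1
  -- Chosen such that `κ ^ 2 * Y / 4 * (N - 1) = 2 * L`; a radius above `r` then has failure term at
  -- most `2 / T ^ 2`.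
  set Y := 8 * L / (κ ^ 2 * (N - 1)) with hY
  have hY0 : 0 < Y := by positivity
  set r := Y ^ (1 / (2 * k - 2)) with hr
  have hr0 : 0 < r := by positivity
  -- Stop at the first radius not above the critical one, or when the epochs run out.
  have hex : ∃ i, i = K ∨ R / 2 ^ i ≤ r := ⟨K, Or.inl rfl⟩
  set I := Nat.find hex with hI
  have hIK : I ≤ K := Nat.find_min' hex (Or.inl rfl)
  have hT4 : (0 : ℝ) < T ^ (-q) := by positivity
  refine ⟨I, hIK, fun i hi => ?_, ?_, ?_⟩
  · have h1 := Nat.find_min hex hi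
    push Not at h1
    have h2 : Y ≤ ((R / 2 ^ i) ^ (k - 1)) ^ 2 := by
      have h3 : r ^ (2 * k - 2) = Y := by
        rw [hr, ← Real.rpow_mul hY0.le, one_div_mul_cancel h2k.ne', Real.rpow_one]
      rw [← h3, rpow_sq (by positivity), show 2 * (k - 1) = 2 * k - 2 by ring]
      exact Real.rpow_le_rpow hr0.le h1.2.le h2k.le
    have h4 : 2 * L ≤ (κ * (R / 2 ^ i) ^ (k - 1)) ^ 2 / 4 * (N - 1) := by
      calc 2 * L = κ ^ 2 * Y / 4 * (N - 1) := by rw [hY]; field_simp; norm_num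
        _ ≤ κ ^ 2 * ((R / 2 ^ i) ^ (k - 1)) ^ 2 / 4 * (N - 1) := by gcongr
        _ = _ := by rw [mul_pow]
    have h5 : Real.exp (-((κ * (R / 2 ^ i) ^ (k - 1)) ^ 2 / 4)) ^ (N - 1) ≤ 1 / T ^ 2 := by
      rw [← Real.exp_nat_mul, Nat.cast_sub (by omega), Nat.cast_one]
      calc _ ≤ Real.exp (-(2 * L)) := Real.exp_le_exp.2 (by linarith)
        _ = 1 / T ^ 2 := by
          rw [Real.exp_neg, two_mul, Real.exp_add, hLdef, Real.exp_log hT0, one_div, sq]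
    calc _ ≤ 2 * (1 / (T : ℝ) ^ 2) := by gcongr
      _ = _ := by ring
  · have hsplit : ∀ {x A : ℝ}, 0 ≤ A → x ≤ (A * L ^ 4 / T) ^ q →
        x ≤ (1 + A) * (L ^ 4 * (T : ℝ) ^ (-q)) := by
      intro x A hA hx
      refine hx.trans ((div_rpow_le (by positivity) hT0 hq0 hq1).trans ?_)
      rw [← mul_assoc]
      gcongr
      exact one_add_mul_log_le hL
    have hLT : 0 ≤ L ^ 4 * (T : ℝ) ^ (-q) := by positivity
    rcases Nat.find_spec hex with h1 | h1
    · rw [← hI] at h1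
      -- The epochs ran out. The squared relative radius is at most a base that is at most `1`, and
      -- `k / 2 ≥ q` because `k ≥ 2`.
      have hKq : ((1 : ℝ) / 2 ^ K) ^ k ≤ (2 * c ^ 2 * d * L ^ 4 / T) ^ q := by
        have h2 : ((1 : ℝ) / 2 ^ K) ^ k = (((1 : ℝ) / 2 ^ K) ^ 2) ^ (k / 2) := by
          rw [sq_rpow (by positivity)]
          congr 1; ring
        rw [h2]
        calc _ ≤ (2 * c ^ 2 * d * L ^ 4 / T) ^ (k / 2) := by gcongr
          _ ≤ _ := by
            refine Real.rpow_le_rpow_of_exponent_ge' (by positivity) ((div_le_one hT0).2 hT2) hq0 ?_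
            rw [hq, div_le_div_iff₀ h2k two_pos]
            nlinarith
      have h3 := hsplit (by positivity) hKq
      have h4 : (R / 2 ^ I) ^ k = R ^ k * ((1 : ℝ) / 2 ^ K) ^ k := by
        rw [h1, ← Real.mul_rpow hR.le (by positivity)]; congr 1; ring
      rw [h4, add_mul, mul_assoc (R ^ k)]
      have h5 : 0 ≤ (1 + 128 * d / κ ^ 2) * (L ^ 4 * (T : ℝ) ^ (-q)) := by positivity
      have h6 := mul_le_mul_of_nonneg_left h3 (by positivity : 0 ≤ R ^ k)
      linarith
    · rw [← hI] at h1
      have h2 : (R / 2 ^ I) ^ k ≤ (128 * d / κ ^ 2 * L ^ 4 / T) ^ q := by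
        calc (R / 2 ^ I) ^ k ≤ r ^ k := by gcongr
          _ = Y ^ q := by rw [hr, ← Real.rpow_mul hY0.le, hq]; congr 1; ring
          _ ≤ _ := by
            gcongr
            rw [hY, div_le_iff₀ (by positivity)]
            rw [div_le_iff₀ (by positivity)] at hN1
            have h3 : 128 * d / κ ^ 2 * L ^ 4 / T * (κ ^ 2 * (N - 1)) =
                8 * L * (((N : ℝ) - 1) * (16 * d * L ^ 3) / T) := by field_simp; norm_num
            rw [h3]
            have h4 : 1 ≤ ((N : ℝ) - 1) * (16 * d * L ^ 3) / T := (one_le_div hT0).2 hN1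
            nlinarith
      have h3 := hsplit (by positivity) h2
      have h5 : 0 ≤ R ^ k * (1 + 2 * c ^ 2 * d) * (L ^ 4 * (T : ℝ) ^ (-q)) := by positivity
      rw [add_mul]
      linarith
  · have hN2' : (2 : ℝ) ≤ N := by exact_mod_cast hN2
    have hIK' : (I : ℝ) ≤ K := by exact_mod_cast hIK
    have hKN' : (K : ℝ) * N ≤ T := by exact_mod_cast hKN
    calc (I : ℝ) * ((N + 1) * (2 / T ^ 2)) ≤ K * ((2 * N) * (2 / (T : ℝ) ^ 2)) := by
          gcongr; linarith
      _ = 4 * (K * N) / (T : ℝ) ^ 2 := by ring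
      _ ≤ 4 * T / (T : ℝ) ^ 2 := by gcongr
      _ = 4 / (T : ℝ) := by field_simp

/-- `θ` makes the band so thin that derivatives on it stay below `τ`; `κ * r ^ (k - 1)` is a margin
it provides at radius `r`, capped so as not to exceed `1`. -/
theorem exists_margin_constants {R k lam Lam a τ : ℝ} (hR : 0 < R) (hk : 2 ≤ k) (hlam : 0 < lam)
    (hLam : 0 < Lam) (ha : 0 < a) (hτ : 0 < τ) :
    ∃ θ κ : ℝ, 0 < θ ∧ θ ≤ 1 / 2 ∧ Lam * (θ * R) ^ (k - 1) ≤ τ ∧ 0 < κ ∧ κ * R ^ (k - 1) ≤ 1 ∧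
      κ ≤ a * lam * (θ / 2) ^ (k - 1) * (θ / 4) := by
  set θ := min (1 / 2) (min 1 (τ / Lam) / R) with hθ
  have hθ0 : 0 < θ := by positivity
  have hθR : θ * R ≤ min 1 (τ / Lam) := by
    rw [← le_div_iff₀ hR]; exact min_le_right _ _
  refine ⟨θ, min (a * lam * (θ / 2) ^ (k - 1) * (θ / 4)) (1 / R ^ (k - 1)), hθ0, min_le_left _ _,
    ?_, by positivity, ?_, min_le_left _ _⟩
  · have h1 : (θ * R) ^ (k - 1) ≤ (θ * R) ^ (1 : ℝ) :=
      Real.rpow_le_rpow_of_exponent_ge (by positivity) (hθR.trans (min_le_left _ _)) (by linarith)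
    rw [Real.rpow_one] at h1
    have h2 := h1.trans (hθR.trans (min_le_right _ _))
    rwa [le_div_iff₀ hLam, mul_comm] at h2
  · rw [← le_div_iff₀ (by positivity)]
    exact min_le_right _ _

theorem rsscd_rate {d : ℕ} (hd : 1 ≤ d) {R c k lam Lam a b τ : ℝ} (hR : 0 < R) (hc : 2 < c ^ 2)
    (hk : 2 ≤ k) (hlam : 0 < lam) (hLam : lam / 2 < Lam) (ha : 0 < a) (hτ : 0 < τ) :
    ∃ (C : ℝ) (p : ℕ), ∀ S : Set (Point d), IsCompact S → Convex ℝ S → Metric.diam S ≤ R →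
      ∀ x₀ ∈ S, ∀ T : ℕ, 2 ≤ T →
        ∀ (f : Point d → ℝ) (g : Point d → Point d) (η : Point d → Fin d → unitInterval)
          (xstar : Point d), IsGradientOn S f g → IsUC S f g k lam → IsLkSS S f g k Lam →
          IsSignOracle S g η a b τ → xstar ∈ S → IsMinOn f S xstar →
          (rsscd S R c x₀ T).expectedError (cdSeedLaw d) η f xstar ≤
            ENNReal.ofReal (C * Real.log T ^ p * (T : ℝ) ^ (-(k / (2 * k - 2)))) := by
  have hd' : (1 : ℝ) ≤ d := by exact_mod_cast hd
  have hLam0 : 0 < Lam := by linarith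
  obtain ⟨θ, κ, hθ0, hθ, hθτ, hκ0, hκ1, hκ⟩ := exists_margin_constants hR hk hlam hLam0 ha hτ
  obtain ⟨γ, hγ⟩ : ∃ γ : ℝ, γ = 1 / (d * (2 * d * Lam / lam) ^ 2) := ⟨_, rfl⟩
  have hγ0 : 0 < γ := by rw [hγ]; positivity
  have hγ1 : γ ≤ 1 := by
    have hD1 : 1 ≤ 2 * d * Lam / lam := by
      rw [one_le_div hlam]
      nlinarith
    rw [hγ, div_le_one (by positivity)]
    exact one_le_mul_of_one_le_of_one_le hd' (one_le_pow₀ hD1)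
  obtain ⟨T₀, hT₀⟩ := exists_log_bounds ((32 + 4 * c ^ 2) * d + 2 * c ^ 2 * d)
  obtain ⟨B, hB⟩ : ∃ B : ℝ, B = d * Lam * R ^ k := ⟨_, rfl⟩
  have hB0 : 0 ≤ B := by rw [hB]; positivity
  obtain ⟨CB, hCB⟩ : ∃ CB : ℝ, CB = (1 + 128 * d / κ ^ 2) + R ^ k * (1 + 2 * c ^ 2 * d) := ⟨_, rfl⟩
  have hCB0 : 0 ≤ CB := by rw [hCB]; positivity
  set q := k / (2 * k - 2) with hq
  have h2k : 0 < 2 * k - 2 := by linarith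
  have hq0 : 0 ≤ q := by positivity
  have hq1 : q ≤ 1 := by rw [hq, div_le_one h2k]; linarith
  obtain ⟨C₁, hC₁⟩ : ∃ C₁ : ℝ, C₁ =
    Real.exp (1 / (4 * γ)) * B + (Lam * (3 ^ k * CB) + B * 4) / γ := ⟨_, rfl⟩
  -- This constant covers `T < T₀`, where the trivial bound `B` is enough.
  obtain ⟨C₂, hC₂⟩ : ∃ C₂ : ℝ, C₂ = B * T₀ / Real.log 2 ^ 4 := ⟨_, rfl⟩
  have hlog2 : 0 < Real.log 2 := Real.log_pos one_lt_two
  have hC₁0 : 0 ≤ C₁ := by rw [hC₁]; positivity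
  have hC₂0 : 0 ≤ C₂ := by rw [hC₂]; positivity
  refine ⟨C₁ + C₂, 4, ?_⟩
  intro S hS hcv hdiam x₀ hx₀ T hT f g η xstar hg huc hss ho hxs hmin
  have hT0 : (0 : ℝ) < T := by exact_mod_cast (by omega : 0 < T)
  have hT1 : (1 : ℝ) ≤ T := by exact_mod_cast (by omega : 1 ≤ T)
  have hinv : (1 : ℝ) / T ≤ (T : ℝ) ^ (-q) := by
    rw [one_div, ← Real.rpow_neg_one]
    exact Real.rpow_le_rpow_of_exponent_le hT1 (by linarith)
  have hTq : (0 : ℝ) < (T : ℝ) ^ (-q) := by positivity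
  -- `f` is continuous on `S`; its extension by zero is measurable.
  obtain ⟨cost, hcostm, hfc⟩ : ∃ cost : Point d → ENNReal, Measurable cost ∧
      ∀ x ∈ S, ENNReal.ofReal (f x - f xstar) = cost x := by
    classical
    refine ⟨fun x => ENNReal.ofReal (S.piecewise f (fun _ => 0) x - f xstar), ?_, ?_⟩
    · exact ((ContinuousOn.measurable_piecewise hg.continuousOn continuousOn_const
        hS.measurableSet).sub_const _).ennreal_ofReal
    · intro x hx
      simp [hx]
  rw [expectedError_rsscd hd hS hcv hR.le c hx₀ T ho.measurable xstar hcostm hfc]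
  by_cases hTT : T₀ ≤ T
  · obtain ⟨hL, hA⟩ := hT₀ T hTT
    obtain ⟨I, hIK, hI1, hI2, hI3⟩ := exists_stopping_epoch (κ := κ) hd hR hc hk hκ0 hL hA
    rw [← hCB, ← hq] at hI2
    set L := Real.log T with hLdef
    have hL4 : 1 ≤ L ^ 4 := one_le_pow₀ hL
    have hmain := lintegral_noisyPoint_le (ε := 3 * (R / 2 ^ I)) (π := 4 / T) (γ := γ) hd hS hcv
      hdiam hk hlam hLam hg huc hss ho.measurable hxs hmin hcostm hfc hx₀ (lsSamples c d T)
      (lsEpochs c d T) (by positivity) (by positivity) hγ (fun x hx j αs hαs =>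
        (measure_lineSearch_far_le hS hcv hx hR hdiam hk hlam hLam0 ha hτ huc hss ho hαs hθ0 hθ hθτ
          hκ0.le hκ1 hκ (lsSamples c d T) hIK hI1).trans (ENNReal.ofReal_le_ofReal hI3))
      (cdEpochs d T)
    refine hmain.trans (ENNReal.ofReal_le_ofReal ?_)
    rw [← hB]
    set Q := L ^ 4 * (T : ℝ) ^ (-q) with hQ
    have hQ0 : 0 ≤ Q := by positivity
    have hTQ : 1 / (T : ℝ) ≤ Q := hinv.trans (le_mul_of_one_le_left hTq.le hL4)
    have h1 : (1 - γ) ^ cdEpochs d T * B ≤ Real.exp (1 / (4 * γ)) * B * Q := by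
      have h2 := contraction_pow_le (d := d) hγ0 hγ1 hd hT
      calc _ ≤ Real.exp (1 / (4 * γ)) / T * B := by gcongr
        _ = Real.exp (1 / (4 * γ)) * B * (1 / T) := by ring
        _ ≤ _ := by gcongr
    have h3 : Lam * (3 * (R / 2 ^ I)) ^ k + B * (4 / T) ≤ (Lam * (3 ^ k * CB) + B * 4) * Q := by
      rw [Real.mul_rpow (by norm_num) (by positivity)]
      calc _ = Lam * (3 ^ k * (R / 2 ^ I) ^ k) + B * 4 * (1 / T) := by ring
        _ ≤ Lam * (3 ^ k * (CB * Q)) + B * 4 * Q := by gcongr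
        _ = _ := by ring
    calc _ ≤ Real.exp (1 / (4 * γ)) * B * Q + (Lam * (3 ^ k * CB) + B * 4) * Q / γ := by gcongr
      _ = C₁ * Q := by rw [hC₁]; ring
      _ ≤ (C₁ + C₂) * Q := by gcongr; linarith
      _ = _ := by rw [hQ]; ring
  · have hpt : ∀ J z, cost (noisyPoint S R (lsEpochs c d T) (lsSamples c d T) η x₀ J z
        (cdEpochs d T)) ≤ ENNReal.ofReal B := by
      intro J z
      have hmem := noisyPoint_mem (η := η) hS hcv hR.le (lsEpochs c d T) (lsSamples c d T) hx₀ J z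
        (cdEpochs d T)
      rw [← hfc _ hmem, hB]
      exact ENNReal.ofReal_le_ofReal (error_le_const hk hlam hLam hS hdiam hg huc hss hmem hxs)
    have := isProbabilityMeasure_coordLaw hd
    calc _ ≤ ∫⁻ _, ∫⁻ _, ENNReal.ofReal B ∂seqLaw squareLaw ∂seqLaw (coordLaw d) :=
          lintegral_mono fun J => lintegral_mono fun z => hpt J z
      _ = ENNReal.ofReal B := by simp
      _ ≤ _ := by
          refine ENNReal.ofReal_le_ofReal ?_
          have hTT' : (T : ℝ) ≤ T₀ := by exact_mod_cast (by omega : T ≤ T₀)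
          have hlogT : Real.log 2 ≤ Real.log T := Real.log_le_log two_pos (by exact_mod_cast hT)
          have h1 : B ≤ C₂ * Real.log T ^ 4 * (1 / T) := by
            rw [mul_one_div, le_div_iff₀ hT0, hC₂, div_mul_eq_mul_div, le_div_iff₀ (by positivity)]
            gcongr
          calc B ≤ C₂ * Real.log T ^ 4 * (1 / T) := h1
            _ ≤ (C₁ + C₂) * Real.log T ^ 4 * (T : ℝ) ^ (-q) := by
              gcongr
              linarith

end Rate

/-! ### Testing two oracles -/

section TwoPoint

/-- With `x = √p` and `y = √r`, the mean exceeds `√(p * r)` by `(x - y) ^ 2 / 2`, and `x + y ≥ 1`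
bounds this by `(p - r) ^ 2 / 2`. -/
theorem sqrt_mul_sqrt_ge {p r : ℝ} (hp : 1 / 4 ≤ p) (hr : 1 / 4 ≤ r) :
    (p + r) / 2 - (p - r) ^ 2 / 2 ≤ Real.sqrt (p * r) := by
  rw [Real.sqrt_mul (by linarith)]
  set x := Real.sqrt p
  set y := Real.sqrt r
  have hx : x ^ 2 = p := Real.sq_sqrt (by linarith)
  have hy : y ^ 2 = r := Real.sq_sqrt (by linarith)
  have hx2 : 1 / 2 ≤ x := Real.le_sqrt_of_sq_le (by linarith)
  have hy2 : 1 / 2 ≤ y := Real.le_sqrt_of_sq_le (by linarith)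
  rw [← hx, ← hy]
  have h1 : (1 : ℝ) ≤ (x + y) ^ 2 := by nlinarith
  have h2 := mul_le_mul_of_nonneg_left h1 (sq_nonneg (x - y))
  nlinarith

/-- The right side is the Hellinger affinity of two coins; for biases away from the extremes its
deficit is quadratic in their difference. -/
theorem affinity_ge {p r χ : ℝ} (hp : |p - 1 / 2| ≤ 1 / 4) (hr : |r - 1 / 2| ≤ 1 / 4)
    (h : (p - r) ^ 2 ≤ χ) :
    1 - χ ≤ Real.sqrt (p * r) + Real.sqrt ((1 - p) * (1 - r)) := by
  rw [abs_le] at hp hr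
  have h1 := sqrt_mul_sqrt_ge (p := p) (r := r) (by linarith) (by linarith)
  have h2 := sqrt_mul_sqrt_ge (p := 1 - p) (r := 1 - r) (by linarith) (by linarith)
  nlinarith

/-- `v - √(v * w) + w / 4` is a square. The bound passes from the affinity to the minimum of the
likelihoods, which governs testing. -/
theorem sqrt_mul_sub_le_min {v w : ℝ} (hv : 0 ≤ v) (hw : 0 ≤ w) :
    Real.sqrt (v * w) - (v + w) / 4 ≤ min v w := by
  rw [Real.sqrt_mul hv]
  have h1 := Real.sq_sqrt hv
  have h2 := Real.sq_sqrt hw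
  refine le_min ?_ ?_
  · nlinarith [sq_nonneg (Real.sqrt v - Real.sqrt w / 2)]
  · nlinarith [sq_nonneg (Real.sqrt w - Real.sqrt v / 2)]

variable {d : ℕ} {Ω : Type*} {A : SignAlgorithm d Ω} {S : Set (Point d)}
  {η₀ η₁ : Point d → Fin d → unitInterval} {cost₀ cost₁ : Point d → ENNReal}

/-- No algorithm has small cost against two oracles that are close to each other, if every output
is costly for one of them. -/
theorem expectedFrom_two_point [MeasurableSpace Ω] {T : ℕ} (hA : A.IsAdmissible S T) {χ κ : ℝ}
    (hκ : 0 ≤ κ) (hχ : χ ≤ 1)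
    (h₀ : ∀ x ∈ S, ∀ j, |(η₀ x j : ℝ) - 1 / 2| ≤ 1 / 4)
    (h₁ : ∀ x ∈ S, ∀ j, |(η₁ x j : ℝ) - 1 / 2| ≤ 1 / 4)
    (hclose : ∀ x ∈ S, ∀ j, ((η₀ x j : ℝ) - η₁ x j) ^ 2 ≤ χ)
    (hcost : ∀ x ∈ S, ENNReal.ofReal κ ≤ cost₀ x + cost₁ x) (ω : Ω) (n : ℕ) (h : List Bool)
    (hn : h.length + n = A.numQueries) {v w : ℝ} (hv : 0 ≤ v) (hw : 0 ≤ w) :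
    ENNReal.ofReal (κ * ((1 - χ) ^ n * Real.sqrt (v * w) - (v + w) / 4)) ≤
      ENNReal.ofReal v * A.expectedFrom η₀ cost₀ ω n h +
        ENNReal.ofReal w * A.expectedFrom η₁ cost₁ ω n h := by
  -- In use, `v` and `w` are the likelihoods of the history under the two oracles. A query
  -- multiplies the sum of `√(v * w)` over both answers by at least `1 - χ` and preserves the sum of
  -- `v + w`.
  induction n generalizing h v w with
  | zero =>
    have hmem := hA.output_mem ω h (by omega)
    simp only [SignAlgorithm.expectedFrom, pow_zero, one_mul]
    calc _ ≤ ENNReal.ofReal (κ * min v w) :=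
          ENNReal.ofReal_le_ofReal (mul_le_mul_of_nonneg_left (sqrt_mul_sub_le_min hv hw) hκ)
      _ = ENNReal.ofReal (min v w) * ENNReal.ofReal κ := by
          rw [mul_comm, ENNReal.ofReal_mul (le_min hv hw)]
      _ ≤ ENNReal.ofReal (min v w) * (cost₀ (A.output ω h) + cost₁ (A.output ω h)) := by
          gcongr; exact hcost _ hmem
      _ ≤ _ := by
          rw [mul_add]
          gcongr
          · exact min_le_left _ _
          · exact min_le_right _ _
  | succ n ih =>
    have hmem := hA.query_mem ω h (by omega)
    simp only [SignAlgorithm.expectedFrom]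
    set x := (A.query ω h).1
    set j := (A.query ω h).2
    set p : ℝ := (η₀ x j : ℝ) with hp
    set r : ℝ := (η₁ x j : ℝ) with hr
    have hp0 : 0 ≤ p := (η₀ x j).2.1
    have hp1 : 0 ≤ 1 - p := sub_nonneg.2 (η₀ x j).2.2
    have hr0 : 0 ≤ r := (η₁ x j).2.1
    have hr1 : 0 ≤ 1 - r := sub_nonneg.2 (η₁ x j).2.2
    have i1 := ih (h ++ [true]) (by simp; omega) (mul_nonneg hv hp0) (mul_nonneg hw hr0)
    have i2 := ih (h ++ [false]) (by simp; omega) (mul_nonneg hv hp1) (mul_nonneg hw hr1)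
    rw [ENNReal.ofReal_mul hv, ENNReal.ofReal_mul hw] at i1 i2
    have haff := affinity_ge (h₀ x hmem j) (h₁ x hmem j) (hclose x hmem j)
    have hs : Real.sqrt (v * p * (w * r)) + Real.sqrt (v * (1 - p) * (w * (1 - r))) =
        Real.sqrt (v * w) * (Real.sqrt (p * r) + Real.sqrt ((1 - p) * (1 - r))) := by
      rw [mul_add, ← Real.sqrt_mul (mul_nonneg hv hw), ← Real.sqrt_mul (mul_nonneg hv hw)]
      congr 2 <;> ring
    have hkey : κ * ((1 - χ) ^ (n + 1) * Real.sqrt (v * w) - (v + w) / 4) ≤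
        κ * ((1 - χ) ^ n * Real.sqrt (v * p * (w * r)) - (v * p + w * r) / 4) +
          κ * ((1 - χ) ^ n * Real.sqrt (v * (1 - p) * (w * (1 - r))) -
            (v * (1 - p) + w * (1 - r)) / 4) := by
      rw [← mul_add]
      refine mul_le_mul_of_nonneg_left ?_ hκ
      have h3 : 0 ≤ (1 - χ) ^ n * Real.sqrt (v * w) :=
        mul_nonneg (pow_nonneg (by linarith) _) (Real.sqrt_nonneg _)
      have h4 := mul_le_mul_of_nonneg_left haff h3
      have h5 : (1 - χ) ^ n * Real.sqrt (v * p * (w * r)) +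
          (1 - χ) ^ n * Real.sqrt (v * (1 - p) * (w * (1 - r))) =
          (1 - χ) ^ n * Real.sqrt (v * w) *
            (Real.sqrt (p * r) + Real.sqrt ((1 - p) * (1 - r))) := by
        rw [← mul_add, hs, mul_assoc]
      rw [pow_succ]
      linarith
    refine (ENNReal.ofReal_le_ofReal hkey).trans (ENNReal.ofReal_add_le.trans ?_)
    refine (add_le_add i1 i2).trans (le_of_eq ?_)
    ring

theorem measurable_expectedFrom [MeasurableSpace Ω] {T : ℕ} (hA : A.IsAdmissible S T)
    (hη : ∀ j, Measurable fun x => η₀ x j) (hcost : Measurable cost₀) (n : ℕ) (h : List Bool)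
    (hn : h.length + n = A.numQueries) : Measurable fun ω => A.expectedFrom η₀ cost₀ ω n h := by
  induction n generalizing h with
  | zero => exact hcost.comp (hA.output_measurable h (by omega))
  | succ n ih =>
    simp only [SignAlgorithm.expectedFrom]
    have hq := hA.query_measurable h (by omega)
    have hp : Measurable fun ω => (η₀ (A.query ω h).1 (A.query ω h).2 : ℝ) :=
      (measurable_of_coordinate (J := fun ω => (A.query ω h).2) (measurable_snd.comp hq)
        (F := fun j ω => η₀ (A.query ω h).1 j)
        fun j => (hη j).comp (measurable_fst.comp hq)).subtype_val
    exact (hp.ennreal_ofReal.mul (ih _ (by simp; omega))).add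
      ((hp.const_sub 1).ennreal_ofReal.mul (ih _ (by simp; omega)))

/-- Bernoulli's inequality gives affinity at least `3 / 4` after all queries, so the two expected
costs sum to at least `κ * (3 / 4 - 1 / 2)`. -/
theorem lintegral_two_point [MeasurableSpace Ω] (μ : Measure Ω) [IsProbabilityMeasure μ] {T : ℕ}
    (hA : A.IsAdmissible S T) {χ κ : ℝ} (hκ : 0 ≤ κ) (hχ0 : 0 ≤ χ) (hχ : χ ≤ 1)
    (hχT : T * χ ≤ 1 / 4) (hη : ∀ j, Measurable fun x => η₀ x j) (hcm : Measurable cost₀)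
    (h₀ : ∀ x ∈ S, ∀ j, |(η₀ x j : ℝ) - 1 / 2| ≤ 1 / 4)
    (h₁ : ∀ x ∈ S, ∀ j, |(η₁ x j : ℝ) - 1 / 2| ≤ 1 / 4)
    (hclose : ∀ x ∈ S, ∀ j, ((η₀ x j : ℝ) - η₁ x j) ^ 2 ≤ χ)
    (hcost : ∀ x ∈ S, ENNReal.ofReal κ ≤ cost₀ x + cost₁ x) :
    ENNReal.ofReal (κ / 8) ≤ ∫⁻ ω, A.expectedFrom η₀ cost₀ ω A.numQueries [] ∂μ ∨
      ENNReal.ofReal (κ / 8) ≤ ∫⁻ ω, A.expectedFrom η₁ cost₁ ω A.numQueries [] ∂μ := by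
  have hpt : ∀ ω, ENNReal.ofReal (κ / 4) ≤ A.expectedFrom η₀ cost₀ ω A.numQueries [] +
      A.expectedFrom η₁ cost₁ ω A.numQueries [] := by
    intro ω
    have h := expectedFrom_two_point hA hκ hχ h₀ h₁ hclose hcost ω A.numQueries [] (by simp)
      zero_le_one zero_le_one
    simp only [ENNReal.ofReal_one, one_mul, Real.sqrt_one, mul_one] at h
    refine le_trans (ENNReal.ofReal_le_ofReal ?_) h
    have hb := one_add_mul_le_pow (a := -χ) (by linarith) A.numQueries
    rw [← sub_eq_add_neg] at hb
    have hq : (A.numQueries : ℝ) ≤ T := by exact_mod_cast hA.budget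
    have hq2 := mul_le_mul_of_nonneg_right hq hχ0
    have h3 : 1 / 4 ≤ (1 - χ) ^ A.numQueries - (1 + 1) / 4 := by linarith
    have h4 := mul_le_mul_of_nonneg_left h3 hκ
    linarith
  by_contra hcon
  push Not at hcon
  have hsum : ENNReal.ofReal (κ / 4) ≤ ∫⁻ ω, A.expectedFrom η₀ cost₀ ω A.numQueries [] ∂μ +
      ∫⁻ ω, A.expectedFrom η₁ cost₁ ω A.numQueries [] ∂μ := by
    rw [← lintegral_add_left (measurable_expectedFrom hA hη hcm _ _ (by simp))]
    calc ENNReal.ofReal (κ / 4) = ∫⁻ _, ENNReal.ofReal (κ / 4) ∂μ := by simp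
      _ ≤ _ := lintegral_mono hpt
  have hlt := ENNReal.add_lt_add hcon.1 hcon.2
  rw [← ENNReal.ofReal_add (by positivity) (by positivity),
    show κ / 8 + κ / 8 = κ / 4 by ring] at hlt
  exact absurd hsum (not_le.2 hlt)

end TwoPoint

/-! ### Uniform convexity of power functions -/

section Powers

variable {k : ℝ}

theorem abs_signed_power {k : ℝ} (hk : 1 < k) (t : ℝ) : |(|t| ^ (k - 2) * t)| = |t| ^ (k - 1) := by
  rcases eq_or_ne t 0 with rfl | ht
  · simp [Real.zero_rpow (by linarith : k - 1 ≠ 0)]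
  · rw [abs_mul, abs_of_nonneg (by positivity), ← Real.rpow_add_one (abs_ne_zero.2 ht)]
    congr 1; ring

theorem signed_power_mul_self (hk : 1 < k) (t : ℝ) : |t| ^ (k - 2) * t * t = |t| ^ k := by
  rcases eq_or_ne t 0 with rfl | ht
  · simp [Real.zero_rpow (by linarith : k ≠ 0)]
  · rw [mul_assoc, ← sq, ← sq_abs, ← Real.rpow_natCast, ← Real.rpow_add (abs_pos.2 ht)]
    congr 1; push_cast; ring

/-- Bernoulli's inequality for `|z| / |x|`; replacing `x * z` by `|x| * |z|` only helps. -/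
theorem abs_rpow_tangent_le (hk : 1 < k) (x z : ℝ) :
    |x| ^ k + k * (|x| ^ (k - 2) * x) * (z - x) ≤ |z| ^ k := by
  rcases eq_or_ne x 0 with rfl | hx
  · simp only [abs_zero, Real.zero_rpow (by linarith : k ≠ 0), mul_zero, zero_mul, add_zero]
    positivity
  have hx0 : 0 < |x| := abs_pos.2 hx
  have h1 := one_add_mul_self_le_rpow_one_add (s := |z| / |x| - 1)
    (by linarith [show 0 ≤ |z| / |x| by positivity]) hk.le
  rw [add_sub_cancel, Real.div_rpow (abs_nonneg _) hx0.le, le_div_iff₀ (by positivity)] at h1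
  have h2 : |x| ^ (k - 2) * x * z ≤ |x| ^ (k - 1) * |z| := by
    refine (le_abs_self _).trans ?_
    rw [abs_mul, abs_signed_power hk]
  have h3 := signed_power_mul_self hk x
  have h4 : |z| / |x| * |x| ^ k = |x| ^ (k - 1) * |z| := by
    rw [← abs_rpow_sub_one_mul hk]; field_simp
  have h5 : (1 + k * (|z| / |x| - 1)) * |x| ^ k =
      |x| ^ k + k * (|z| / |x| * |x| ^ k) - k * |x| ^ k := by ring
  rw [h5, h4] at h1
  have h6 := mul_le_mul_of_nonneg_left h2 (by linarith : 0 ≤ k)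
  calc _ = |x| ^ k + k * (|x| ^ (k - 2) * x * z) - k * (|x| ^ (k - 2) * x * x) := by ring
    _ ≤ _ := by rw [h3]; linarith

/-- Superadditivity of the power `k / 2` on squares, then the parallelogram law, then convexity of
that power. -/
theorem clarkson_real (hk : 2 ≤ k) (x y : ℝ) :
    |(x + y) / 2| ^ k + |(x - y) / 2| ^ k ≤ (|x| ^ k + |y| ^ k) / 2 := by
  have hsq : ∀ t : ℝ, |t| ^ k = (t ^ 2) ^ (k / 2) := by
    intro t
    rw [← sq_abs, sq_rpow (abs_nonneg _)]
    congr 1; ring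
  rw [hsq, hsq, hsq x, hsq y]
  refine (Real.add_rpow_le_rpow_add (sq_nonneg _) (sq_nonneg _) (by linarith)).trans ?_
  have h1 : ((x + y) / 2) ^ 2 + ((x - y) / 2) ^ 2 = (1 / 2) * x ^ 2 + (1 / 2) * y ^ 2 := by ring
  rw [h1]
  have := (convexOn_rpow (p := k / 2) (by linarith)).2 (sq_nonneg x : x ^ 2 ∈ Set.Ici 0)
    (sq_nonneg y : y ^ 2 ∈ Set.Ici 0) (by norm_num : (0 : ℝ) ≤ 1 / 2)
    (by norm_num : (0 : ℝ) ≤ 1 / 2) (by norm_num)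
  simp only [smul_eq_mul] at this
  linarith

/-- Clarkson's inequality yields the last term and a midpoint value, which the tangent at `x` bounds
from below. -/
theorem abs_rpow_uniformly_convex (hk : 2 ≤ k) (x y : ℝ) :
    |x| ^ k + k * (|x| ^ (k - 2) * x) * (y - x) + 2 ^ (1 - k) * |x - y| ^ k ≤ |y| ^ k := by
  have h1 := clarkson_real hk x y
  have h2 := abs_rpow_tangent_le (by linarith : 1 < k) x ((x + y) / 2)
  have h3 : 2 * |(x - y) / 2| ^ k = 2 ^ (1 - k) * |x - y| ^ k := by
    rw [abs_div, abs_two, Real.div_rpow (abs_nonneg _) zero_le_two, Real.rpow_sub two_pos,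
      Real.rpow_one]
    ring
  have h4 : (x + y) / 2 - x = (y - x) / 2 := by ring
  rw [h4] at h2
  rw [← h3]
  linarith

theorem norm_rpow_le_sum {d : ℕ} (hk : 2 ≤ k) (v : Point d) :
    ‖v‖ ^ k ≤ (d : ℝ) ^ (k / 2 - 1) * ∑ i, |v i| ^ k := by
  have h1 : ‖v‖ ^ k = (∑ i, v i ^ 2) ^ (k / 2) := by
    rw [← EuclideanSpace.real_norm_sq_eq, sq_rpow (norm_nonneg _)]
    congr 1; ring
  rw [h1]
  refine (Real.rpow_sum_le_const_mul_sum_rpow_of_nonneg Finset.univ (p := k / 2) (by linarith)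
    fun i _ => sq_nonneg (v i)).trans (le_of_eq ?_)
  rw [Finset.card_univ, Fintype.card_fin]
  congr 1
  refine Finset.sum_congr rfl fun i _ => ?_
  rw [← sq_abs, sq_rpow (abs_nonneg _)]
  congr 1; ring

end Powers

/-! ### Separable power functions on the cube -/

section Separable

variable {d : ℕ} {k K s : ℝ}

/-- `K ∑ᵢ |xᵢ - mᵢ|^k`. -/
noncomputable def sepPower (K k : ℝ) (m x : Point d) : ℝ := K * ∑ i, |x i - m i| ^ k

/-- The gradient of `sepPower`. -/
noncomputable def sepPowerGrad (K k : ℝ) (m x : Point d) : Point d :=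
  WithLp.toLp 2 fun i => K * (k * (|x i - m i| ^ (k - 2) * (x i - m i)))

theorem sepPowerGrad_apply (m x : Point d) (i : Fin d) :
    sepPowerGrad K k m x i = K * (k * (|x i - m i| ^ (k - 2) * (x i - m i))) := rfl

theorem abs_sepPowerGrad (hk : 1 < k) (hK : 0 ≤ K) (m x : Point d) (i : Fin d) :
    |sepPowerGrad K k m x i| = K * k * |x i - m i| ^ (k - 1) := by
  rw [sepPowerGrad_apply, abs_mul, abs_mul, abs_signed_power hk, abs_of_nonneg hK,
    abs_of_nonneg (by linarith : 0 ≤ k), mul_assoc]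

theorem isGradientOn_sepPower (hk : 1 < k) (S : Set (Point d)) (m : Point d) :
    IsGradientOn S (sepPower K k m) (sepPowerGrad K k m) := by
  intro x _
  refine HasFDerivAt.hasFDerivWithinAt ?_
  have h1 : ∀ i : Fin d, HasFDerivAt (fun y : Point d => |y i - m i| ^ k)
      ((k * |x i - m i| ^ (k - 2) * (x i - m i)) • (EuclideanSpace.proj i : Point d →L[ℝ] ℝ)) x := by
    intro i
    have h2 : HasFDerivAt (fun y : Point d => y i - m i)
        (EuclideanSpace.proj i : Point d →L[ℝ] ℝ) x :=
      (EuclideanSpace.proj i : Point d →L[ℝ] ℝ).hasFDerivAt.sub_const (m i)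
    exact (hasDerivAt_abs_rpow (x i - m i) hk).comp_hasFDerivAt x h2
  have h3 := (HasFDerivAt.fun_sum fun i (_ : i ∈ Finset.univ) => h1 i).const_mul K
  refine h3.congr_fderiv ?_
  ext v
  simp only [FunLike.coe_smul, Pi.smul_apply, FunLike.coe_sum, Finset.sum_apply, smul_eq_mul,
    InnerProductSpace.toDual_apply_apply]
  rw [PiLp.inner_apply, Finset.mul_sum]
  refine Finset.sum_congr rfl fun i _ => ?_
  have hv : (EuclideanSpace.proj i : Point d →L[ℝ] ℝ) v = v i := rfl
  simp only [RCLike.inner_apply, conj_trivial, sepPowerGrad_apply, hv]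
  ring

theorem isUC_sepPower (hk : 2 ≤ k) (hK : 0 ≤ K) {lam : ℝ}
    (hlam : lam / 2 * (d : ℝ) ^ (k / 2 - 1) ≤ K * 2 ^ (1 - k)) (hlam0 : 0 ≤ lam)
    (S : Set (Point d)) (m : Point d) :
    IsUC S (sepPower K k m) (sepPowerGrad K k m) k lam := by
  intro x _ y _
  have h1 : lam / 2 * ‖x - y‖ ^ k ≤ K * ∑ i, 2 ^ (1 - k) * |x i - y i| ^ k := by
    calc lam / 2 * ‖x - y‖ ^ k ≤ lam / 2 * ((d : ℝ) ^ (k / 2 - 1) * ∑ i, |x i - y i| ^ k) := by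
          gcongr
          simpa using norm_rpow_le_sum hk (x - y)
      _ = lam / 2 * (d : ℝ) ^ (k / 2 - 1) * ∑ i, |x i - y i| ^ k := by ring
      _ ≤ K * 2 ^ (1 - k) * ∑ i, |x i - y i| ^ k := by gcongr
      _ = _ := by rw [← Finset.mul_sum, mul_assoc]
  have h2 : inner ℝ (sepPowerGrad K k m x) (y - x) =
      K * ∑ i, k * (|x i - m i| ^ (k - 2) * (x i - m i)) * (y i - x i) := by
    rw [PiLp.inner_apply, Finset.mul_sum]
    refine Finset.sum_congr rfl fun i _ => ?_
    simp only [RCLike.inner_apply, conj_trivial, sepPowerGrad_apply, PiLp.sub_apply]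
    ring
  rw [h2]
  unfold sepPower
  calc _ ≤ K * ∑ i, |x i - m i| ^ k +
        K * ∑ i, k * (|x i - m i| ^ (k - 2) * (x i - m i)) * (y i - x i) +
          K * ∑ i, 2 ^ (1 - k) * |x i - y i| ^ k := by gcongr
    _ = K * ∑ i, (|x i - m i| ^ k + k * (|x i - m i| ^ (k - 2) * (x i - m i)) * (y i - x i) +
          2 ^ (1 - k) * |x i - y i| ^ k) := by
        rw [Finset.sum_add_distrib, Finset.sum_add_distrib]; ring
    _ ≤ _ := by
        gcongr with i
        have := abs_rpow_uniformly_convex hk (x i - m i) (y i - m i)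
        simpa using this

theorem along_apply_self (x : Point d) (j : Fin d) (α : ℝ) : along x j α j = x j + α := by
  simp [along]

theorem along_apply_ne (x : Point d) {i j : Fin d} (h : i ≠ j) (α : ℝ) : along x j α i = x i := by
  simp [along, h]

/-- Along direction `j` the minimum is where coordinate `j` equals `m j`, a point that the line
attains within the cube. -/
theorem isLkSS_sepPower (hk : 1 < k) (hK : 0 < K) {Lam : ℝ} (hLam : K * k ≤ Lam) {m : Point d}
    (hm : m ∈ cube d s) :
    IsLkSS (cube d s) (sepPower K k m) (sepPowerGrad K k m) k Lam := by
  intro x hx j α hα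
  have hα' : α = m j - x j := by
    have h1 := hα.2 (m j - x j) (by
      intro i
      by_cases hij : i = j
      · subst hij; rw [along_apply_self]; simpa using hm i
      · rw [along_apply_ne x hij]; exact hx i)
    have h2 : ∀ β, sepPower K k m (along x j β) =
        K * (|x j + β - m j| ^ k + ∑ i ∈ Finset.univ.erase j, |x i - m i| ^ k) := by
      intro β
      rw [sepPower, ← Finset.add_sum_erase _ _ (Finset.mem_univ j), along_apply_self]
      congr 2
      exact Finset.sum_congr rfl fun i hi => by rw [along_apply_ne x (Finset.ne_of_mem_erase hi)]
    rw [h2, h2] at h1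
    have h3 := le_of_mul_le_mul_left h1 hK
    rw [show x j + (m j - x j) - m j = 0 by ring, abs_zero, Real.zero_rpow (by linarith)] at h3
    have h4 : |x j + α - m j| ^ k = 0 := le_antisymm (by linarith) (by positivity)
    rw [Real.rpow_eq_zero (abs_nonneg _) (by linarith), abs_eq_zero] at h4
    linarith
  have h5 : ‖x - along x j α‖ = |x j - m j| := by
    have := norm_along_sub_along x j 0 α
    rw [along_zero] at this
    rw [this, hα']
    congr 1; ring
  rw [h5, abs_sepPowerGrad hk hK.le]
  gcongr

theorem sepPower_self (hk : 1 < k) (m : Point d) : sepPower K k m m = 0 := by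
  simp [sepPower, Real.zero_rpow (by linarith : k ≠ 0)]

theorem sepPower_nonneg (hK : 0 ≤ K) (m x : Point d) : 0 ≤ sepPower K k m x :=
  mul_nonneg hK (Finset.sum_nonneg fun _ _ => by positivity)

theorem le_sepPower (hK : 0 ≤ K) (m x : Point d) (i : Fin d) :
    K * |x i - m i| ^ k ≤ sepPower K k m x :=
  mul_le_mul_of_nonneg_left (Finset.single_le_sum (f := fun i => |x i - m i| ^ k)
    (fun _ _ => by positivity) (Finset.mem_univ i)) hK

end Separable

/-! ### Two oracles that are hard to tell apart -/

section HardOracles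

variable {d : ℕ} {k K s A δ t : ℝ}

open Classical in
/-- Bias of the oracle for a minimum at `δ`: the signed power of the distance to `δ` for `t ≤ 2δ`,
and that of the distance to `0` beyond. -/
noncomputable def signBias (A k δ t : ℝ) : ℝ :=
  if t ≤ 2 * δ then A * (|t - δ| ^ (k - 2) * (t - δ)) else A * (|t| ^ (k - 2) * t)

theorem signBias_zero : signBias A k 0 t = A * (|t| ^ (k - 2) * t) := by
  simp [signBias]

theorem measurable_signBias : Measurable (signBias A k δ) := by
  classical
  unfold signBias
  refine Measurable.ite measurableSet_Iic ?_ ?_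
  · exact (((measurable_id.sub_const δ).abs.pow_const _).mul (measurable_id.sub_const δ)).const_mul A
  · exact ((measurable_id.abs.pow_const _).mul measurable_id).const_mul A

theorem signBias_pos (hA : 0 < A) (hδ : 0 ≤ δ) (h : δ < t) : 0 < signBias A k δ t := by
  unfold signBias
  have h1 : 0 < t - δ := by linarith
  have h2 : 0 < t := by linarith
  split_ifs
  · have := abs_pos.2 h1.ne'
    positivity
  · have := abs_pos.2 h2.ne'
    positivity

theorem signBias_neg (hA : 0 < A) (ht : 0 ≤ t) (h : t < δ) : signBias A k δ t < 0 := by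
  unfold signBias
  rw [if_pos (by linarith)]
  have h1 : t - δ < 0 := by linarith
  have := abs_pos.2 h1.ne
  exact mul_neg_of_pos_of_neg hA (mul_neg_of_pos_of_neg (by positivity) h1)

/-- Beyond `2 * δ` the distances to `0` and to `δ` differ by a factor of at most `2`, so the switch
costs only `2 ^ (k - 1)` in the ratio of the oracle constants. -/
theorem abs_signBias_bounds (hk : 1 < k) (hA : 0 ≤ A) (hδ : 0 ≤ δ) :
    A * |t - δ| ^ (k - 1) ≤ |signBias A k δ t| ∧
      |signBias A k δ t| ≤ A * 2 ^ (k - 1) * |t - δ| ^ (k - 1) := by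
  have hk0 : 0 ≤ k - 1 := by linarith
  unfold signBias
  split_ifs with h
  · rw [abs_mul, abs_signed_power hk, abs_of_nonneg hA]
    refine ⟨le_rfl, ?_⟩
    gcongr
    exact le_mul_of_one_le_right hA (Real.one_le_rpow one_le_two hk0)
  · push Not at h
    rw [abs_mul, abs_signed_power hk, abs_of_nonneg hA, abs_of_pos (by linarith : 0 < t),
      abs_of_pos (by linarith : 0 < t - δ), mul_assoc, ← Real.mul_rpow zero_le_two (by linarith)]
    constructor
    · gcongr
      · linarith
      · linarith
    · gcongr
      · linarith
      · linarith

/-- This amplitude keeps the answer probabilities in `[1/4, 3/4]`, as `affinity_ge` requires. -/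
theorem abs_signBias_le (hk : 1 < k) (hs : 0 < s) (hδ : δ ∈ Set.Icc 0 s) (ht : t ∈ Set.Icc 0 s) :
    |signBias (1 / (4 * s ^ (k - 1))) k δ t| ≤ 1 / 4 := by
  have hk0 : 0 ≤ k - 1 := by linarith
  have hsk : 0 < s ^ (k - 1) := by positivity
  have key : ∀ u : ℝ, |u| ≤ s → |1 / (4 * s ^ (k - 1)) * (|u| ^ (k - 2) * u)| ≤ 1 / 4 := by
    intro u hu
    rw [abs_mul, abs_signed_power hk, abs_of_nonneg (by positivity)]
    calc 1 / (4 * s ^ (k - 1)) * |u| ^ (k - 1) ≤ 1 / (4 * s ^ (k - 1)) * s ^ (k - 1) := by gcongr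
      _ = 1 / 4 := by field_simp
  unfold signBias
  split_ifs
  · exact key _ (abs_le.2 ⟨by linarith [ht.1, hδ.2], by linarith [ht.2, hδ.1]⟩)
  · exact key _ (abs_le.2 ⟨by linarith [ht.1], ht.2⟩)

/-- The two biases coincide beyond `2 * δ`; before it each is at most `A * (2 * δ) ^ (k - 1)` in
size. -/
theorem sq_signBias_sub_le (hk : 1 < k) (hA : 0 ≤ A) (hδ : 0 ≤ δ) (ht : 0 ≤ t) :
    (signBias A k 0 t - signBias A k δ t) ^ 2 ≤ 4 * A ^ 2 * (2 * δ) ^ (2 * k - 2) := by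
  have hk0 : 0 ≤ k - 1 := by linarith
  rw [signBias_zero]
  unfold signBias
  split_ifs with h
  · have h1 : |A * (|t| ^ (k - 2) * t)| ≤ A * (2 * δ) ^ (k - 1) := by
      rw [abs_mul, abs_signed_power hk, abs_of_nonneg hA, abs_of_nonneg ht]
      gcongr
    have h2 : |A * (|t - δ| ^ (k - 2) * (t - δ))| ≤ A * (2 * δ) ^ (k - 1) := by
      rw [abs_mul, abs_signed_power hk, abs_of_nonneg hA]
      gcongr
      exact abs_le.2 ⟨by linarith, by linarith⟩
    have h3 := (abs_sub _ _).trans (add_le_add h1 h2)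
    have h4 : (2 * δ) ^ (2 * k - 2) = ((2 * δ) ^ (k - 1)) ^ 2 := by
      rw [rpow_sq (by positivity)]; congr 1; ring
    rw [← sq_abs, h4]
    calc _ ≤ (A * (2 * δ) ^ (k - 1) + A * (2 * δ) ^ (k - 1)) ^ 2 := by gcongr
      _ = _ := by ring
  · rw [sub_self, zero_pow two_ne_zero]
    positivity

/-- The oracle for `sepPower` with minimum `m`. -/
noncomputable def sepOracle (A k : ℝ) (m x : Point d) (j : Fin d) : unitInterval :=
  Set.projIcc 0 1 zero_le_one (1 / 2 + signBias A k (m j) (x j))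

theorem measurable_sepOracle (m : Point d) (j : Fin d) :
    Measurable fun x => sepOracle A k m x j := by
  refine continuous_projIcc.measurable.comp (Measurable.const_add (measurable_signBias.comp ?_) _)
  exact (EuclideanSpace.proj j : Point d →L[ℝ] ℝ).continuous.measurable

theorem coe_sepOracle (hk : 1 < k) (hs : 0 < s) {m x : Point d} (hm : m ∈ cube d s)
    (hx : x ∈ cube d s) (j : Fin d) :
    (sepOracle (1 / (4 * s ^ (k - 1))) k m x j : ℝ) =
      1 / 2 + signBias (1 / (4 * s ^ (k - 1))) k (m j) (x j) := by
  have h := abs_le.1 (abs_signBias_le hk hs (hm j) (hx j))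
  rw [sepOracle, Set.projIcc_of_mem _ ⟨by linarith, by linarith⟩]

theorem isSignOracle_sepOracle (hk : 1 < k) (hs : 0 < s) (hK : 0 < K) {m : Point d}
    (hm : m ∈ cube d s) (τ : ℝ) :
    IsSignOracle (cube d s) (sepPowerGrad K k m) (sepOracle (1 / (4 * s ^ (k - 1))) k m)
      (1 / (4 * s ^ (k - 1)) / (K * k)) (1 / (4 * s ^ (k - 1)) * 2 ^ (k - 1) / (K * k)) τ where
  measurable j := measurable_sepOracle m j
  pos x hx j h := by
    rw [coe_sepOracle hk hs hm hx]
    have : m j < x j := by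
      by_contra hle
      rw [sepPowerGrad_apply] at h
      have h1 : K * (k * (|x j - m j| ^ (k - 2) * (x j - m j))) ≤ 0 :=
        mul_nonpos_of_nonneg_of_nonpos hK.le (mul_nonpos_of_nonneg_of_nonpos (by linarith)
          (mul_nonpos_of_nonneg_of_nonpos (by positivity) (by linarith)))
      linarith
    linarith [signBias_pos (A := 1 / (4 * s ^ (k - 1))) (k := k) (by positivity) (hm j).1 this]
  neg x hx j h := by
    rw [coe_sepOracle hk hs hm hx]
    have : x j < m j := by
      by_contra hle
      rw [sepPowerGrad_apply] at h
      have h0 : 0 ≤ x j - m j := by linarith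
      have h1 : 0 ≤ K * (k * (|x j - m j| ^ (k - 2) * (x j - m j))) := by positivity
      linarith
    linarith [signBias_neg (A := 1 / (4 * s ^ (k - 1))) (k := k) (by positivity) (hx j).1 this]
  order x hx j _ := by
    rw [coe_sepOracle hk hs hm hx, add_sub_cancel_left, abs_sepPowerGrad hk hK.le]
    have h := abs_signBias_bounds (A := 1 / (4 * s ^ (k - 1))) (t := x j) hk (by positivity)
      (hm j).1
    have hKk : K * k ≠ 0 := by positivity
    refine ⟨le_trans (le_of_eq ?_) h.1, h.2.trans (le_of_eq ?_)⟩ <;> field_simp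

theorem sign_oracle_lower_bound {d : ℕ} (hd : 1 ≤ d) {s k lam τ : ℝ} (hs : 0 < s) (hk : 2 ≤ k)
    (hlam : 0 < lam) :
    ∃ Lam a b c₀ : ℝ, lam / 2 < Lam ∧ 0 < a ∧ a ≤ b ∧ 0 < c₀ ∧
      ∀ T : ℕ, 1 ≤ T →
      ∀ (Ω : Type*) [MeasurableSpace Ω] (μ : Measure Ω) [IsProbabilityMeasure μ]
        (A : SignAlgorithm d Ω), A.IsAdmissible (cube d s) T →
        ∃ (f : Point d → ℝ) (g : Point d → Point d) (η : Point d → Fin d → unitInterval)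
          (xstar : Point d), IsGradientOn (cube d s) f g ∧ IsUC (cube d s) f g k lam ∧
          IsLkSS (cube d s) f g k Lam ∧ IsSignOracle (cube d s) g η a b τ ∧
          xstar ∈ cube d s ∧ IsMinOn f (cube d s) xstar ∧
          ENNReal.ofReal (c₀ * (T : ℝ) ^ (-(k / (2 * k - 2)))) ≤
            A.expectedError μ η f xstar := by
  have hk1 : 1 < k := by linarith
  have hd' : (1 : ℝ) ≤ d := by exact_mod_cast hd
  -- `d ^ (k / 2 - 1)` compensates the passage from the Euclidean norm to the sum of powers, `2 ^ (k
  -- - 1)` the modulus of convexity of one power.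
  obtain ⟨K, hKdef⟩ : ∃ K : ℝ, K = lam / 2 * (d : ℝ) ^ (k / 2 - 1) * 2 ^ (k - 1) := ⟨_, rfl⟩
  have hK : 0 < K := by rw [hKdef]; positivity
  have hKlam : lam / 2 * (d : ℝ) ^ (k / 2 - 1) ≤ K * 2 ^ (1 - k) := by
    have : (2 : ℝ) ^ (k - 1) * 2 ^ (1 - k) = 1 := by
      rw [← Real.rpow_add two_pos]; simp
    rw [hKdef, mul_assoc _ ((2 : ℝ) ^ (k - 1)), this, mul_one]
  obtain ⟨B, hB⟩ : ∃ B : ℝ, B = 1 / (4 * s ^ (k - 1)) := ⟨_, rfl⟩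
  have hB0 : 0 < B := by rw [hB]; positivity
  -- The maximum with `lam` only secures `lam / 2 < Lam`.
  refine ⟨max (K * k) lam, B / (K * k), B * 2 ^ (k - 1) / (K * k), K * (s / 4) ^ k / 8,
    lt_of_lt_of_le (by linarith) (le_max_right _ _), by positivity, ?_, by positivity, ?_⟩
  · gcongr
    exact le_mul_of_one_le_right hB0.le (Real.one_le_rpow one_le_two (by linarith))
  intro T hT Ω _ μ _ A hA
  have hT0 : (0 : ℝ) < T := by exact_mod_cast hT
  have h2k : 0 < 2 * k - 2 := by linarith
  -- A separation of the order that `T` queries cannot detect: it makes the squared difference of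
  -- the oracles at most `1 / (4 * T)`.
  set δ := s / 2 * (T : ℝ) ^ (-(1 / (2 * k - 2))) with hδ
  have hδ0 : 0 < δ := by positivity
  have hδs : δ ≤ s := by
    have : (T : ℝ) ^ (-(1 / (2 * k - 2))) ≤ 1 :=
      Real.rpow_le_one_of_one_le_of_nonpos (by exact_mod_cast hT)
        (neg_nonpos.2 (by positivity))
    calc δ ≤ s / 2 * 1 := by rw [hδ]; gcongr
      _ ≤ s := by linarith
  let j₀ : Fin d := ⟨0, hd⟩
  let m : Point d := EuclideanSpace.single j₀ δ
  have hmj : ∀ j, m j = 0 ∨ (j = j₀ ∧ m j = δ) := by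
    intro j
    by_cases hj : j = j₀
    · right; subst hj; simp [m]
    · left; simp [m, hj]
  have hmc : m ∈ cube d s := by
    intro j
    rcases hmj j with h | ⟨-, h⟩
    · rw [h]; exact ⟨le_rfl, hs.le⟩
    · rw [h]; exact ⟨hδ0.le, hδs⟩
  have h0c : (0 : Point d) ∈ cube d s := fun j => ⟨le_rfl, hs.le⟩
  set χ := 1 / (4 * (T : ℝ)) with hχ
  have hχeq : 4 * B ^ 2 * (2 * δ) ^ (2 * k - 2) = χ := by
    have h1 : 2 * δ = s * (T : ℝ) ^ (-(1 / (2 * k - 2))) := by rw [hδ]; ring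
    have h2 : ((T : ℝ) ^ (-(1 / (2 * k - 2)))) ^ (2 * k - 2) = (T : ℝ)⁻¹ := by
      rw [← Real.rpow_mul hT0.le, ← Real.rpow_neg_one]
      rw [neg_mul, one_div_mul_cancel h2k.ne']
    have h3 : s ^ (2 * k - 2) = (s ^ (k - 1)) ^ 2 := by
      rw [rpow_sq hs.le]; congr 1; ring
    rw [h1, Real.mul_rpow hs.le (by positivity), h2, h3, hB, hχ]
    have : s ^ (k - 1) ≠ 0 := by positivity
    field_simp
  have hclose : ∀ x ∈ cube d s, ∀ j,
      ((sepOracle B k 0 x j : ℝ) - sepOracle B k m x j) ^ 2 ≤ χ := by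
    intro x hx j
    rw [hB, coe_sepOracle hk1 hs h0c hx, coe_sepOracle hk1 hs hmc hx, ← hB,
      add_sub_add_left_eq_sub]
    have h00 : (0 : Point d) j = 0 := rfl
    rw [h00]
    rcases hmj j with h | ⟨-, h⟩
    · rw [h, sub_self, zero_pow two_ne_zero]
      positivity
    · rw [h, ← hχeq]
      exact sq_signBias_sub_le hk1 hB0.le hδ0.le (hx j).1
  have hbias : ∀ m' ∈ cube d s, ∀ x ∈ cube d s, ∀ j,
      |(sepOracle B k m' x j : ℝ) - 1 / 2| ≤ 1 / 4 := by
    intro m' hm' x hx j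
    rw [hB, coe_sepOracle hk1 hs hm' hx, add_sub_cancel_left]
    exact abs_signBias_le hk1 hs (hm' j) (hx j)
  -- In coordinate `j₀` no point is closer than `δ / 2` to both minima.
  have hcost : ∀ x ∈ cube d s, ENNReal.ofReal (K * (δ / 2) ^ k) ≤
      ENNReal.ofReal (sepPower K k 0 x - sepPower K k (0 : Point d) 0) +
        ENNReal.ofReal (sepPower K k m x - sepPower K k m m) := by
    intro x _
    rw [sepPower_self hk1, sepPower_self hk1, sub_zero, sub_zero,
      ← ENNReal.ofReal_add (sepPower_nonneg hK.le _ _) (sepPower_nonneg hK.le _ _)]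
    refine ENNReal.ofReal_le_ofReal ?_
    have h1 := le_sepPower (k := k) hK.le 0 x j₀
    have h2 := le_sepPower (k := k) hK.le m x j₀
    have hm0 : m j₀ = δ := by simp [m]
    have h00 : (0 : Point d) j₀ = 0 := rfl
    rw [h00, sub_zero] at h1
    rw [hm0] at h2
    rcases le_total (δ / 2) (x j₀) with h | h
    · have h3 : K * (δ / 2) ^ k ≤ K * |x j₀| ^ k := by
        gcongr
        exact h.trans (le_abs_self _)
      linarith [sepPower_nonneg (k := k) hK.le m x]
    · have h3 : K * (δ / 2) ^ k ≤ K * |x j₀ - δ| ^ k := by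
        gcongr
        exact le_trans (by linarith) (neg_le_abs _)
      linarith [sepPower_nonneg (k := k) hK.le 0 x]
  have hrate : K * (δ / 2) ^ k / 8 =
      K * (s / 4) ^ k / 8 * (T : ℝ) ^ (-(k / (2 * k - 2))) := by
    have h1 : δ / 2 = s / 4 * (T : ℝ) ^ (-(1 / (2 * k - 2))) := by rw [hδ]; ring
    rw [h1, Real.mul_rpow (by positivity) (by positivity), ← Real.rpow_mul hT0.le,
      show -(1 / (2 * k - 2)) * k = -(k / (2 * k - 2)) by ring]
    ring
  have hcm : Measurable fun x : Point d =>
      ENNReal.ofReal (sepPower K k 0 x - sepPower K k (0 : Point d) 0) := by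
    have hcont : Continuous (sepPower K k (0 : Point d)) :=
      continuousOn_univ.1 (isGradientOn_sepPower hk1 Set.univ 0).continuousOn
    exact (hcont.measurable.sub_const _).ennreal_ofReal
  have hχ1 : χ ≤ 1 := by
    have : (1 : ℝ) ≤ T := by exact_mod_cast hT
    rw [hχ, div_le_one (by positivity)]
    linarith
  have htwo := lintegral_two_point μ hA (κ := K * (δ / 2) ^ k) (χ := χ) (by positivity)
    (by positivity) hχ1 (by rw [hχ]; field_simp; rfl) (fun j => measurable_sepOracle 0 j) hcm
    (hbias 0 h0c) (hbias m hmc) hclose hcost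
  rw [hrate] at htwo
  have hfinal : ∀ m' ∈ cube d s, ENNReal.ofReal (K * (s / 4) ^ k / 8 *
      (T : ℝ) ^ (-(k / (2 * k - 2)))) ≤ A.expectedError μ (sepOracle B k m') (sepPower K k m') m' →
      ∃ (f : Point d → ℝ) (g : Point d → Point d) (η : Point d → Fin d → unitInterval)
        (xstar : Point d), IsGradientOn (cube d s) f g ∧ IsUC (cube d s) f g k lam ∧
        IsLkSS (cube d s) f g k (max (K * k) lam) ∧ IsSignOracle (cube d s) g η (B / (K * k))
          (B * 2 ^ (k - 1) / (K * k)) τ ∧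
        xstar ∈ cube d s ∧ IsMinOn f (cube d s) xstar ∧
        ENNReal.ofReal (K * (s / 4) ^ k / 8 * (T : ℝ) ^ (-(k / (2 * k - 2)))) ≤
          A.expectedError μ η f xstar := by
    intro m' hm' h
    refine ⟨sepPower K k m', sepPowerGrad K k m', sepOracle B k m', m',
      isGradientOn_sepPower hk1 _ _, isUC_sepPower hk hK.le hKlam hlam.le _ _,
      isLkSS_sepPower hk1 hK (le_max_left _ _) hm', ?_, hm', ?_, h⟩
    · rw [hB]
      exact isSignOracle_sepOracle hk1 hs hK hm' τ
    · intro x _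
      rw [Set.mem_ofPred_eq, sepPower_self hk1]
      exact sepPower_nonneg hK.le _ _
  rcases htwo with h | h
  · exact hfinal 0 h0c h
  · exact hfinal m hmc h

end HardOracles

theorem theorem2 (d : ℕ) (hd : 1 ≤ d) :
    -- upper bound for `k`-uniformly convex functions with local `k`-strong smoothness
    (∀ R c k lam Lam a b τ : ℝ, 0 < R → 2 < c ^ 2 → 2 ≤ k → 0 < lam → lam / 2 < Lam →
      0 < a → a ≤ b → 0 < τ →
      ∃ (C : ℝ) (p : ℕ), ∀ S : Set (Point d), IsCompact S → Convex ℝ S → Metric.diam S ≤ R →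
        ∀ x₀ ∈ S, ∀ T : ℕ, 2 ≤ T →
          (rsscd S R c x₀ T).IsAdmissible S T ∧
          ∀ (f : Point d → ℝ) (g : Point d → Point d) (η : Point d → Fin d → unitInterval)
            (xstar : Point d), IsGradientOn S f g → IsUC S f g k lam → IsLkSS S f g k Lam →
            IsSignOracle S g η a b τ → xstar ∈ S → IsMinOn f S xstar →
            (rsscd S R c x₀ T).expectedError (cdSeedLaw d) η f xstar ≤
              ENNReal.ofReal (C * Real.log T ^ p * (T : ℝ) ^ (-(k / (2 * k - 2))))) ∧
    -- the rate is minimax: no algorithm that queries a sign oracle does better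
    (∀ s k lam τ : ℝ, 0 < s → 2 ≤ k → 0 < lam → 0 < τ →
      ∃ Lam a b c₀ : ℝ, lam / 2 < Lam ∧ 0 < a ∧ a ≤ b ∧ 0 < c₀ ∧
        ∀ T : ℕ, 1 ≤ T →
        ∀ (Ω : Type*) [MeasurableSpace Ω] (μ : Measure Ω) [IsProbabilityMeasure μ]
          (A : SignAlgorithm d Ω), A.IsAdmissible (cube d s) T →
          ∃ (f : Point d → ℝ) (g : Point d → Point d) (η : Point d → Fin d → unitInterval)
            (xstar : Point d), IsGradientOn (cube d s) f g ∧ IsUC (cube d s) f g k lam ∧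
            IsLkSS (cube d s) f g k Lam ∧ IsSignOracle (cube d s) g η a b τ ∧
            xstar ∈ cube d s ∧ IsMinOn f (cube d s) xstar ∧
            ENNReal.ofReal (c₀ * (T : ℝ) ^ (-(k / (2 * k - 2)))) ≤
              A.expectedError μ η f xstar) ∧
    -- strongly convex and strongly smooth functions
    (∀ R c lam H a b τ : ℝ, 0 < R → 2 < c ^ 2 → 0 < lam → lam < H → 0 < a → a ≤ b → 0 < τ →
      ∃ (C : ℝ) (p : ℕ), ∀ S : Set (Point d), IsCompact S → Convex ℝ S → Metric.diam S ≤ R →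
        ∀ x₀ ∈ S, ∀ T : ℕ, 2 ≤ T →
          ∀ (f : Point d → ℝ) (g : Point d → Point d) (η : Point d → Fin d → unitInterval)
            (xstar : Point d), IsGradientOn S f g → IsUC S f g 2 lam → IsStronglySmooth S g H →
            DirMinStationary S f g → IsSignOracle S g η a b τ → xstar ∈ S → IsMinOn f S xstar →
            (rsscd S R c x₀ T).expectedError (cdSeedLaw d) η f xstar ≤
              ENNReal.ofReal (C * Real.log T ^ p / T)) := by
  refine ⟨?_, ?_, ?_⟩
  · intro R c k lam Lam a b τ hR hc hk hlam hLam ha _ hτ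
    obtain ⟨C, p, h⟩ := rsscd_rate (b := b) hd hR hc hk hlam hLam ha hτ
    refine ⟨C, p, fun S hS hcv hdiam x₀ hx₀ T hT => ⟨?_, ?_⟩⟩
    · exact isAdmissible_rsscd hS hcv hR.le c hx₀ T
    · exact h S hS hcv hdiam x₀ hx₀ T hT
  · intro s k lam τ hs hk hlam _
    exact sign_oracle_lower_bound hd hs hk hlam
  · intro R c lam H a b τ hR hc hlam hH ha _ hτ
    obtain ⟨C, p, h⟩ := rsscd_rate (b := b) hd hR hc le_rfl hlam
      (show lam / 2 < H by linarith) ha hτ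
    refine ⟨C, p, fun S hS hcv hdiam x₀ hx₀ T hT f g η xstar hg huc hsm hst hη hx hmin => ?_⟩
    refine (h S hS hcv hdiam x₀ hx₀ T hT f g η xstar hg huc (hsm.isLkSS hst) hη hx hmin).trans_eq ?_
    rw [show -((2 : ℝ) / (2 * 2 - 2)) = -1 by norm_num, Real.rpow_neg_one, div_eq_mul_inv]
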